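/- **Setting.** Let $d\ge 2$, let $E=\mathbb Z$ (with counting measure $\lambda$) or $E=\mathbb R$ (with Lebesgue measure $\lambda$), let $\mathcal L\subset\mathbb Z^d$ be a full-rank sublattice, and let $d_1$ be the graph metric of the square lattice. $\Omega$ is the set of functions $\phi:\mathbb Z^d\to E$, and for $v\in\mathcal L$ put $(\theta_v\phi)(y)=\phi(y+v)$. For $\Lambda\subset\mathbb Z^d$ let $\mathcal F^\nabla_\Lambda=\sigma(\phi(y)-\phi(x):x,y\in\Lambda)$ and $\mathcal F^\nabla=\mathcal F^\nabla_{\mathbb Z^d}$. Let $\mathcal P_{\mathcal L}(\Omega,\mathcal F^\nabla)$ be the set of probability measures on $(\Omega,\mathcal F^\nabla)$ invariant under all $\theta_v$, $v\in\mathcal L$. **Potentials.** A *periodic gradient potential* is a family $\Phi=(\Phi_\Lambda)$, indexed by the finite sets $\Lambda\subset\mathbb Z^d$, of $\mathcal F_\Lambda^\nabla$-measurable functions $\Phi_\Lambda:\Omega\to\mathbb R\cup\{\infty\}$ with $\Phi_\Lambda\equiv0$ if $|\Lambda|\le1$ and $\Phi_{\Lambda+v}(\phi)=\Phi_\Lambda(\theta_v\phi)$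 for $v\in\mathcal L$. **Local Lipschitz constraints.** An *admissible graph* $\mathbb A$ is an $\mathcal L$-invariant connected graph of bounded degree on $\mathbb Z^d$. An *admissible quasimetric* is an $\mathcal L$-invariant $q:\mathbb Z^d\times\mathbb Z^d\to\mathbb R$ with $q(x,x)=0$, $q(x,y)+q(y,x)>0$ for $x\ne y$, and $q(x,z)\le q(x,y)+q(y,z)$. A *local Lipschitz constraint* is a pair $(\mathbb A,q)$ of these such that $p\le q$ for every admissible quasimetric $p$ with $p\le q$ on the edges of $\mathbb A$. For $\varepsilon>0$, $q_\varepsilon$ is the largest admissible quasimetric that is $\le q-\varepsilon$ on the edges of $\mathbb A$ (if it exists). $U_q$ is the interior of the set of slopes $u\in(\mathbb R^d)^*$ with $u(y)-u(x)\le q(x,y)$ for all $x,y\in\mathcal L$. **Strong and weak interactions.** A *strong interaction* $\Psi$ with constraint $(\mathbb A,q)$ is a periodic gradient potential such that: $\Psi_\Lambda\ge0$; $\Psi_\Lambda\equiv0$ if the $d_1$-diameter of $\Lambda$ exceeds some $R$; $\Psi_\Lambda(\phi)=\infty$ if and only if $\Lambda=\{x,y\}$ is an edge of $\mathbb A$ with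 $\phi(y)-\phi(x)>q(x,y)$ for some $x,y$; if $E=\mathbb Z$, $q$ is integer-valued; and if $E=\mathbb R$, for every sufficiently small $\varepsilon>0$ there is $C_\varepsilon<\infty$ with $\sum_{\Lambda\ni x}\Psi_\Lambda(\phi)\le C_\varepsilon$ for all $x\in\mathbb Z^d$ and all $\phi\in\Omega$ satisfying the $q_\varepsilon$-Lipschitz inequalities on the edges of $\mathbb A$ at $x$. A *weak interaction* $\Xi$ is a periodic gradient potential with $\sup_{x,\phi}\sum_{\Lambda\ni x}|\Xi_\Lambda(\phi)|<\infty$ for which $e^-(\Lambda)=\sup_\phi\sum_{\Delta\cap\Lambda\neq\emptyset,\ \Delta\not\subset\Lambda}|\Xi_\Delta(\phi)|$ is finite, $\mathcal L$-invariant, satisfies $e^-(\Lambda\cup\Delta)\le e^-(\Lambda)+e^-(\Delta)$ for disjoint $\Lambda,\Delta$, and satisfies $e^-(\Lambda_n)=o(|\Lambda_n|)$ whenever $|\Lambda_n|\to\infty$ and $|\partial\Lambda_n|/|\Lambda_n|\to0$ ($\partial\Lambda$ being the set of vertices outside $\Lambda$ adjacent to $\Lambda$ in the square lattice). **Surface tension.**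 For a finite nonempty $\Lambda\subset\mathbb Z^d$ let $\lambda^{\Lambda-1}$ be the measure on $(\Omega,\mathcal F_\Lambda^\nabla)$ whose image under $\phi\mapsto(\phi(y)-\phi(x))_{y\in\Lambda\setminus\{x\}}$, for any fixed $x\in\Lambda$, is the product measure $\lambda^{\Lambda\setminus\{x\}}$. Put $H^0_\Lambda=\sum_{\emptyset\ne\Gamma\subset\Lambda}\Phi_\Gamma$, and let $\mathcal H_\Lambda(\mu|\Phi)$ be the relative entropy of $\mu|_{\mathcal F^\nabla_\Lambda}$ with respect to $e^{-H^0_\Lambda}\lambda^{\Lambda-1}$, where the relative entropy of $\mu$ with respect to $\nu$ is $\mu(\log\frac{d\mu}{d\nu})$ if $\mu\ll\nu$ and $\infty$ otherwise (with $\infty-\infty=\infty$). The specific free energy is $\mathcal H(\mu|\Phi)=\lim_{n\to\infty}n^{-d}\mathcal H_{[0,n)^d\cap\mathbb Z^d}(\mu|\Phi)$. A measure $\mu\in\mathcal P_{\mathcal L}(\Omega,\mathcal F^\nabla)$ has slope $S(\mu)=u\in(\mathbb R^d)^*$ if all $\phi(y)-\phi(x)$ are $\mu$-integrable and $u(x)=\mu(\phi(x)-\phi(0))$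 for $x\in\mathcal L$. Put $\sigma(u)=\inf\{\mathcal H(\mu|\Phi):\mu\in\mathcal P_{\mathcal L}(\Omega,\mathcal F^\nabla),\ S(\mu)=u\}$, with $\inf\emptyset=\infty$, where the infimum is over those $\mu$ for which the limit $\mathcal H(\mu|\Phi)$ exists, and let $U_\Phi$ be the interior of $\{\sigma<\infty\}$. **Theorem 4.8.** Let $\Phi=\Psi+\Xi$, where $\Psi$ is a strong interaction with constraint $(\mathbb A,q)$ and $\Xi$ is a weak interaction. Then: 1. $U_\Phi=U_q$. 2. If $E=\mathbb R$, then $\sigma(u)\to\infty$ as $u$ approaches $\partial U_\Phi$; that is, for every $v\in\partial U_\Phi$, $\sigma(u)\to\infty$ as $u\to v$, where $u$ ranges over all of $(\mathbb R^d)^*$, including $u=v$, so that $\sigma(v)=\infty$. 3. If $E=\mathbb Z$, then $\sigma$ is bounded and continuous on $\bar U_\Phi$. -/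

import Mathlib

open MeasureTheory Filter Topology Set
open scoped ENNReal

noncomputable section

namespace LipschitzSurface

/-! ## Height functions and the gradient sigma-algebras -/

/-- The value group `E` of the height functions, with its embedding in `ℝ` and its reference
measure. Only the two instances below are ever used. -/
class HeightSpace (E : Type) [AddCommGroup E] [MeasurableSpace E] where
  /-- the inclusion `E ⊆ ℝ` -/
  toReal : E →+ ℝ
  /-- the reference measure on `E` -/
  ref : Measure E

/-- `E = ℝ` with Lebesgue measure. -/
instance : HeightSpace ℝ where
  toReal := AddMonoidHom.id ℝ
  ref := volume

/-- `E = ℤ` with counting measure. -/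
instance : HeightSpace ℤ where
  toReal := Int.castAddHom ℝ
  ref := Measure.count

/-- The vertices of the square lattice `ℤ^d`. -/
abbrev Site (d : ℕ) : Type := Fin d → ℤ

/-- The graph metric of the square lattice. -/
def d1 {d : ℕ} (x y : Site d) : ℕ := ∑ i, (x i - y i).natAbs

/-- The set `Ω` of height functions. It is a type of its own because it carries the gradient
sigma-algebra (the instance below) rather than the product sigma-algebra. -/
def HeightFunction (d : ℕ) (E : Type) : Type := Site d → E

/-- The gradient sigma-algebra of a set of vertices, generated by the height differences
`φ y - φ x` with `x`, `y` in that set. -/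
abbrev gradientAlgebra {d : ℕ} {E : Type} [AddCommGroup E] [MeasurableSpace E]
    (Λ : Set (Site d)) : MeasurableSpace (HeightFunction d E) :=
  ⨆ x ∈ Λ, ⨆ y ∈ Λ,
    MeasurableSpace.comap (fun φ : HeightFunction d E => φ y - φ x) inferInstance

instance {d : ℕ} {E : Type} [AddCommGroup E] [MeasurableSpace E] :
    MeasurableSpace (HeightFunction d E) :=
  gradientAlgebra Set.univ

theorem gradientAlgebra_le {d : ℕ} {E : Type} [AddCommGroup E] [MeasurableSpace E]
    (Λ : Set (Site d)) :
    (gradientAlgebra Λ : MeasurableSpace (HeightFunction d E)) ≤ gradientAlgebra Set.univ :=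
  iSup₂_le fun x _ => iSup₂_le fun y _ =>
    le_iSup₂_of_le x (Set.mem_univ x) (le_iSup₂_of_le y (Set.mem_univ y) le_rfl)

section Fields

variable {d : ℕ} {E : Type} [AddCommGroup E] [MeasurableSpace E]

/-- The translate of a height function: `(θ φ) y = φ (y + v)`. -/
def shift (v : Site d) (φ : HeightFunction d E) : HeightFunction d E := fun y => φ (y + v)

/-- The gradient of `μ` is invariant under the translations by the vectors of `L`. -/
def IsShiftInvariant (L : AddSubgroup (Site d)) (μ : Measure (HeightFunction d E)) : Prop :=
  ∀ v ∈ L, μ.map (shift v) = μ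

/-- A slope is an element of the dual of `ℝ^d`. -/
abbrev Slope (d : ℕ) : Type := StrongDual ℝ (Fin d → ℝ)

/-- The inclusion of `ℤ^d` in `ℝ^d`. -/
def toVec (x : Site d) : Fin d → ℝ := fun i => (x i : ℝ)

/-- `μ` has finite slope, and its slope is `u`. -/
def HasSlope [HeightSpace E] (L : AddSubgroup (Site d)) (μ : Measure (HeightFunction d E))
    (u : Slope d) : Prop :=
  (∀ x y : Site d,
    Integrable (fun φ : HeightFunction d E => HeightSpace.toReal (φ y - φ x)) μ) ∧
  ∀ x ∈ L, u (toVec x) = ∫ φ : HeightFunction d E, HeightSpace.toReal (φ x - φ 0) ∂μ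

/-! ## Potentials -/

/-- A family of functions on `Ω`, indexed by the finite sets of vertices; the values `⊥` are
excluded in `IsPeriodicGradientPotential`. -/
abbrev Potential (d : ℕ) (E : Type) : Type :=
  Finset (Site d) → HeightFunction d E → EReal

/-- The translate of a finite set of vertices. -/
def translate (v : Site d) (Λ : Finset (Site d)) : Finset (Site d) :=
  Λ.map (addRightEmbedding v)

/-- Periodic gradient potentials with values in `ℝ ∪ {∞}`. -/
structure IsPeriodicGradientPotential (L : AddSubgroup (Site d)) (Φ : Potential d E) : Prop where
  ne_bot : ∀ Λ φ, Φ Λ φ ≠ ⊥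
  measurable : ∀ Λ : Finset (Site d), Measurable[gradientAlgebra (Λ : Set (Site d))] (Φ Λ)
  eq_zero : ∀ Λ : Finset (Site d), Λ.card ≤ 1 → ∀ φ, Φ Λ φ = 0
  periodic : ∀ v ∈ L, ∀ Λ φ, Φ (translate v Λ) φ = Φ Λ (shift v φ)

/-- The interior Hamiltonian `H⁰_Λ`. -/
def interiorHamiltonian (Φ : Potential d E) (Λ : Finset (Site d)) (φ : HeightFunction d E) :
    EReal :=
  ∑ Γ ∈ Λ.powerset with Γ.Nonempty, Φ Γ φ

/-! ## Entropy, specific free energy and surface tension -/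

/-- The relative entropy `μ (log f)`, `f = dμ/dν`, of a probability measure `μ` with respect to a
sigma-finite measure `ν`, with values in `[-∞, ∞]`; it is `∞` if `μ` is not absolutely continuous,
and `∞ - ∞ = ∞`. -/
def relEntropy {X : Type} {m : MeasurableSpace X} (μ ν : Measure X) : EReal :=
  open Classical in
  if μ ≪ ν ∧ (∫⁻ x, ENNReal.ofReal (llr μ ν x) ∂μ) ≠ ⊤ then
    ((∫⁻ x, ENNReal.ofReal (llr μ ν x) ∂μ : ℝ≥0∞) : EReal)
      - ((∫⁻ x, ENNReal.ofReal (-llr μ ν x) ∂μ : ℝ≥0∞) : EReal)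
  else ⊤

/-- Extends a function on `Λ \ {x}` by zero. -/
def extendZero (Λ : Finset (Site d)) (x : Site d) (ψ : ↥(Λ.erase x) → E) : HeightFunction d E :=
  fun y => if h : y ∈ Λ.erase x then ψ ⟨y, h⟩ else 0

/-- The gradient reference measure on the gradient sigma-algebra of `Λ`, for a reference point
`x ∈ Λ` (the result does not depend on that point). As `extendZero Λ x` is a section of
`φ ↦ (φ y - φ x)` with `y ∈ Λ \ {x}`, and as the latter map generates the gradient sigma-algebra
of `Λ`, this is the unique measure which this map sends to the product measure. -/
def gradientRef [HeightSpace E] (Λ : Finset (Site d)) (x : Site d) :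
    @Measure (HeightFunction d E) (gradientAlgebra (Λ : Set (Site d))) :=
  @Measure.map _ _ _ (gradientAlgebra (Λ : Set (Site d))) (extendZero Λ x)
    (Measure.pi fun _ : ↥(Λ.erase x) => HeightSpace.ref (E := E))

/-- The free energy of `μ` in `Λ` with respect to `Φ`, for a reference point `x ∈ Λ`. -/
def freeEnergy [HeightSpace E] (Φ : Potential d E) (Λ : Finset (Site d)) (x : Site d)
    (μ : Measure (HeightFunction d E)) : EReal :=
  relEntropy (μ.trim (gradientAlgebra_le (Λ : Set (Site d))))
    ((gradientRef Λ x).withDensity fun φ => EReal.exp (-interiorHamiltonian Φ Λ φ))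

/-- The box `[0,n)^d`. -/
def box (d n : ℕ) : Finset (Site d) := Fintype.piFinset fun _ => Finset.Ico (0 : ℤ) n

/-- `h` is the specific free energy of `μ` with respect to `Φ`, that is, the limit of the
normalised free energies in the boxes `[0,n)^d`. -/
def IsSpecificFreeEnergy [HeightSpace E] (Φ : Potential d E) (μ : Measure (HeightFunction d E))
    (h : EReal) : Prop :=
  Tendsto (fun n : ℕ => ((((n : ℝ) ^ d)⁻¹ : ℝ) : EReal) * freeEnergy Φ (box d n) 0 μ)
    atTop (𝓝 h)

/-- The surface tension: the infimum of the specific free energy over the shift-invariant gradient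
measures of slope `u`. -/
def surfaceTension [HeightSpace E] (L : AddSubgroup (Site d)) (Φ : Potential d E)
    (u : Slope d) : EReal :=
  sInf {h | ∃ μ : Measure (HeightFunction d E), IsProbabilityMeasure μ ∧ IsShiftInvariant L μ ∧
    HasSlope L μ u ∧ IsSpecificFreeEnergy Φ μ h}

/-- The set `U_Φ` of allowable slopes. -/
def allowableSlopes [HeightSpace E] (L : AddSubgroup (Site d)) (Φ : Potential d E) :
    Set (Slope d) :=
  interior {u | surfaceTension L Φ u < ⊤}

end Fields

/-! ## Local Lipschitz constraints -/

section Constraints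

variable {d : ℕ}

/-- Admissible graphs. -/
structure IsAdmissibleGraph (L : AddSubgroup (Site d)) (A : SimpleGraph (Site d)) : Prop where
  periodic : ∀ v ∈ L, ∀ x y, A.Adj (x + v) (y + v) ↔ A.Adj x y
  connected : A.Connected
  bounded_degree : ∃ D : ℕ, ∀ x, (A.neighborSet x).encard ≤ D

/-- Admissible quasimetrics. -/
structure IsAdmissibleQuasimetric (L : AddSubgroup (Site d)) (q : Site d → Site d → ℝ) :
    Prop where
  self : ∀ x, q x x = 0
  pos : ∀ x y, x ≠ y → 0 < q x y + q y x
  triangle : ∀ x y z, q x z ≤ q x y + q y z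
  periodic : ∀ v ∈ L, ∀ x y, q (x + v) (y + v) = q x y

/-- Local Lipschitz constraints. -/
structure IsLocalLipschitzConstraint (L : AddSubgroup (Site d)) (A : SimpleGraph (Site d))
    (q : Site d → Site d → ℝ) : Prop where
  graph : IsAdmissibleGraph L A
  quasimetric : IsAdmissibleQuasimetric L q
  maximal : ∀ p : Site d → Site d → ℝ, IsAdmissibleQuasimetric L p →
    (∀ x y, A.Adj x y → p x y ≤ q x y) → ∀ x y, p x y ≤ q x y

/-- `p` is the quasimetric `q_ε`, the largest admissible quasimetric with `p ≤ q - ε` on the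
edges of `A`. -/
def IsShrunkQuasimetric (L : AddSubgroup (Site d)) (A : SimpleGraph (Site d))
    (q : Site d → Site d → ℝ) (ε : ℝ) (p : Site d → Site d → ℝ) : Prop :=
  IsGreatest {p | IsAdmissibleQuasimetric L p ∧ ∀ x y, A.Adj x y → p x y ≤ q x y - ε} p

/-- The set `U_q`: the interior of the set of slopes whose restriction to `L` is `q`-Lipschitz. -/
def lipschitzSlopes (L : AddSubgroup (Site d)) (q : Site d → Site d → ℝ) : Set (Slope d) :=
  interior {u | ∀ x ∈ L, ∀ y ∈ L, u (toVec y) - u (toVec x) ≤ q x y}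

/-! ## Strong interactions -/

/-- Positive potentials. -/
def IsPositive {E : Type} (Ψ : Potential d E) : Prop := ∀ Λ φ, 0 ≤ Ψ Λ φ

/-- Potentials of finite range: `Ψ_Λ` vanishes if the diameter of `Λ` exceeds `R`. -/
def HasFiniteRange {E : Type} (Ψ : Potential d E) : Prop :=
  ∃ R : ℕ, ∀ Λ : Finset (Site d), (∃ x ∈ Λ, ∃ y ∈ Λ, R < d1 x y) → ∀ φ, Ψ Λ φ = 0

variable {E : Type} [AddCommGroup E] [MeasurableSpace E] [HeightSpace E]

/-- `Ψ` is Lipschitz, with the local Lipschitz constraint `(A, q)`. -/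
def IsLipschitzPotential (L : AddSubgroup (Site d)) (A : SimpleGraph (Site d))
    (q : Site d → Site d → ℝ) (Ψ : Potential d E) : Prop :=
  IsLocalLipschitzConstraint L A q ∧
  ∀ (Λ : Finset (Site d)) (φ : HeightFunction d E), Ψ Λ φ = ⊤ ↔
    ∃ x y, Λ = {x, y} ∧ A.Adj x y ∧ q x y < HeightSpace.toReal (φ y - φ x)

/-- `φ` is `p`-Lipschitz at the vertex `x`, with respect to the edges of `A` at `x`. -/
def IsLipschitzAt (A : SimpleGraph (Site d)) (p : Site d → Site d → ℝ)
    (φ : HeightFunction d E) (x : Site d) : Prop :=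
  ∀ y, A.Adj x y →
    HeightSpace.toReal (φ y - φ x) ≤ p x y ∧ HeightSpace.toReal (φ x - φ y) ≤ p y x

/-- The Hamiltonian `H_{x}` of a singleton, for a positive potential. -/
def singletonHamiltonian (Ψ : Potential d E) (x : Site d) (φ : HeightFunction d E) : ℝ≥0∞ :=
  ∑' Γ : {Γ : Finset (Site d) // x ∈ Γ}, (Ψ Γ.1 φ).toENNReal

/-- The locally bounded property of a positive Lipschitz potential. -/
def IsLocallyBounded (L : AddSubgroup (Site d)) (A : SimpleGraph (Site d))
    (q : Site d → Site d → ℝ) (Ψ : Potential d E) : Prop :=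
  ∃ η > (0 : ℝ), ∀ ε : ℝ, 0 < ε → ε < η → ∀ p, IsShrunkQuasimetric L A q ε p →
    ∃ C : ℝ, ∀ x φ, IsLipschitzAt A p φ x → singletonHamiltonian Ψ x φ ≤ ENNReal.ofReal C

/-- Strong interactions for `E = ℝ`, with constraint `(A, q)`. -/
structure IsStrongInteractionReal (L : AddSubgroup (Site d)) (A : SimpleGraph (Site d))
    (q : Site d → Site d → ℝ) (Ψ : Potential d ℝ) : Prop where
  potential : IsPeriodicGradientPotential L Ψ
  positive : IsPositive Ψ
  finiteRange : HasFiniteRange Ψ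
  lipschitz : IsLipschitzPotential L A q Ψ
  locallyBounded : IsLocallyBounded L A q Ψ

/-- Strong interactions for `E = ℤ`, with constraint `(A, q)`, where `q` is integral. -/
structure IsStrongInteractionInt (L : AddSubgroup (Site d)) (A : SimpleGraph (Site d))
    (q : Site d → Site d → ℝ) (Ψ : Potential d ℤ) : Prop where
  potential : IsPeriodicGradientPotential L Ψ
  positive : IsPositive Ψ
  finiteRange : HasFiniteRange Ψ
  lipschitz : IsLipschitzPotential L A q Ψ
  integral : ∀ x y, ∃ k : ℤ, q x y = k

/-! ## Weak interactions -/

/-- Summable potentials. -/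
def IsSummable {E : Type} (Ξ : Potential d E) : Prop :=
  (⨆ (x : Site d) (φ : HeightFunction d E),
    ∑' Λ : {Λ : Finset (Site d) // x ∈ Λ}, (Ξ Λ.1 φ).abs) < ⊤

/-- The set of the vertices which are adjacent to `Λ` in the square lattice (and not in `Λ`). -/
def outerBoundary (Λ : Finset (Site d)) : Set (Site d) :=
  {y | y ∉ Λ ∧ ∃ x ∈ Λ, d1 x y = 1}

/-- Van Hove sequences. -/
def IsVanHove (Λ : ℕ → Finset (Site d)) : Prop :=
  Tendsto (fun n => (Λ n).card) atTop atTop ∧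
  Tendsto (fun n => ((outerBoundary (Λ n)).ncard : ℝ) / ((Λ n).card : ℝ)) atTop (𝓝 0)

/-- Amenable functions on the finite sets of vertices. -/
structure IsAmenable (L : AddSubgroup (Site d)) (f : Finset (Site d) → ℝ≥0∞) : Prop where
  finite : ∀ Λ, f Λ ≠ ⊤
  periodic : ∀ v ∈ L, ∀ Λ, f (translate v Λ) = f Λ
  subadditive : ∀ Λ Δ : Finset (Site d), Disjoint Λ Δ → f (Λ ∪ Δ) ≤ f Λ + f Δ
  vanHove : ∀ Λ : ℕ → Finset (Site d), IsVanHove Λ →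
    Tendsto (fun n => f (Λ n) / ((Λ n).card : ℝ≥0∞)) atTop (𝓝 0)

/-- The lower exterior bound `e⁻`. -/
def lowerExteriorBound {E : Type} (Ξ : Potential d E) (Λ : Finset (Site d)) : ℝ≥0∞ :=
  ⨆ φ : HeightFunction d E,
    ∑' Δ : {Δ : Finset (Site d) // (∃ x ∈ Δ, x ∈ Λ) ∧ ∃ y ∈ Δ, y ∉ Λ}, (Ξ Δ.1 φ).abs

/-- Weak interactions. -/
structure IsWeakInteraction {E : Type} [AddCommGroup E] [MeasurableSpace E]
    (L : AddSubgroup (Site d)) (Ξ : Potential d E) : Prop where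
  potential : IsPeriodicGradientPotential L Ξ
  summable : IsSummable Ξ
  amenable : IsAmenable L (lowerExteriorBound Ξ)

end Constraints

end LipschitzSurface

end

set_option linter.unusedSectionVars false

namespace LipschitzSurface

/-! ## Walks and slopes -/

section Walks

variable {d : ℕ}

/-! Lower bounds for free energies come from trial densities. By Gibbs' variational inequality
(`freeEnergy_ge`), a function `ρ ≥ 0` of integral at most one against the reference measure of a box
bounds the free energy of `μ` there from below by `μ (log ρ)` plus the mean of any integrable
minorant of the Hamiltonian. Trial densities on large boxes are glued from a density on small tiles:
the root of each tile, and each vertex outside the tiles, is attached to a neighbouring earlier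
vertex by a uniform step (`lintegral_tileDensity_le_one`). Gluing copies of the density of `μ`
itself shows that box free energies are superadditive up to boundary terms. So the specific free
energy exists for invariant measures with bounded densities on functions of bounded steps and
bounded energy, and it is bounded below in terms of each single box (`IsTameMeasure.exists_limit`).

Finite specific free energy forces the Hamiltonian to be almost surely finite, hence the heights to
be `q`-Lipschitz (`ae_lipschitz`) and the slope to lie in `slopeSet L q`. A long walk repeats a
class modulo `L` and can be cut there, so only finitely many inequalities `u v ≤ q a (a + v)` matter
and `slopeSet L q` is a polyhedron (`slopeSet_polyhedral`). Conversely, shortest paths produce an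
equivariant Lipschitz function of any slope in it (`exists_equivariant`), with uniform room below
`q` when the slope is interior (`exists_strict_equivariant`).

For real heights and an interior slope, independent uniform noise is added to that function, within
the room; this gives a measure of finite specific free energy. At a boundary slope `v` some
constraint is tight: `v w = q a (a + w)` with `w ≠ 0`. For slopes near `v` the increment over this
pair is in mean close to its maximum, so an exponential trial density of rate `r` for the gap gains
about `log r` per tile, and `r` is arbitrary (`specificFreeEnergy_ge_of_tight`).

For integral heights, rounding the equivariant function with a uniform random phase gives a
Lipschitz measure of every slope in the closed polyhedron. Lipschitz patterns on a finite set are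
finite in number and discrete densities are at most one, so energies and entropies are uniformly
bounded, and so is the surface tension. Upper semicontinuity follows from convexity, because a
polyhedron is a cone near each of its points (`IsTameModel.eventually_surfaceTension_lt`). Lower
semicontinuity follows from compactness of the Lipschitz measures, lower semicontinuity of box free
energies, and the lower bound of the specific free energy by single boxes
(`IsTameModel.eventually_lt_surfaceTension`). -/

@[simp] theorem toVec_zero : toVec (0 : Site d) = 0 := by
  ext i; simp [toVec]

theorem toVec_add (x y : Site d) : toVec (x + y) = toVec x + toVec y := by
  ext i; simp [toVec]

theorem toVec_sub (x y : Site d) : toVec (x - y) = toVec x - toVec y := by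
  ext i; simp [toVec]

theorem toVec_neg (x : Site d) : toVec (-x) = -toVec x := by
  ext i; simp [toVec]

theorem toVec_nsmul (n : ℕ) (x : Site d) : toVec (n • x) = (n : ℝ) • toVec x := by
  ext i; simp [toVec]

/-- The slopes whose restriction to `L` is `q`-Lipschitz. -/
def slopeSet (L : AddSubgroup (Site d)) (q : Site d → Site d → ℝ) : Set (Slope d) :=
  {u | ∀ x ∈ L, ∀ y ∈ L, u (toVec y) - u (toVec x) ≤ q x y}

/-- There is a walk of `n` steps from `x` to `y` in `A` of total weight `s`. -/
def HasWalk (A : SimpleGraph (Site d)) (w : Site d → Site d → ℝ) (n : ℕ) (x y : Site d)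
    (s : ℝ) : Prop :=
  ∃ c : ℕ → Site d, c 0 = x ∧ c n = y ∧ (∀ i < n, A.Adj (c i) (c (i + 1))) ∧
    ∑ i ∈ Finset.range n, w (c i) (c (i + 1)) = s

variable {L : AddSubgroup (Site d)} {A : SimpleGraph (Site d)} {q w : Site d → Site d → ℝ}

theorem HasWalk.nil (x : Site d) : HasWalk A w 0 x x 0 :=
  ⟨fun _ => x, rfl, rfl, by simp, by simp⟩

theorem HasWalk.edge {x y : Site d} (h : A.Adj x y) : HasWalk A w 1 x y (w x y) :=
  ⟨fun i => if i = 0 then x else y, by simp, by simp, by simpa using h, by simp⟩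

theorem HasWalk.trans {n m : ℕ} {x y z : Site d} {s t : ℝ} (h₁ : HasWalk A w n x y s)
    (h₂ : HasWalk A w m y z t) : HasWalk A w (n + m) x z (s + t) := by
  obtain ⟨c, c0, cn, hc, rfl⟩ := h₁
  obtain ⟨e, e0, en, he, rfl⟩ := h₂
  have hlow : ∀ i ≤ n, (fun i => if i ≤ n then c i else e (i - n)) i = c i := by
    intro i hi; simp [hi]
  have hhigh : ∀ i, (fun i => if i ≤ n then c i else e (i - n)) (n + i) = e i := by
    intro i
    rcases Nat.eq_zero_or_pos i with rfl | hi
    · simp [cn, e0]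
    · have : ¬ n + i ≤ n := by omega
      simp [this]
  refine ⟨fun i => if i ≤ n then c i else e (i - n), ?_, ?_, ?_, ?_⟩
  · rw [hlow 0 (Nat.zero_le _), c0]
  · rw [hhigh m, en]
  · intro i hi
    by_cases h : i < n
    · rw [hlow i h.le, hlow (i + 1) h]; exact hc i h
    · obtain ⟨j, rfl⟩ := Nat.exists_eq_add_of_le (not_lt.1 h)
      rw [hhigh j, show n + j + 1 = n + (j + 1) by ring, hhigh (j + 1)]
      exact he j (by omega)
  · rw [Finset.sum_range_add]
    congr 1
    · refine Finset.sum_congr rfl fun i hi => ?_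
      rw [Finset.mem_range] at hi
      rw [hlow i hi.le, hlow (i + 1) hi]
    · refine Finset.sum_congr rfl fun i _ => ?_
      rw [hhigh i, show n + i + 1 = n + (i + 1) by ring, hhigh (i + 1)]

theorem HasWalk.split {n m : ℕ} {c : ℕ → Site d} (hnm : n ≤ m)
    (hc : ∀ i < m, A.Adj (c i) (c (i + 1))) :
    HasWalk A w (m - n) (c n) (c m) (∑ i ∈ Finset.Ico n m, w (c i) (c (i + 1))) := by
  refine ⟨fun i => c (n + i), by simp, by simp [Nat.add_sub_cancel' hnm], ?_, ?_⟩
  · intro i hi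
    exact hc (n + i) (by omega)
  · rw [Finset.sum_Ico_eq_sum_range]
    rfl

theorem HasWalk.translate {n : ℕ} {x y v : Site d} {s : ℝ}
    (hA : ∀ x y, A.Adj (x + v) (y + v) ↔ A.Adj x y)
    (hw : ∀ x y, w (x + v) (y + v) = w x y) (h : HasWalk A w n x y s) :
    HasWalk A w n (x + v) (y + v) s := by
  obtain ⟨c, rfl, rfl, hc, rfl⟩ := h
  exact ⟨fun i => c i + v, rfl, rfl, fun i hi => (hA _ _).2 (hc i hi), by simp [hw]⟩

theorem exists_hasWalk (hA : A.Connected) (w : Site d → Site d → ℝ) (x y : Site d) :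
    ∃ n s, HasWalk A w n x y s := by
  obtain ⟨p⟩ := hA.preconnected x y
  induction p with
  | nil => exact ⟨0, 0, HasWalk.nil _⟩
  | cons h _ ih =>
    obtain ⟨n, s, hs⟩ := ih
    exact ⟨_, _, (HasWalk.edge h).trans hs⟩

/-- The triangle inequality telescopes along the walk. It is applied to `q` itself, to differences
of a function, and to such differences with extra room. -/
theorem le_weight_of_hasWalk {b : Site d → Site d → ℝ} (hself : ∀ x, b x x ≤ 0)
    (htri : ∀ x y z, b x z ≤ b x y + b y z) (hb : ∀ x y, A.Adj x y → b x y ≤ w x y)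
    {n : ℕ} {x y : Site d} {s : ℝ} (h : HasWalk A w n x y s) : b x y ≤ s := by
  obtain ⟨c, rfl, rfl, hc, rfl⟩ := h
  induction n with
  | zero => simpa using hself _
  | succ n ih =>
    rw [Finset.sum_range_succ]
    have h1 := ih fun i hi => hc i (by omega)
    have h2 := hb _ _ (hc n (by omega))
    have h3 := htri (c 0) (c n) (c (n + 1))
    linarith

/-- The infimum of the weights of the walks between two vertices. -/
noncomputable def walkDist (A : SimpleGraph (Site d)) (w : Site d → Site d → ℝ)
    (x y : Site d) : ℝ :=
  sInf {s | ∃ n, HasWalk A w n x y s}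

/-- The infimum of a set unbounded below is a junk value, so a lower bound `b` for the weights of
all walks has to be supplied. -/
theorem walkDist_le {b : Site d → Site d → ℝ} (hb : ∀ n x y s, HasWalk A w n x y s → b x y ≤ s)
    {n : ℕ} {x y : Site d} {s : ℝ} (h : HasWalk A w n x y s) : walkDist A w x y ≤ s :=
  csInf_le ⟨b x y, by rintro _ ⟨n, h⟩; exact hb _ _ _ _ h⟩ ⟨n, h⟩

theorem le_walkDist (hA : A.Connected) {x y : Site d} {r : ℝ}
    (h : ∀ n s, HasWalk A w n x y s → r ≤ s) : r ≤ walkDist A w x y := by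
  refine le_csInf ?_ ?_
  · obtain ⟨n, s, hs⟩ := exists_hasWalk hA w x y
    exact ⟨s, n, hs⟩
  · rintro _ ⟨n, hs⟩
    exact h _ _ hs

/-- The function `b` keeps the infima finite; as the path metric dominates it, `b` also provides the
positivity. -/
theorem isAdmissibleQuasimetric_walkDist (hA : IsAdmissibleGraph L A)
    (hw : ∀ v ∈ L, ∀ x y, w (x + v) (y + v) = w x y) {b : Site d → Site d → ℝ}
    (hself : ∀ x, b x x = 0) (hpos : ∀ x y, x ≠ y → 0 < b x y + b y x)
    (hb : ∀ n x y s, HasWalk A w n x y s → b x y ≤ s) :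
    IsAdmissibleQuasimetric L (walkDist A w) := by
  have hle : ∀ x y, b x y ≤ walkDist A w x y := fun x y =>
    le_walkDist hA.connected fun n s h => hb n x y s h
  have hper : ∀ v ∈ L, ∀ x y, walkDist A w (x + v) (y + v) ≤ walkDist A w x y := fun v hv x y =>
    le_walkDist hA.connected fun n s h => walkDist_le hb (h.translate (hA.periodic v hv) (hw v hv))
  refine ⟨fun x => le_antisymm (walkDist_le hb (HasWalk.nil x)) ((hself x).ge.trans (hle x x)),
    fun x y hxy => (hpos x y hxy).trans_le (add_le_add (hle x y) (hle y x)), fun x y z => ?_,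
    fun v hv x y => le_antisymm (hper v hv x y) ?_⟩
  · have h1 : ∀ n s, HasWalk A w n x y s → walkDist A w x z - walkDist A w y z ≤ s := by
      intro n s hs
      have h2 : ∀ m t, HasWalk A w m y z t → walkDist A w x z - s ≤ t := fun m t ht => by
        have := walkDist_le hb (hs.trans ht); linarith
      have := le_walkDist hA.connected h2; linarith
    have := le_walkDist hA.connected h1; linarith
  · have := hper (-v) (neg_mem hv) (x + v) (y + v)
    simpa using this

/-- A local Lipschitz constraint is the path metric of its edges. -/
theorem IsLocalLipschitzConstraint.le_of_forall_walk (h : IsLocalLipschitzConstraint L A q)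
    {x y : Site d} {r : ℝ} (hr : ∀ n s, HasWalk A q n x y s → r ≤ s) : r ≤ q x y := by
  have hb : ∀ n x y s, HasWalk A q n x y s → q x y ≤ s := fun n x y s hs =>
    le_weight_of_hasWalk (fun x => (h.quasimetric.self x).le) h.quasimetric.triangle
      (fun _ _ _ => le_rfl) hs
  have had := isAdmissibleQuasimetric_walkDist h.graph h.quasimetric.periodic
    h.quasimetric.self h.quasimetric.pos hb
  -- The path metric is itself admissible and at most `q` on the edges, so maximality puts it below
  -- `q`.
  exact (le_walkDist h.graph.connected hr).trans
    (h.maximal _ had (fun x y hxy => walkDist_le hb (HasWalk.edge hxy)) x y)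

theorem IsLocalLipschitzConstraint.le_of_edges (h : IsLocalLipschitzConstraint L A q)
    {g : Site d → ℝ} (hg : ∀ x y, A.Adj x y → g y - g x ≤ q x y) (x y : Site d) :
    g y - g x ≤ q x y :=
  h.le_of_forall_walk fun _ _ hs =>
    le_weight_of_hasWalk (b := fun x y => g y - g x) (by simp) (by intros; linarith) hg hs

/-- It suffices to control the short closed walks of the quotient by `L`. -/
theorem weight_ge_of_short [L.FiniteIndex] (hA : ∀ v ∈ L, ∀ x y, A.Adj (x + v) (y + v) ↔ A.Adj x y)
    (hw : ∀ v ∈ L, ∀ x y, w (x + v) (y + v) = w x y) (u : Slope d)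
    (hu : ∀ n ≤ Nat.card (Site d ⧸ L), ∀ a, ∀ v ∈ L, ∀ s, HasWalk A w n a (a + v) s →
      u (toVec v) ≤ s) :
    ∀ n a, ∀ v ∈ L, ∀ s, HasWalk A w n a (a + v) s → u (toVec v) ≤ s := by
  intro n
  induction n using Nat.strong_induction_on with
  | _ n ih =>
    intro a v hv s hs
    by_cases hn : n ≤ Nat.card (Site d ⧸ L)
    · exact hu n hn a v hv s hs
    obtain ⟨c, c0, cn, hc, hsum⟩ := hs
    -- Two of the first `Nat.card (Site d ⧸ L) + 1` vertices are equivalent. The loop between them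
    -- has displacement `v'`; removing it and translating the tail back leaves a walk of
    -- displacement `v - v'`. Both are strictly shorter, and their weights add up to the original
    -- one.
    obtain ⟨i, j, hij, hcij⟩ : ∃ i j : Fin (Nat.card (Site d ⧸ L) + 1), i < j ∧
        (c i : Site d ⧸ L) = (c j : Site d ⧸ L) := by
      have : ¬ Function.Injective
          (fun i : Fin (Nat.card (Site d ⧸ L) + 1) => ((c i : Site d) : Site d ⧸ L)) := by
        intro hinj
        have := Nat.card_le_card_of_injective _ hinj
        simp at this
      rw [Function.not_injective_iff] at this
      obtain ⟨i, j, h, hne⟩ := this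
      rcases lt_or_gt_of_ne hne with hlt | hlt
      · exact ⟨i, j, hlt, h⟩
      · exact ⟨j, i, hlt, h.symm⟩
    have hjn : (j : ℕ) ≤ n := by have := j.2; omega
    have hij' : (i : ℕ) < j := hij
    have hvm : -(c i) + c j ∈ L := QuotientAddGroup.eq.1 hcij
    set v' := -(c i) + c j with hv'
    have hcj : c j = c i + v' := by rw [hv']; abel
    have w1 : HasWalk A w (i - 0) (c 0) (c i) _ :=
      HasWalk.split (Nat.zero_le _) fun k hk => hc k (by omega)
    have w2 : HasWalk A w (j - i) (c i) (c j) _ :=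
      HasWalk.split hij'.le fun k hk => hc k (by omega)
    have w3 : HasWalk A w (n - j) (c j) (c n) _ := HasWalk.split hjn hc
    have w3' := w3.translate (hA (-v') (neg_mem hvm)) (hw (-v') (neg_mem hvm))
    rw [show c j + -v' = c i by rw [hcj]; abel, cn, show a + v + -v' = a + (v - v') by abel] at w3'
    have h1 := ih _ (by omega) a (v - v') (sub_mem hv hvm) _ ((c0 ▸ w1).trans w3')
    rw [hcj] at w2
    have h2 := ih _ (by have := j.2; omega) (c i) v' hvm _ w2
    rw [toVec_sub, map_sub] at h1
    have e1 := Finset.sum_Ico_consecutive (fun i => w (c i) (c (i + 1))) (Nat.zero_le i) hij'.le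
    have e2 := Finset.sum_Ico_consecutive (fun i => w (c i) (c (i + 1))) (Nat.zero_le j) hjn
    rw [Finset.range_eq_Ico] at hsum
    linarith

/-- A periodic weight without negative cycles of slope `u` bounds the gradient of a function of
slope `u`. -/
theorem exists_equivariant (hA : IsAdmissibleGraph L A)
    (hw : ∀ v ∈ L, ∀ x y, w (x + v) (y + v) = w x y) (u : Slope d)
    (hu : ∀ n a, ∀ v ∈ L, ∀ s, HasWalk A w n a (a + v) s → u (toVec v) ≤ s) :
    ∃ f : Site d → ℝ, (∀ x, ∀ v ∈ L, f (x + v) = f x + u (toVec v)) ∧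
      ∀ x y, A.Adj x y → f y - f x ≤ w x y := by
  -- A shortest-path potential in which every lattice vertex `v` is a source with initial value `u
  -- v`. The hypothesis `hu` prevents the infimum from being `-∞`, and summing over all of `L` makes
  -- the result equivariant.
  set S : Site d → Set ℝ := fun x =>
    {r | ∃ v ∈ L, ∃ n s, HasWalk A w n v x s ∧ r = s + u (toVec v)} with hS
  have hne : ∀ x, (S x).Nonempty := fun x => by
    obtain ⟨n, s, hs⟩ := exists_hasWalk hA.connected w 0 x
    exact ⟨_, 0, zero_mem L, n, s, hs, rfl⟩
  have hbd : ∀ x, BddBelow (S x) := fun x => by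
    obtain ⟨n₀, s₀, hs₀⟩ := exists_hasWalk hA.connected w x 0
    refine ⟨-s₀, ?_⟩
    rintro _ ⟨v, hv, n, s, hs, rfl⟩
    have h1 := hs.trans hs₀
    have h2 := hu _ v (-v) (neg_mem hv) _ (by simpa using h1)
    rw [toVec_neg, map_neg] at h2
    linarith
  have hshift : ∀ x, ∀ v ∈ L, sInf (S (x + v)) ≤ sInf (S x) + u (toVec v) := by
    intro x v hv
    rw [← sub_le_iff_le_add]
    refine le_csInf (hne x) ?_
    rintro _ ⟨v', hv', n, s, hs, rfl⟩
    have : sInf (S (x + v)) ≤ s + u (toVec (v' + v)) :=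
      csInf_le (hbd _) ⟨v' + v, add_mem hv' hv, n, s,
        hs.translate (hA.periodic v hv) (hw v hv), rfl⟩
    rw [toVec_add, map_add] at this
    linarith
  refine ⟨fun x => sInf (S x), fun x v hv => le_antisymm (hshift x v hv) ?_, fun x y hxy => ?_⟩
  · have := hshift (x + v) (-v) (neg_mem hv)
    rw [toVec_neg, map_neg, add_neg_cancel_right] at this
    linarith
  · rw [sub_le_iff_le_add, add_comm, ← sub_le_iff_le_add]
    refine le_csInf (hne x) ?_
    rintro _ ⟨v, hv, n, s, hs, rfl⟩
    have : sInf (S y) ≤ (s + w x y) + u (toVec v) :=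
      csInf_le (hbd _) ⟨v, hv, _, _, hs.trans (HasWalk.edge hxy), rfl⟩
    linarith

/-- The definition of `slopeSet` concerns only pairs in `L`. For another base point `a`, repeat the
displacement `n` times: going from `0` to `a` and back costs a bounded amount, which disappears on
dividing by `n`. -/
theorem IsAdmissibleQuasimetric.slope_le (h : IsAdmissibleQuasimetric L q) {u : Slope d}
    (hu : u ∈ slopeSet L q) (a : Site d) {v : Site d} (hv : v ∈ L) :
    u (toVec v) ≤ q a (a + v) := by
  have hmul : ∀ n : ℕ, q a (a + n • v) ≤ n * q a (a + v) := by
    intro n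
    induction n with
    | zero => simp [h.self]
    | succ n ih =>
      have h1 := h.triangle a (a + n • v) (a + (n + 1) • v)
      have h2 := h.periodic (n • v) (L.nsmul_mem hv n) a (a + v)
      rw [show a + v + n • v = a + (n + 1) • v by rw [add_smul, one_smul]; abel] at h2
      push_cast
      linarith
  by_contra! hlt
  obtain ⟨n, hn⟩ := exists_nat_gt ((q 0 a + q a 0) / (u (toVec v) - q a (a + v)))
  rw [div_lt_iff₀ (by linarith)] at hn
  have h1 := hu 0 (zero_mem L) (n • v) (L.nsmul_mem hv n)
  rw [toVec_nsmul, map_smul, toVec_zero, map_zero, smul_eq_mul] at h1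
  have h2 := h.triangle 0 a (n • v)
  have h3 := h.triangle a (a + n • v) (n • v)
  have h4 := h.periodic (n • v) (L.nsmul_mem hv n) a 0
  rw [zero_add] at h4
  have h5 := hmul n
  linarith

theorem finite_reachable (hA : ∃ D : ℕ, ∀ x, (A.neighborSet x).encard ≤ D) (n : ℕ) (x : Site d) :
    {y | ∃ s, HasWalk A w n x y s}.Finite := by
  obtain ⟨D, hD⟩ := hA
  induction n with
  | zero =>
    refine (Set.finite_singleton x).subset ?_
    rintro y ⟨s, c, rfl, rfl, -, -⟩
    rfl
  | succ n ih =>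
    refine (ih.biUnion (t := fun y => A.neighborSet y) fun y _ =>
      Set.finite_of_encard_le_coe (hD y)).subset ?_
    rintro y ⟨s, c, rfl, rfl, hc, -⟩
    refine mem_biUnion (x := c n) ⟨_, c, rfl, rfl, fun i hi => hc i (by omega), rfl⟩ ?_
    exact hc n (by omega)

/-- Every vertex is a translate of the chosen representative of its class. -/
theorem exists_out (L : AddSubgroup (Site d)) (x : Site d) :
    ∃ v ∈ L, x = (x : Site d ⧸ L).out + v := by
  refine ⟨-(x : Site d ⧸ L).out + x, ?_, by abel⟩
  apply QuotientAddGroup.eq.1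
  exact Quotient.out_eq' _

instance finite_quotient [L.FiniteIndex] : Finite (Site d ⧸ L) := AddSubgroup.finite_quotient_of_finiteIndex

/-- By `weight_ge_of_short` only displacements of walks of at most `Nat.card (Site d ⧸ L)` steps
from a representative matter, and the bounded degree leaves finitely many. Both the local cone
property and the tight constraint at boundary slopes rest on this finiteness. -/
theorem slopeSet_polyhedral [L.FiniteIndex] (h : IsLocalLipschitzConstraint L A q) :
    ∃ F : Finset (Site d), (∀ v ∈ F, v ∈ L) ∧
      slopeSet L q = {u | ∀ r : Site d ⧸ L, ∀ v ∈ F, u (toVec v) ≤ q r.out (r.out + v)} := by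
  have hfin : {v | v ∈ L ∧ ∃ r : Site d ⧸ L, ∃ n ≤ Nat.card (Site d ⧸ L), ∃ s,
      HasWalk A q n r.out (r.out + v) s}.Finite := by
    refine (Set.finite_iUnion fun r : Site d ⧸ L => Set.Finite.biUnion
      (Set.finite_Iic (Nat.card (Site d ⧸ L))) fun n _ =>
        (finite_reachable (w := q) h.graph.bounded_degree n r.out).image
          fun y => y - r.out).subset ?_
    rintro v ⟨-, r, n, hn, s, hs⟩
    exact mem_iUnion.2 ⟨r, mem_biUnion (x := n) hn ⟨r.out + v, ⟨s, hs⟩, by simp⟩⟩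
  refine ⟨hfin.toFinset, fun v hv => (hfin.mem_toFinset.1 hv).1, ?_⟩
  ext u
  constructor
  · intro hu r v hv
    exact h.quasimetric.slope_le hu _ (hfin.mem_toFinset.1 hv).1
  · intro hu x hx y hy
    refine h.le_of_forall_walk fun n s hs => ?_
    have key := weight_ge_of_short h.graph.periodic h.quasimetric.periodic u ?_ n x (y - x)
      (sub_mem hy hx) s (by simpa using hs)
    · rwa [toVec_sub, map_sub] at key
    · intro n hn a v hv s hs
      obtain ⟨t, ht, hat⟩ := exists_out L a
      have hs' : HasWalk A q n (a : Site d ⧸ L).out ((a : Site d ⧸ L).out + v) s := by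
        have := hs.translate (h.graph.periodic (-t) (neg_mem ht))
          (h.quasimetric.periodic (-t) (neg_mem ht))
        have e : a + -t = (a : Site d ⧸ L).out := by
          rw [← sub_eq_add_neg, sub_eq_iff_eq_add]; exact hat
        rwa [show a + v + -t = (a + -t) + v by abel, e] at this
      refine (hu (a : Site d ⧸ L) v (hfin.mem_toFinset.2 ⟨hv, _, n, hn, s, hs'⟩)).trans ?_
      exact le_weight_of_hasWalk (fun x => (h.quasimetric.self x).le) h.quasimetric.triangle
        (fun _ _ _ => le_rfl) hs'

theorem isClosed_slopeSet (L : AddSubgroup (Site d)) (q : Site d → Site d → ℝ) :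
    IsClosed (slopeSet L q) := by
  simp only [slopeSet, Set.ofPred_forall]
  refine isClosed_iInter fun x => isClosed_iInter fun _ => isClosed_iInter fun y =>
    isClosed_iInter fun _ => isClosed_le ?_ continuous_const
  fun_prop

/-- The set of Lipschitz slopes is a cone near each of its points. -/
theorem slopeSet_locally_conical [L.FiniteIndex] (h : IsLocalLipschitzConstraint L A q)
    {w : Slope d} (hw : w ∈ slopeSet L q) :
    ∃ δ > (0 : ℝ), ∀ u ∈ slopeSet L q, ∀ t : ℝ, 0 < t → ‖u - w‖ ≤ δ * t →
      w + t⁻¹ • (u - w) ∈ slopeSet L q := by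
  obtain ⟨F, -, hF⟩ := slopeSet_polyhedral h
  -- An inequality with slack at `w` allows a radius proportional to the slack, the `+ 1` avoiding a
  -- zero norm. An inequality tight at `w` is homogeneous in `u - w`, so it survives scaling and any
  -- radius will do.
  have hex : ∀ i : (Site d ⧸ L) × F, ∃ δ > (0 : ℝ), w (toVec i.2.1) < q i.1.out (i.1.out + i.2.1) →
      δ * ‖toVec i.2.1‖ ≤ q i.1.out (i.1.out + i.2.1) - w (toVec i.2.1) := by
    intro i
    by_cases hi : w (toVec i.2.1) < q i.1.out (i.1.out + i.2.1)
    · refine ⟨(q i.1.out (i.1.out + i.2.1) - w (toVec i.2.1)) / (‖toVec i.2.1‖ + 1),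
        div_pos (by linarith) (by positivity), fun _ => ?_⟩
      rw [div_mul_eq_mul_div, div_le_iff₀ (by positivity)]
      nlinarith [norm_nonneg (toVec i.2.1)]
    · exact ⟨1, one_pos, fun h => absurd h hi⟩
  choose δ hδ hδ' using hex
  obtain ⟨δ₀, hδ₀, hmin⟩ : ∃ δ₀ > (0 : ℝ), ∀ i, δ₀ ≤ δ i := by
    rcases isEmpty_or_nonempty ((Site d ⧸ L) × F) with he | hne
    · exact ⟨1, one_pos, fun i => he.elim i⟩
    · obtain ⟨i, hi⟩ := Finite.exists_min δ
      exact ⟨δ i, hδ i, hi⟩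
  refine ⟨δ₀, hδ₀, fun u hu t ht hut => ?_⟩
  rw [hF] at hu hw ⊢
  intro r v hv
  have hu' := hu r v hv
  have hw' := hw r v hv
  simp only [add_apply, smul_apply,
    sub_apply, smul_eq_mul]
  rcases hw'.lt_or_eq with hlt | heq
  · have h1 := hδ' (r, ⟨v, hv⟩) hlt
    have h2 : u (toVec v) - w (toVec v) ≤ ‖u - w‖ * ‖toVec v‖ :=
      (le_abs_self _).trans ((u - w).le_opNorm (toVec v))
    have h3 : u (toVec v) - w (toVec v) ≤ t * (δ₀ * ‖toVec v‖) := by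
      nlinarith [mul_le_mul_of_nonneg_right hut (norm_nonneg (toVec v))]
    have h4 : t⁻¹ * (u (toVec v) - w (toVec v)) ≤ δ₀ * ‖toVec v‖ := by
      rw [inv_mul_le_iff₀ ht]; exact h3
    have h5 := mul_le_mul_of_nonneg_right (hmin (r, ⟨v, hv⟩)) (norm_nonneg (toVec v))
    simp only at h1
    linarith
  · have : t⁻¹ * (u (toVec v) - w (toVec v)) ≤ 0 :=
      mul_nonpos_of_nonneg_of_nonpos (inv_nonneg.2 ht.le) (by linarith)
    linarith

/-- If all inequalities with `v ≠ 0` were strict, the finitely many that define the polyhedron would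
cut out an open neighbourhood of `w` in it; those with `v = 0` hold for every slope. -/
theorem exists_tight [L.FiniteIndex] (h : IsLocalLipschitzConstraint L A q) {w : Slope d}
    (hw : w ∈ slopeSet L q) (hw' : w ∉ interior (slopeSet L q)) :
    ∃ a : Site d, ∃ v ∈ L, v ≠ 0 ∧ w (toVec v) = q a (a + v) := by
  by_contra! hcon
  obtain ⟨F, hFL, hF⟩ := slopeSet_polyhedral h
  apply hw'
  rw [mem_interior]
  refine ⟨⋂ r : Site d ⧸ L, ⋂ v ∈ F.erase 0, {u : Slope d | u (toVec v) < q r.out (r.out + v)},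
    ?_, ?_, ?_⟩
  · intro u hu
    rw [hF]
    intro r v hv
    by_cases hv0 : v = 0
    · subst hv0
      simp [h.quasimetric.self]
    · simp only [mem_iInter] at hu
      exact (hu r v (Finset.mem_erase.2 ⟨hv0, hv⟩)).le
  · refine isOpen_iInter_of_finite fun r => isOpen_biInter_finset fun v _ =>
      isOpen_lt ?_ continuous_const
    fun_prop
  · simp only [mem_iInter]
    intro r v hv
    rw [Finset.mem_erase] at hv
    exact lt_of_le_of_ne (h.quasimetric.slope_le hw _ (hFL v hv.2)) (hcon _ v (hFL v hv.2) hv.1)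

theorem one_le_norm_toVec {v : Site d} (hv : v ≠ 0) : 1 ≤ ‖toVec v‖ := by
  obtain ⟨i, hi⟩ := Function.ne_iff.1 hv
  refine le_trans ?_ (norm_le_pi_norm (toVec v) i)
  rw [toVec, Real.norm_eq_abs]
  exact_mod_cast Int.one_le_abs hi

/-- In the interior of the set of Lipschitz slopes there is room below the constraint. -/
theorem exists_strict_equivariant [L.FiniteIndex] (h : IsLocalLipschitzConstraint L A q)
    {u : Slope d} (hu : u ∈ interior (slopeSet L q)) :
    ∃ c > (0 : ℝ), ∃ f : Site d → ℝ, (∀ x, ∀ v ∈ L, f (x + v) = f x + u (toVec v)) ∧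
      ∀ x y, A.Adj x y → f y - f x ≤ q x y - c := by
  have hu₀ : u ∈ slopeSet L q := interior_subset hu
  obtain ⟨δ, hδ, hball⟩ := Metric.isOpen_iff.1 isOpen_interior u hu
  -- slack on the walks between distinct equivalent vertices
  have hslack : ∀ a, ∀ v ∈ L, v ≠ 0 → u (toVec v) + δ / 2 ≤ q a (a + v) := by
    intro a v hv hv0
    have hx : toVec v ≠ 0 := fun h0 => by have := one_le_norm_toVec hv0; simp [h0] at this; linarith
    -- Moving the slope by `δ / 2` in a direction norming `toVec v` stays in the set and raises the
    -- value at `v` by at least `δ / 2`, since nonzero integer vectors have norm at least one.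
    obtain ⟨g, hg1, hg2⟩ := exists_dual_vector ℝ (toVec v) (by simpa using hx)
    have hmem : u + (δ / 2) • g ∈ slopeSet L q := by
      refine interior_subset (hball ?_)
      rw [Metric.mem_ball, dist_eq_norm, add_sub_cancel_left, norm_smul, hg1]
      simp [abs_of_pos hδ]
      linarith
    have := h.quasimetric.slope_le hmem a hv
    simp only [add_apply, smul_apply, smul_eq_mul] at this
    rw [hg2] at this
    have h1 := one_le_norm_toVec hv0
    simp only [RCLike.ofReal_real_eq_id, id_eq] at this
    nlinarith
  -- slack on the closed walks
  obtain ⟨κ, hκ, hκ'⟩ : ∃ κ > (0 : ℝ), ∀ x y, A.Adj x y → κ ≤ q x y + q y x := by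
    have hfin : {p : Site d × Site d | (∃ r : Site d ⧸ L, p.1 = r.out) ∧ A.Adj p.1 p.2}.Finite := by
      obtain ⟨D, hD⟩ := h.graph.bounded_degree
      refine (Set.finite_iUnion fun r : Site d ⧸ L =>
        (Set.finite_of_encard_le_coe (hD r.out)).image fun y => (r.out, y)).subset ?_
      rintro ⟨x, y⟩ ⟨⟨r, hr⟩, hxy⟩
      simp only at hr hxy
      subst hr
      exact mem_iUnion.2 ⟨r, y, hxy, rfl⟩
    obtain ⟨κ, hκ, hmin⟩ : ∃ κ > (0 : ℝ), ∀ p ∈ hfin.toFinset, κ ≤ q p.1 p.2 + q p.2 p.1 := by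
      rcases hfin.toFinset.eq_empty_or_nonempty with he | hne
      · exact ⟨1, one_pos, by simp [he]⟩
      · obtain ⟨p, hp, hp'⟩ := hfin.toFinset.exists_min_image (fun p => q p.1 p.2 + q p.2 p.1) hne
        exact ⟨_, h.quasimetric.pos _ _ (hfin.mem_toFinset.1 hp).2.ne, hp'⟩
    refine ⟨κ, hκ, fun x y hxy => ?_⟩
    obtain ⟨t, ht, hxt⟩ := exists_out L x
    have hy : y = (y - t) + t := by abel
    generalize hr : (x : Site d ⧸ L) = r at hxt
    subst hxt
    rw [hy] at hxy ⊢
    rw [h.quasimetric.periodic t ht, h.quasimetric.periodic t ht]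
    exact hmin (r.out, y - t) (hfin.mem_toFinset.2 ⟨⟨r, rfl⟩, (h.graph.periodic t ht _ _).1 hxy⟩)
  -- Only walks of at most `Nat.card (Site d ⧸ L)` steps have to be checked, so lowering every edge
  -- by `c` costs them at most `min (δ / 2) κ`, the slack found above.
  set N : ℝ := (Nat.card (Site d ⧸ L) : ℝ) + 1 with hN
  have hNpos : 0 < N := by positivity
  set c := min (δ / 2) κ / N with hc
  have hcpos : 0 < c := div_pos (lt_min (by linarith) hκ) hNpos
  have hb : ∀ n x y s, HasWalk A q n x y s → q x y ≤ s := fun n x y s hs =>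
    le_weight_of_hasWalk (fun x => (h.quasimetric.self x).le) h.quasimetric.triangle
      (fun _ _ _ => le_rfl) hs
  have hper : ∀ v ∈ L, ∀ x y, q (x + v) (y + v) - c = q x y - c := fun v hv x y => by
    rw [h.quasimetric.periodic v hv]
  refine ⟨c, hcpos, exists_equivariant (w := fun x y => q x y - c) h.graph hper u
    (weight_ge_of_short h.graph.periodic hper u ?_)⟩
  rintro n hn a v hv s ⟨e, e0, en, he, rfl⟩
  rw [Finset.sum_sub_distrib, Finset.sum_const, Finset.card_range, nsmul_eq_mul]
  have hw : HasWalk A q n a (a + v) (∑ i ∈ Finset.range n, q (e i) (e (i + 1))) :=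
    ⟨e, e0, en, he, rfl⟩
  have hnc : (n : ℝ) * c ≤ min (δ / 2) κ := by
    rw [hc, mul_div_assoc', div_le_iff₀ hNpos, mul_comm]
    refine mul_le_mul_of_nonneg_left ?_ (le_min (by linarith) hκ.le)
    have : (n : ℝ) ≤ Nat.card (Site d ⧸ L) := by exact_mod_cast hn
    linarith
  by_cases hv0 : v = 0
  · subst hv0
    rcases Nat.eq_zero_or_pos n with rfl | hnpos
    · simp
    -- A nonempty closed walk weighs at least its first edge plus the distance back, hence at least
    -- `κ`.
    · have h1 : HasWalk A q (n - 1) (e 1) (e n) _ := HasWalk.split hnpos he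
      have h2 := hb _ _ _ _ h1
      have h3 : ∑ i ∈ Finset.range n, q (e i) (e (i + 1)) =
          q (e 0) (e 1) + ∑ i ∈ Finset.Ico 1 n, q (e i) (e (i + 1)) := by
        rw [Finset.range_eq_Ico, Finset.sum_eq_sum_Ico_succ_bot hnpos]
      have h4 := hκ' _ _ (he 0 hnpos)
      rw [en, add_zero, ← e0] at h2
      rw [h3]
      simp only [toVec_zero, map_zero, zero_add] at h4 ⊢
      have := min_le_right (δ / 2) κ
      linarith
  · have h1 := hslack a v hv hv0
    have h2 := hb _ _ _ _ hw
    have := min_le_left (δ / 2) κ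
    linarith

/-- The shrunk quasimetrics exist below a function with room. -/
theorem exists_shrunk (h : IsLocalLipschitzConstraint L A q) {c ε : ℝ} (hε : ε < c)
    {f : Site d → ℝ} (hf : ∀ x y, A.Adj x y → f y - f x ≤ q x y - c) :
    ∃ p, IsShrunkQuasimetric L A q ε p ∧
      ∀ x y, x ≠ y → f y - f x ≤ p x y - (c - ε) := by
  classical
  -- The room `c - ε` is added once for each pair of distinct vertices. As it is positive, the
  -- triangle inequality persists, and `b` lies below the weights `q - ε` on the edges, hence below
  -- those of all walks.
  set b : Site d → Site d → ℝ := fun x y => f y - f x + if x = y then 0 else c - ε with hb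
  have hw : ∀ n x y s, HasWalk A (fun x y => q x y - ε) n x y s → b x y ≤ s := fun n x y s hs => by
    refine le_weight_of_hasWalk (b := b) (by simp [hb]) ?_ ?_ hs
    · intro x y z
      simp only [hb]
      split_ifs <;> first | linarith | (exfalso; simp_all)
    · intro x y hxy
      simp only [hb, if_neg hxy.ne]
      have := hf x y hxy
      linarith
  have hper : ∀ v ∈ L, ∀ x y, q (x + v) (y + v) - ε = q x y - ε := fun v hv x y => by
    rw [h.quasimetric.periodic v hv]
  refine ⟨walkDist A fun x y => q x y - ε, ⟨⟨isAdmissibleQuasimetric_walkDist h.graph hper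
    (b := b) (by simp [hb]) ?_ hw, fun x y hxy => walkDist_le hw (HasWalk.edge hxy)⟩, ?_⟩, ?_⟩
  · intro x y hxy
    simp only [hb, if_neg hxy, if_neg hxy.symm]
    linarith
  · rintro p ⟨hp, hp'⟩ x y
    exact le_walkDist h.graph.connected fun n s hs =>
      le_weight_of_hasWalk (fun x => (hp.self x).le) hp.triangle hp' hs
  · intro x y hxy
    have := le_walkDist h.graph.connected (hw · x y ·)
    simp only [hb, if_neg hxy] at this
    linarith

end Walks

/-! ## The gradient sigma-algebras and the gradient reference measures -/

/-- The properties of the height space on which the arguments rely. -/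
class IsRegularHeight (E : Type) [AddCommGroup E] [MeasurableSpace E] [HeightSpace E] : Prop where
  measurableAdd : MeasurableAdd₂ E
  measurableNeg : MeasurableNeg E
  measurable_toReal : Measurable (HeightSpace.toReal : E → ℝ)
  sigmaFinite : SigmaFinite (HeightSpace.ref : Measure E)
  invariant : (HeightSpace.ref : Measure E).IsAddLeftInvariant
  exists_unit : ∃ s : Set E, MeasurableSet s ∧ HeightSpace.ref s = 1
  ref_le : ∀ K : ℝ, 0 ≤ K →
    HeightSpace.ref {t : E | |HeightSpace.toReal t| ≤ K} ≤ ENNReal.ofReal (2 * K + 1)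

attribute [instance] IsRegularHeight.measurableAdd IsRegularHeight.measurableNeg
  IsRegularHeight.sigmaFinite IsRegularHeight.invariant

instance : IsRegularHeight ℝ where
  measurableAdd := inferInstance
  measurableNeg := inferInstance
  measurable_toReal := measurable_id
  sigmaFinite := inferInstanceAs (SigmaFinite (volume : Measure ℝ))
  invariant := inferInstanceAs ((volume : Measure ℝ).IsAddLeftInvariant)
  exists_unit := ⟨Icc 0 1, measurableSet_Icc, by
    change volume (Icc (0 : ℝ) 1) = 1
    simp⟩
  ref_le K hK := by
    change volume {t : ℝ | |t| ≤ K} ≤ _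
    have : {t : ℝ | |t| ≤ K} = Icc (-K) K := by ext; simp [abs_le]
    rw [this, Real.volume_Icc]
    exact ENNReal.ofReal_le_ofReal (by linarith)

instance : IsRegularHeight ℤ where
  measurableAdd := inferInstance
  measurableNeg := inferInstance
  measurable_toReal := measurable_from_top
  sigmaFinite := inferInstanceAs (SigmaFinite (Measure.count : Measure ℤ))
  invariant := inferInstanceAs ((Measure.count : Measure ℤ).IsAddLeftInvariant)
  exists_unit := ⟨{0}, measurableSet_singleton _, by
    change Measure.count ({0} : Set ℤ) = 1
    simp⟩
  ref_le K hK := by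
    change Measure.count {t : ℤ | |(t : ℝ)| ≤ K} ≤ _
    have : {t : ℤ | |(t : ℝ)| ≤ K} = (Finset.Icc (-⌊K⌋) ⌊K⌋ : Finset ℤ) := by
      ext t
      simp only [mem_ofPred_eq, abs_le, Finset.coe_Icc, mem_Icc, Int.le_floor]
      rw [neg_le (a := ⌊K⌋), Int.le_floor, neg_le (a := K)]
      push_cast
      rfl
    rw [this, Measure.count_apply_finset, Int.card_Icc]
    rw [← ENNReal.ofReal_natCast]
    refine ENNReal.ofReal_le_ofReal ?_
    have h0 : 0 ≤ ⌊K⌋ := Int.floor_nonneg.2 hK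
    have h1 : (⌊K⌋ : ℝ) ≤ K := Int.floor_le K
    have h2 : ((⌊K⌋ + 1 - -⌊K⌋).toNat : ℤ) = 2 * ⌊K⌋ + 1 := by omega
    have h3 : (((⌊K⌋ + 1 - -⌊K⌋).toNat : ℤ) : ℝ) = 2 * ⌊K⌋ + 1 := by rw [h2]; push_cast; ring
    rw [Int.cast_natCast] at h3
    rw [h3]
    linarith

section Gradient

variable {d : ℕ} {E : Type} [AddCommGroup E] [MeasurableSpace E]

/-- The gradient sigma-algebra is coarser than the pull-back of the full power set under the map to
the differences inside `Λ`, so its sets cannot separate configurations with equal differences. -/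
theorem mem_of_gradient_eq {Λ : Set (Site d)} {S : Set (HeightFunction d E)}
    (hS : MeasurableSet[gradientAlgebra Λ] S) {φ ψ : HeightFunction d E}
    (h : ∀ x ∈ Λ, ∀ y ∈ Λ, φ y - φ x = ψ y - ψ x) (hφ : φ ∈ S) : ψ ∈ S := by
  have hle : (gradientAlgebra Λ : MeasurableSpace (HeightFunction d E)) ≤
      MeasurableSpace.comap (fun (φ : HeightFunction d E) (p : Λ × Λ) => φ p.2.1 - φ p.1.1) ⊤ := by
    refine iSup₂_le fun x hx => iSup₂_le fun y hy => ?_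
    rintro _ ⟨T, -, rfl⟩
    exact ⟨{g | g (⟨x, hx⟩, ⟨y, hy⟩) ∈ T}, trivial, rfl⟩
  obtain ⟨T, -, rfl⟩ := hle S hS
  have : (fun p : Λ × Λ => φ p.2.1 - φ p.1.1) = fun p : Λ × Λ => ψ p.2.1 - ψ p.1.1 := by
    funext p
    exact h _ p.1.2 _ p.2.2
  simp only [mem_preimage] at hφ ⊢
  rwa [← this]

theorem eq_of_gradient_eq {β : Type*} [MeasurableSpace β] [MeasurableSingletonClass β]
    {Λ : Set (Site d)} {f : HeightFunction d E → β} (hf : Measurable[gradientAlgebra Λ] f)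
    {φ ψ : HeightFunction d E} (h : ∀ x ∈ Λ, ∀ y ∈ Λ, φ y - φ x = ψ y - ψ x) : f ψ = f φ :=
  mem_of_gradient_eq (hf (measurableSet_singleton (f φ))) h rfl

theorem eq_of_eq_add_const {β : Type*} [MeasurableSpace β] [MeasurableSingletonClass β]
    {Λ : Set (Site d)} {f : HeightFunction d E → β} (hf : Measurable[gradientAlgebra Λ] f)
    {φ ψ : HeightFunction d E} (c : E) (h : ∀ x ∈ Λ, φ x = ψ x + c) : f ψ = f φ :=
  eq_of_gradient_eq hf fun x hx y hy => by rw [h x hx, h y hy]; abel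

theorem measurable_gradientAlgebra {X : Type*} {m : MeasurableSpace X} {Λ : Set (Site d)}
    {g : X → HeightFunction d E} (h : ∀ x ∈ Λ, ∀ y ∈ Λ, Measurable fun a => g a y - g a x) :
    @Measurable _ _ m (gradientAlgebra Λ) g := by
  rw [measurable_iff_comap_le]
  simp only [MeasurableSpace.comap_iSup]
  refine iSup₂_le fun x hx => iSup₂_le fun y hy => ?_
  rw [MeasurableSpace.comap_comp]
  exact (h x hx y hy).comap_le

theorem measurable_sub_apply {Λ : Set (Site d)} {x y : Site d} (hx : x ∈ Λ) (hy : y ∈ Λ) :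
    Measurable[gradientAlgebra Λ] fun φ : HeightFunction d E => φ y - φ x := by
  rw [measurable_iff_comap_le]
  exact le_iSup₂_of_le x hx (le_iSup₂_of_le y hy le_rfl)

theorem measurable_gradient (x y : Site d) :
    Measurable fun φ : HeightFunction d E => φ y - φ x :=
  measurable_sub_apply (Set.mem_univ x) (Set.mem_univ y)

theorem measurable_shift (v : Site d) : Measurable (shift v : HeightFunction d E → _) :=
  measurable_gradientAlgebra fun x _ y _ => measurable_gradient (x + v) (y + v)

theorem gradientAlgebra_mono {Λ Δ : Set (Site d)} (h : Λ ⊆ Δ) :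
    (gradientAlgebra Λ : MeasurableSpace (HeightFunction d E)) ≤ gradientAlgebra Δ :=
  iSup₂_le fun x hx => iSup₂_le fun y hy =>
    le_iSup₂_of_le x (h hx) (le_iSup₂_of_le y (h hy) le_rfl)

variable [HeightSpace E] [IsRegularHeight E]

theorem measurable_of_pi :
    @Measurable (Site d → E) (HeightFunction d E) _ _ id :=
  measurable_gradientAlgebra fun x _ y _ => (measurable_pi_apply y).sub (measurable_pi_apply x)

theorem measurable_extendZero (Λ : Finset (Site d)) (x : Site d) (Δ : Set (Site d)) :
    @Measurable _ _ _ (gradientAlgebra Δ) (extendZero (E := E) Λ x) := by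
  have h : ∀ y, Measurable fun ψ : ↥(Λ.erase x) → E => extendZero Λ x ψ y := by
    intro y
    by_cases hy : y ∈ Λ.erase x
    · simpa only [extendZero, hy, dif_pos] using measurable_pi_apply (⟨y, hy⟩ : ↥(Λ.erase x))
    · simpa only [extendZero, hy, dif_neg, not_false_eq_true] using measurable_const
  exact measurable_gradientAlgebra fun y _ z _ => (h z).sub (h y)

theorem lintegral_gradientRef {Λ : Finset (Site d)} {x : Site d} {f : HeightFunction d E → ℝ≥0∞}
    (hf : Measurable[gradientAlgebra (Λ : Set (Site d))] f) :
    @lintegral _ (gradientAlgebra (Λ : Set (Site d))) (gradientRef Λ x) f =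
      ∫⁻ ψ, f (extendZero Λ x ψ) ∂Measure.pi fun _ : ↥(Λ.erase x) => HeightSpace.ref (E := E) := by
  let _ : MeasurableSpace (HeightFunction d E) := gradientAlgebra (Λ : Set (Site d))
  exact lintegral_map hf (measurable_extendZero Λ x _)

/-- The map `φ ↦ (φ i - φ x)` carries the reference measure back to the product measure, and a
measure with a sigma-finite image is sigma-finite. -/
theorem sigmaFinite_gradientRef {Λ : Finset (Site d)} {x : Site d} (hx : x ∈ Λ) :
    @SigmaFinite (HeightFunction d E) (gradientAlgebra (Λ : Set (Site d))) (gradientRef Λ x) := by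
  have hD : @Measurable _ _ (gradientAlgebra (Λ : Set (Site d))) _
      (fun (φ : HeightFunction d E) (i : ↥(Λ.erase x)) => φ i - φ x) :=
    @measurable_pi_lambda _ _ _ (gradientAlgebra (Λ : Set (Site d))) _ _ fun i =>
      measurable_sub_apply hx (Finset.mem_of_mem_erase i.2)
  refine @SigmaFinite.of_map _ _ (gradientAlgebra (Λ : Set (Site d))) _ (gradientRef Λ x) _
    (@Measurable.aemeasurable _ _ (gradientAlgebra (Λ : Set (Site d))) _ _ _ hD) ?_
  have : @Measure.map _ _ (gradientAlgebra (Λ : Set (Site d))) _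
      (fun (φ : HeightFunction d E) (i : ↥(Λ.erase x)) => φ i - φ x) (gradientRef Λ x) =
      Measure.pi fun _ : ↥(Λ.erase x) => HeightSpace.ref (E := E) := by
    rw [gradientRef, @Measure.map_map _ _ _ _ (gradientAlgebra (Λ : Set (Site d))) _ _ _ _ hD
      (measurable_extendZero Λ x _)]
    convert Measure.map_id
    ext ψ i
    have h1 : (i : Site d) ∈ Λ.erase x := i.2
    simp only [Function.comp, extendZero, h1, dif_pos, Finset.notMem_erase, dif_neg,
      not_false_eq_true, sub_zero, id]
  rw [this]
  infer_instance

/-- Gradient functions ignore a common constant and the measure on `E` is translation invariant, so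
neither the height at which `x` is held nor an added `h` affects the integral. This turns integrals
against `gradientRef` into marginals, which can be iterated. -/
theorem lmarginal_gradient {Λ : Finset (Site d)} {x : Site d} (hx : x ∈ Λ)
    {f : HeightFunction d E → ℝ≥0∞} (hf : Measurable[gradientAlgebra (Λ : Set (Site d))] f)
    (h φ : Site d → E) :
    (∫⋯∫⁻_Λ.erase x, (fun ψ => f (ψ + h)) ∂fun _ => (HeightSpace.ref : Measure E)) φ =
      @lintegral _ (gradientAlgebra (Λ : Set (Site d))) (gradientRef Λ x) f := by
  rw [lintegral_gradientRef hf, lmarginal]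
  rw [← lintegral_add_right_eq_self (μ := Measure.pi fun _ : ↥(Λ.erase x) => HeightSpace.ref (E := E))
    (fun ψ => f (extendZero Λ x ψ)) (fun i : ↥(Λ.erase x) => h i - φ x - h x)]
  refine lintegral_congr fun ψ => ?_
  refine eq_of_eq_add_const hf (-(φ x) - h x) fun i hi => ?_
  by_cases hix : i = x
  · subst hix
    simp [extendZero, Function.updateFinset]
  · have hi' : i ∈ Λ.erase x := Finset.mem_erase.2 ⟨hix, hi⟩
    simp only [extendZero, hi', dif_pos, Pi.add_apply, Function.updateFinset]
    abel

end Gradient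

/-! ### Integrating out products of conditional densities -/

section Marginal

variable {δ : Type*} [DecidableEq δ] {X : δ → Type*} [∀ i, MeasurableSpace (X i)]
  {μ : ∀ i, Measure (X i)}

theorem lmarginal_mul_left {s : Finset δ} {G F : (∀ i, X i) → ℝ≥0∞} (hF : Measurable F)
    (hG : ∀ φ y, G (Function.updateFinset φ s y) = G φ) (φ : ∀ i, X i) :
    (∫⋯∫⁻_s, (fun φ => G φ * F φ) ∂μ) φ = G φ * (∫⋯∫⁻_s, F ∂μ) φ := by
  simp only [lmarginal, hG]
  exact lintegral_const_mul _ (hF.comp measurable_updateFinset)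

/-- A product of partial densities on disjoint blocks, each depending only on its own block and on
the blocks of lower rank, has mass at most one. -/
theorem lmarginal_prod_le_one [∀ i, SigmaFinite (μ i)] {ι : Type*} [DecidableEq ι] (s : Finset ι) (rank : ι → ℕ)
    (B : ι → Finset δ) (G : ι → (∀ i, X i) → ℝ≥0∞) (hG : ∀ i, Measurable (G i))
    (hdisj : (s : Set ι).PairwiseDisjoint B)
    (hindep : ∀ i ∈ s, ∀ j ∈ s, i ≠ j → rank i ≤ rank j →
      ∀ φ y, G i (Function.updateFinset φ (B j) y) = G i φ)
    (hle : ∀ i ∈ s, ∀ φ, (∫⋯∫⁻_B i, G i ∂μ) φ ≤ 1) (φ : ∀ i, X i) :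
    (∫⋯∫⁻_s.biUnion B, (fun φ => ∏ i ∈ s, G i φ) ∂μ) φ ≤ 1 := by
  induction s using Finset.induction_on_max_value rank generalizing φ with
  | empty => simp
  | insert a s ha hmax ih =>
    have hms : Measurable fun φ => ∏ i ∈ insert a s, G i φ :=
      Finset.measurable_prod _ fun i _ => hG i
    rw [Finset.biUnion_insert, lmarginal_union' _ _ hms]
    · have : ∫⋯∫⁻_B a, (fun φ => ∏ i ∈ insert a s, G i φ) ∂μ ≤ fun φ => ∏ i ∈ s, G i φ := by
        intro φ
        simp only [Finset.prod_insert ha]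
        simp only [mul_comm (G a _)]
        rw [lmarginal_mul_left (hG a)]
        · exact mul_le_of_le_one_right' (hle a (Finset.mem_insert_self _ _) φ)
        · intro φ y
          refine Finset.prod_congr rfl fun i hi => ?_
          exact hindep i (Finset.mem_insert_of_mem hi) a (Finset.mem_insert_self _ _)
            (fun h => ha (h ▸ hi)) (hmax i hi) φ y
      refine (lmarginal_mono this φ).trans (ih ?_ ?_ ?_ φ)
      · exact hdisj.subset (by simp)
      · exact fun i hi j hj => hindep i (Finset.mem_insert_of_mem hi) j (Finset.mem_insert_of_mem hj)
      · exact fun i hi => hle i (Finset.mem_insert_of_mem hi)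
    · rw [Finset.disjoint_biUnion_right]
      intro i hi
      exact hdisj (by simp) (by simp [hi]) fun h => ha (h ▸ hi)

end Marginal

/-! ### Densities on a block with a root -/

section Tiling

variable {d : ℕ} {E : Type} [AddCommGroup E] [MeasurableSpace E] [HeightSpace E]
  [IsRegularHeight E]

/-- The rest of the block is integrated with the root height fixed, and then the root height, whose
density is `g` translated by a quantity determined outside the block. -/
theorem lmarginal_root_le_one {B : Finset (Site d)} {x : Site d} (hx : x ∈ B)
    {F : (Site d → E) → ℝ≥0∞} (hF : Measurable F)
    (hF1 : ∀ φ, (∫⋯∫⁻_B.erase x, F ∂fun _ => (HeightSpace.ref : Measure E)) φ ≤ 1)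
    {g : E → ℝ≥0∞} (hg : Measurable g) (hg1 : ∫⁻ t, g t ∂HeightSpace.ref ≤ 1)
    {c : (Site d → E) → E} (hc : Measurable c)
    (hcB : ∀ φ y, c (Function.updateFinset φ B y) = c φ) (φ : Site d → E) :
    (∫⋯∫⁻_B, (fun φ => F φ * g (φ x - c φ)) ∂fun _ => (HeightSpace.ref : Measure E)) φ ≤ 1 := by
  have hm : Measurable fun φ : Site d → E => g (φ x - c φ) :=
    hg.comp ((measurable_pi_apply x).sub hc)
  have hcu : ∀ (φ ψ : Site d → E), (∀ i ∉ B, φ i = ψ i) → c φ = c ψ := by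
    intro φ ψ h
    rw [← hcB φ (fun _ => 0), ← hcB ψ (fun _ => 0)]
    congr 1
    ext i
    by_cases hi : i ∈ B
    · simp [Function.updateFinset, hi]
    · simp [Function.updateFinset, hi, h i hi]
  rw [lmarginal_erase (fun φ => F φ * g (φ x - c φ)) (hF.mul hm) hx]
  calc _ ≤ ∫⁻ t, g (t - c φ) ∂HeightSpace.ref := by
        refine lintegral_mono fun t => ?_
        simp only [mul_comm (F _)]
        rw [lmarginal_mul_left hF]
        · rw [Function.update_self, hcu (Function.update φ x t) φ fun i hi =>
            Function.update_of_ne (fun h : i = x => hi (h.symm ▸ hx)) _ _]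
          exact mul_le_of_le_one_right' (hF1 _)
        · intro ψ y
          rw [hcu (Function.updateFinset ψ (B.erase x) y) ψ fun i hi => by
            simp [Function.updateFinset, hi]]
          simp [Function.updateFinset]
    _ = ∫⁻ t, g t ∂HeightSpace.ref := lintegral_sub_right_eq_self g (c φ)
    _ ≤ 1 := hg1

theorem lmarginal_translate (v : Site d) (s : Finset (Site d)) {F : (Site d → E) → ℝ≥0∞}
    (hF : Measurable F) (φ : Site d → E) :
    (∫⋯∫⁻_translate v s, (fun φ => F (fun y => φ (y + v))) ∂fun _ => (HeightSpace.ref : Measure E)) φ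
      = (∫⋯∫⁻_s, F ∂fun _ => (HeightSpace.ref : Measure E)) (fun y => φ (y + v)) := by
  have := lmarginal_image (μ := fun _ : Site d => (HeightSpace.ref : Measure E))
    (add_left_injective v) s hF φ
  rw [translate, Finset.map_eq_image]
  exact this

/-- The integral of a gradient function against a density for the height at the root. -/
theorem lmarginal_gauge {Λ : Finset (Site d)} {x : Site d} (hx : x ∈ Λ)
    {f : HeightFunction d E → ℝ≥0∞} (hf : Measurable[gradientAlgebra (Λ : Set (Site d))] f)
    {s : Set E} (hs : MeasurableSet s) (hs1 : HeightSpace.ref s = 1) (φ : Site d → E) :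
    (∫⋯∫⁻_Λ, (fun φ => s.indicator 1 (φ x) * f φ) ∂fun _ => (HeightSpace.ref : Measure E)) φ =
      @lintegral _ (gradientAlgebra (Λ : Set (Site d))) (gradientRef Λ x) f := by
  have hf' : Measurable fun φ : Site d → E => f φ :=
    (hf.mono (gradientAlgebra_le _) le_rfl).comp measurable_of_pi
  have hi : Measurable fun φ : Site d → E => s.indicator (1 : E → ℝ≥0∞) (φ x) :=
    (measurable_one.indicator hs).comp (measurable_pi_apply x)
  rw [lmarginal_erase (fun φ => s.indicator 1 (φ x) * f φ) (hi.mul hf') hx]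
  have : ∀ t, (∫⋯∫⁻_Λ.erase x, (fun φ => s.indicator 1 (φ x) * f φ)
      ∂fun _ => (HeightSpace.ref : Measure E)) (Function.update φ x t) =
      s.indicator 1 t * @lintegral _ (gradientAlgebra (Λ : Set (Site d))) (gradientRef Λ x) f := by
    intro t
    rw [lmarginal_mul_left hf']
    · have := lmarginal_gradient hx hf 0 (Function.update φ x t)
      simp only [add_zero] at this
      rw [this, Function.update_self]
    · intro ψ y
      simp [Function.updateFinset]
  simp only [this]
  rw [lintegral_mul_const _ (measurable_one.indicator hs), lintegral_indicator_one hs, hs1, one_mul]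

end Tiling

/-! ## Tilings of boxes -/

section Boxes

variable {d : ℕ}

theorem mem_box {n : ℕ} {x : Site d} : x ∈ box d n ↔ ∀ j, 0 ≤ x j ∧ x j < n := by
  simp [box, Fintype.mem_piFinset, Finset.mem_Ico]

theorem card_box (d n : ℕ) : (box d n).card = n ^ d := by
  simp [box, Fintype.card_piFinset]

theorem zero_mem_box {n : ℕ} (hn : 1 ≤ n) : (0 : Site d) ∈ box d n := by
  rw [mem_box]
  intro j
  exact ⟨le_rfl, by simpa using Nat.lt_of_lt_of_le Nat.zero_lt_one hn⟩

theorem mem_translate {v y : Site d} {Λ : Finset (Site d)} :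
    y ∈ translate v Λ ↔ y - v ∈ Λ := by
  simp only [translate, Finset.mem_map, addRightEmbedding_apply]
  constructor
  · rintro ⟨x, hx, rfl⟩; simpa using hx
  · intro h; exact ⟨_, h, by simp⟩

theorem card_translate (v : Site d) (Λ : Finset (Site d)) : (translate v Λ).card = Λ.card :=
  Finset.card_map _

/-- The positions of the tiles: the vertices `k • w` in the box of side `n` at which a tile of
side at most `k` fits. -/
noncomputable def tilePositions (d n k : ℕ) : Finset (Site d) := (box d (n / k)).image fun w => (k : ℤ) • w

/-- The vertices of the box of side `n` that are not covered by the tiles of side `l`. -/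
noncomputable def uncovered (d n k l : ℕ) : Finset (Site d) :=
  box d n \ (tilePositions d n k).biUnion fun v => translate v (box d l)

theorem translate_subset_box {n k l : ℕ} (hlk : l ≤ k) {v : Site d}
    (hv : v ∈ tilePositions d n k) : translate v (box d l) ⊆ box d n := by
  intro y hy
  simp only [tilePositions, Finset.mem_image] at hv
  obtain ⟨w, hw, rfl⟩ := hv
  rw [mem_translate, mem_box] at hy
  rw [mem_box] at hw ⊢
  intro j
  have h1 := hy j
  have h2 := hw j
  simp only [Pi.sub_apply, Pi.smul_apply, smul_eq_mul] at h1
  have h3 : (k : ℤ) * (n / k : ℕ) ≤ n := by exact_mod_cast Nat.mul_div_le n k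
  have h4 : (l : ℤ) ≤ k := by exact_mod_cast hlk
  have h5 : (0 : ℤ) ≤ k := by positivity
  constructor
  · nlinarith
  · nlinarith

theorem disjoint_tiles {n k l : ℕ} (hlk : l ≤ k) {v v' : Site d}
    (hv : v ∈ tilePositions d n k) (hv' : v' ∈ tilePositions d n k) (hne : v ≠ v') :
    Disjoint (translate v (box d l)) (translate v' (box d l)) := by
  rw [Finset.disjoint_left]
  intro y hy hy'
  apply hne
  simp only [tilePositions, Finset.mem_image] at hv hv'
  obtain ⟨w, -, rfl⟩ := hv
  obtain ⟨w', -, rfl⟩ := hv'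
  congr 1
  ext j
  rw [mem_translate, mem_box] at hy hy'
  have h1 := hy j
  have h2 := hy' j
  simp only [Pi.sub_apply, Pi.smul_apply, smul_eq_mul] at h1 h2
  have h4 : (l : ℤ) ≤ k := by exact_mod_cast hlk
  have hk : (0 : ℤ) < k := by linarith
  rcases lt_trichotomy (w j) (w' j) with h | h | h
  · have : (k : ℤ) * (w j + 1) ≤ k * w' j := mul_le_mul_of_nonneg_left h hk.le
    linarith
  · exact h
  · have : (k : ℤ) * (w' j + 1) ≤ k * w j := mul_le_mul_of_nonneg_left h hk.le
    linarith

theorem card_tilePositions {n k : ℕ} (hk : 1 ≤ k) :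
    (tilePositions d n k).card = (n / k) ^ d := by
  rw [tilePositions, Finset.card_image_of_injective, card_box]
  intro w w' h
  ext j
  have := congrFun h j
  simp only [Pi.smul_apply, smul_eq_mul] at this
  have hk' : (k : ℤ) ≠ 0 := by positivity
  exact mul_left_cancel₀ hk' this

theorem card_uncovered {n k l : ℕ} (hk : 1 ≤ k) (hlk : l ≤ k) :
    (uncovered d n k l).card + (n / k) ^ d * l ^ d = n ^ d := by
  have h1 : ((tilePositions d n k).biUnion fun v => translate v (box d l)).card =
      (n / k) ^ d * l ^ d := by
    rw [Finset.card_biUnion fun v hv v' hv' hne => disjoint_tiles hlk hv hv' hne]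
    simp [card_translate, card_box, card_tilePositions hk]
  rw [uncovered, ← h1, Finset.card_sdiff_add_card_eq_card, card_box]
  exact Finset.biUnion_subset.2 fun v hv => translate_subset_box hlk hv

/-- A neighbour of a vertex, one step closer to the origin in the positive orthant. -/
noncomputable def parent (i : Site d) : Site d :=
  open Classical in
  if h : ∃ j, 1 ≤ i j then i - Pi.single h.choose 1 else i

theorem exists_parent_eq {n : ℕ} {i : Site d} (hi : i ∈ box d n) (hi0 : i ≠ 0) :
    ∃ j, 1 ≤ i j ∧ parent i = i - Pi.single j 1 := by
  rw [mem_box] at hi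
  have h : ∃ j, 1 ≤ i j := by
    obtain ⟨j, hj⟩ := Function.ne_iff.1 hi0
    refine ⟨j, ?_⟩
    have := (hi j).1
    simp only [Pi.zero_apply, ne_eq] at hj
    omega
  exact ⟨h.choose, h.choose_spec, by rw [parent, dif_pos h]⟩

theorem parent_mem_box {n : ℕ} {i : Site d} (hi : i ∈ box d n) (hi0 : i ≠ 0) :
    parent i ∈ box d n := by
  obtain ⟨j, hj, hp⟩ := exists_parent_eq hi hi0
  rw [hp, mem_box]
  rw [mem_box] at hi
  intro j'
  have := hi j'
  by_cases h : j' = j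
  · subst h; simp; omega
  · simp [h, this]

/-- The distance to the origin of a vertex of the positive orthant. -/
def rank (i : Site d) : ℕ := ∑ j, (i j).toNat

theorem rank_mono {i y : Site d} (h : ∀ j, i j ≤ y j) : rank i ≤ rank y :=
  Finset.sum_le_sum fun j _ => Int.toNat_le_toNat (h j)

/-- Together with `le_of_mem_block` and `rank_mono` this orders the blocks: the parent of a root
never lies in a block whose root has at least the same rank. -/
theorem rank_parent_lt {n : ℕ} {i : Site d} (hi : i ∈ box d n) (hi0 : i ≠ 0) :
    rank (parent i) < rank i := by
  obtain ⟨j, hj, hp⟩ := exists_parent_eq hi hi0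
  rw [hp]
  refine Finset.sum_lt_sum (fun j' _ => Int.toNat_le_toNat ?_) ⟨j, Finset.mem_univ _, ?_⟩
  · by_cases h : j' = j
    · subst h; simp
    · simp [h]
  · simp only [Pi.sub_apply, Pi.single_eq_same]
    omega

/-- The roots of the blocks of the tiling. -/
noncomputable def blockRoots (d n k l : ℕ) : Finset (Site d) := tilePositions d n k ∪ uncovered d n k l

theorem disjoint_tilePositions_uncovered {n k l : ℕ} (hl : 1 ≤ l) :
    Disjoint (tilePositions d n k) (uncovered d n k l) := by
  rw [Finset.disjoint_left]
  intro v hv hv'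
  rw [uncovered, Finset.mem_sdiff] at hv'
  exact hv'.2 (Finset.mem_biUnion.2 ⟨v, hv, by rw [mem_translate, sub_self]; exact zero_mem_box hl⟩)

theorem card_blockRoots_le {n k l : ℕ} (hk : 1 ≤ k) :
    (blockRoots d n k l).card ≤ (n / k) ^ d + (uncovered d n k l).card := by
  rw [blockRoots, ← card_tilePositions hk]
  exact Finset.card_union_le _ _

/-- The block of the tiling with a given root. -/
noncomputable def block (n k l : ℕ) (i : Site d) : Finset (Site d) :=
  if i ∈ tilePositions d n k then translate i (box d l) else {i}

theorem root_mem_block {n k l : ℕ} (hl : 1 ≤ l) (i : Site d) : i ∈ block n k l i := by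
  rw [block]
  split_ifs
  · rw [mem_translate, sub_self]; exact zero_mem_box hl
  · simp

theorem le_of_mem_block {n k l : ℕ} {i y : Site d} (hy : y ∈ block n k l i) (j : Fin d) :
    i j ≤ y j := by
  rw [block] at hy
  split_ifs at hy
  · rw [mem_translate, mem_box] at hy
    have := (hy j).1
    simp only [Pi.sub_apply] at this
    linarith
  · rw [Finset.mem_singleton] at hy
    rw [hy]

theorem biUnion_block {n k l : ℕ} (hl : 1 ≤ l) (hlk : l ≤ k) :
    (blockRoots d n k l).biUnion (block n k l) = box d n := by
  have hdis := disjoint_tilePositions_uncovered (d := d) (n := n) (k := k) hl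
  ext y
  simp only [Finset.mem_biUnion, blockRoots, Finset.mem_union]
  constructor
  · rintro ⟨i, hi | hi, hy⟩
    · rw [block, if_pos hi] at hy
      exact translate_subset_box hlk hi hy
    · rw [block, if_neg (Finset.disjoint_right.1 hdis hi), Finset.mem_singleton] at hy
      subst hy
      exact (Finset.mem_sdiff.1 hi).1
  · intro hy
    by_cases h : y ∈ (tilePositions d n k).biUnion fun v => translate v (box d l)
    · obtain ⟨v, hv, hyv⟩ := Finset.mem_biUnion.1 h
      exact ⟨v, Or.inl hv, by rw [block, if_pos hv]; exact hyv⟩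
    · exact ⟨y, Or.inr (Finset.mem_sdiff.2 ⟨hy, h⟩), root_mem_block hl y⟩

theorem pairwiseDisjoint_block {n k l : ℕ} (hl : 1 ≤ l) (hlk : l ≤ k) :
    ((blockRoots d n k l : Finset (Site d)) : Set (Site d)).PairwiseDisjoint (block n k l) := by
  have hdis := disjoint_tilePositions_uncovered (d := d) (n := n) (k := k) hl
  have hmix : ∀ i ∈ tilePositions d n k, ∀ j ∈ uncovered d n k l,
      Disjoint (block n k l i) (block n k l j) := by
    intro i hi j hj
    rw [block, if_pos hi, block, if_neg (Finset.disjoint_right.1 hdis hj),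
      Finset.disjoint_singleton_right]
    intro h
    exact (Finset.mem_sdiff.1 hj).2 (Finset.mem_biUnion.2 ⟨i, hi, h⟩)
  intro i hi j hj hij
  rw [Finset.mem_coe, blockRoots, Finset.mem_union] at hi hj
  rcases hi with hi | hi <;> rcases hj with hj | hj
  · simp only [Function.onFun, block, if_pos hi, if_pos hj]
    exact disjoint_tiles hlk hi hj hij
  · exact hmix i hi j hj
  · exact (hmix j hj i hi).symm
  · simp only [Function.onFun, block, if_neg (Finset.disjoint_right.1 hdis hi),
      if_neg (Finset.disjoint_right.1 hdis hj)]
    simpa using hij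

theorem blockRoots_subset {n k l : ℕ} (hl : 1 ≤ l) (hlk : l ≤ k) :
    blockRoots d n k l ⊆ box d n := fun i hi => by
  rw [← biUnion_block hl hlk]
  exact Finset.mem_biUnion.2 ⟨i, hi, root_mem_block hl i⟩

end Boxes

/-! ### The trial density glued from tiles -/

section TileDensity

variable {d : ℕ} {E : Type} [AddCommGroup E] [MeasurableSpace E]

/-- The density on a box obtained from a density `F` on the tiles and a density `u` for the height
differences between the roots of the blocks and their parents. -/
noncomputable def tileDensity (n k l : ℕ) (F : HeightFunction d E → ℝ≥0∞) (u : E → ℝ≥0∞)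
    (φ : HeightFunction d E) : ℝ≥0∞ :=
  (∏ v ∈ tilePositions d n k, F (shift v φ)) *
    ∏ i ∈ (blockRoots d n k l).erase 0, u (φ i - φ (parent i))

theorem measurable_comp_shift {Λ Δ : Finset (Site d)} {v : Site d} (h : translate v Λ ⊆ Δ)
    {β : Type*} [MeasurableSpace β] {F : HeightFunction d E → β}
    (hF : Measurable[gradientAlgebra (Λ : Set (Site d))] F) :
    Measurable[gradientAlgebra (Δ : Set (Site d))] fun φ => F (shift v φ) := by
  have : @Measurable _ _ (gradientAlgebra (Δ : Set (Site d))) (gradientAlgebra (Λ : Set (Site d)))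
      (shift v : HeightFunction d E → _) := by
    refine @measurable_gradientAlgebra _ _ _ _ _ (gradientAlgebra (Δ : Set (Site d))) _ _ ?_
    intro x hx y hy
    exact measurable_sub_apply (h (mem_translate.2 (by simpa using hx)))
      (h (mem_translate.2 (by simpa using hy)))
  exact hF.comp this

theorem measurable_tileDensity {n k l : ℕ} (hl : 1 ≤ l) (hlk : l ≤ k)
    {F : HeightFunction d E → ℝ≥0∞}
    (hF : Measurable[gradientAlgebra (box d l : Set (Site d))] F) {u : E → ℝ≥0∞}
    (hu : Measurable u) :
    Measurable[gradientAlgebra (box d n : Set (Site d))] (tileDensity n k l F u) := by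
  have h1 : Measurable[gradientAlgebra (box d n : Set (Site d))] fun φ : HeightFunction d E =>
      ∏ v ∈ tilePositions d n k, F (shift v φ) :=
    Finset.measurable_prod _ fun v hv => measurable_comp_shift (translate_subset_box hlk hv) hF
  have h2 : Measurable[gradientAlgebra (box d n : Set (Site d))] fun φ : HeightFunction d E =>
      ∏ i ∈ (blockRoots d n k l).erase 0, u (φ i - φ (parent i)) := by
    refine Finset.measurable_prod _ fun i hi => hu.comp ?_
    rw [Finset.mem_erase] at hi
    have hi' := blockRoots_subset hl hlk hi.2
    exact measurable_sub_apply (parent_mem_box hi' hi.1) hi'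
  exact h1.mul h2

variable [HeightSpace E] [IsRegularHeight E]

/-- Each block carries a density of its inner gradients (trivial for a single vertex) and a density
of its root height relative to the parent; the origin is anchored by the indicator of a set of mass
one. Parents lie in blocks of lower rank, so the blocks can be integrated out by decreasing rank. -/
theorem lintegral_tileDensity_le_one {n k l : ℕ} (hn : 1 ≤ n) (hl : 1 ≤ l) (hlk : l ≤ k)
    {F : HeightFunction d E → ℝ≥0∞}
    (hF : Measurable[gradientAlgebra (box d l : Set (Site d))] F)
    (hF1 : @lintegral _ (gradientAlgebra (box d l : Set (Site d))) (gradientRef (box d l) 0) F ≤ 1)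
    {u : E → ℝ≥0∞} (hu : Measurable u) (hu1 : ∫⁻ t, u t ∂HeightSpace.ref ≤ 1) :
    @lintegral _ (gradientAlgebra (box d n : Set (Site d))) (gradientRef (box d n) 0)
      (tileDensity n k l F u) ≤ 1 := by
  obtain ⟨s, hs, hs1⟩ := IsRegularHeight.exists_unit (E := E)
  have hdis := disjoint_tilePositions_uncovered (d := d) (n := n) (k := k) hl
  have hF' : Measurable fun φ : Site d → E => F φ :=
    (hF.mono (gradientAlgebra_le _) le_rfl).comp measurable_of_pi
  have hsm : Measurable (s.indicator (1 : E → ℝ≥0∞)) := measurable_one.indicator hs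
  rw [← lmarginal_gauge (zero_mem_box hn) (measurable_tileDensity hl hlk hF hu) hs hs1 0]
  set K : Site d → (Site d → E) → ℝ≥0∞ := fun i φ =>
    if i ∈ tilePositions d n k then F (fun y => φ (y + i)) else 1 with hK
  set g : Site d → E → ℝ≥0∞ := fun i => if i = 0 then s.indicator 1 else u with hg
  set c : Site d → (Site d → E) → E := fun i φ => if i = 0 then 0 else φ (parent i) with hc
  set G : Site d → (Site d → E) → ℝ≥0∞ := fun i φ => K i φ * g i (φ i - c i φ) with hG
  have hKm : ∀ i, Measurable (K i) := by
    intro i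
    simp only [hK]
    split_ifs
    · exact hF'.comp (measurable_pi_lambda _ fun y => measurable_pi_apply (y + i))
    · exact measurable_const
  have hgm : ∀ i, Measurable (g i) := by
    intro i
    simp only [hg]
    split_ifs
    · exact hsm
    · exact hu
  have hcm : ∀ i, Measurable (c i) := by
    intro i
    simp only [hc]
    split_ifs
    · exact measurable_const
    · exact measurable_pi_apply _
  have hGm : ∀ i, Measurable (G i) := fun i =>
    (hKm i).mul ((hgm i).comp ((measurable_pi_apply i).sub (hcm i)))
  have hcB : ∀ i ∈ blockRoots d n k l, ∀ j ∈ blockRoots d n k l, rank i ≤ rank j →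
      ∀ φ y, c i (Function.updateFinset φ (block n k l j) y) = c i φ := by
    intro i hi j hj hij φ y
    simp only [hc]
    split_ifs with hi0
    · rfl
    · have hi' := blockRoots_subset hl hlk hi
      have : parent i ∉ block n k l j := fun h => by
        have h1 := rank_mono (le_of_mem_block h)
        have h2 := rank_parent_lt hi' hi0
        omega
      simp [Function.updateFinset, this]
  have key := lmarginal_prod_le_one (μ := fun _ : Site d => (HeightSpace.ref : Measure E))
    (blockRoots d n k l) rank (block n k l) G hGm (pairwiseDisjoint_block hl hlk) ?_ ?_ 0
  · rw [biUnion_block hl hlk] at key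
    refine le_of_eq_of_le ?_ key
    congr 1
    funext φ
    -- The block containing the origin has a root coordinatewise below the origin, and inside the
    -- box this can only be the origin.
    have h0 : (0 : Site d) ∈ blockRoots d n k l := by
      have h := zero_mem_box (d := d) hn
      rw [← biUnion_block (k := k) hl hlk, Finset.mem_biUnion] at h
      obtain ⟨i, hi, h0i⟩ := h
      have hle := le_of_mem_block h0i
      have hi' := mem_box.1 (blockRoots_subset hl hlk hi)
      have : i = 0 := by
        ext j
        exact le_antisymm (hle j) (hi' j).1
      rwa [this] at hi
    simp only [hG, Finset.prod_mul_distrib]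
    have e1 : ∏ i ∈ blockRoots d n k l, K i φ = ∏ v ∈ tilePositions d n k, F (shift v φ) := by
      rw [blockRoots, Finset.prod_union hdis]
      have h1 : ∀ i ∈ tilePositions d n k, K i φ = F (shift i φ) := fun i hi => by
        simp only [hK, if_pos hi]; rfl
      have h2 : ∀ i ∈ uncovered d n k l, K i φ = 1 := fun i hi => by
        simp only [hK, if_neg (Finset.disjoint_right.1 hdis hi)]
      rw [Finset.prod_congr rfl h1, Finset.prod_congr rfl h2, Finset.prod_const_one, mul_one]
    have e2 : ∏ i ∈ blockRoots d n k l, g i (φ i - c i φ) =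
        s.indicator 1 (φ 0) * ∏ i ∈ (blockRoots d n k l).erase 0, u (φ i - φ (parent i)) := by
      rw [← Finset.mul_prod_erase _ _ h0]
      congr 1
      · simp [hg, hc]
      · refine Finset.prod_congr rfl fun i hi => ?_
        simp only [hg, hc, if_neg (Finset.ne_of_mem_erase hi)]
    rw [e1, e2]
    simp only [tileDensity]
    ring
  · intro i hi j hj hij hr φ y
    have hd : Disjoint (block n k l i) (block n k l j) := pairwiseDisjoint_block hl hlk hi hj hij
    have hout : ∀ z ∈ block n k l i, Function.updateFinset φ (block n k l j) y z = φ z := by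
      intro z hz
      simp [Function.updateFinset, Finset.disjoint_left.1 hd hz]
    simp only [hG]
    rw [hcB i hi j hj hr, hout i (root_mem_block hl i)]
    congr 1
    simp only [hK]
    split_ifs with hit
    · refine eq_of_eq_add_const hF 0 fun z hz => ?_
      rw [add_zero, hout]
      rw [block, if_pos hit, mem_translate]
      simpa using hz
    · rfl
  · intro i hi φ
    refine lmarginal_root_le_one (root_mem_block hl i) (hKm i) ?_ (hgm i) ?_ (hcm i)
      (hcB i hi i hi le_rfl) φ
    · intro φ
      simp only [hK]
      rw [block]
      split_ifs with hit
      · have h1 : (translate i (box d l)).erase i = translate i ((box d l).erase 0) := by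
          ext y
          simp [mem_translate, sub_eq_zero]
        rw [h1, lmarginal_translate i _ hF']
        have := lmarginal_gradient (zero_mem_box hl) hF 0 fun y => φ (y + i)
        simp only [add_zero] at this
        rw [this]
        exact hF1
      · simp
    · simp only [hg]
      split_ifs
      · rw [lintegral_indicator_one hs, hs1]
      · exact hu1

end TileDensity

/-! ## Relative entropy -/

section Entropy

variable {X : Type} {m : MeasurableSpace X} {μ ν lam : Measure X}

theorem relEntropy_of_integrable (hac : μ ≪ ν) (hint : Integrable (llr μ ν) μ) :
    relEntropy μ ν = ((∫ x, llr μ ν x ∂μ : ℝ) : EReal) := by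
  have hP : ∫⁻ x, ENNReal.ofReal (llr μ ν x) ∂μ ≠ ⊤ := hint.lintegral_lt_top.ne
  have hN : ∫⁻ x, ENNReal.ofReal (-llr μ ν x) ∂μ ≠ ⊤ := hint.neg.lintegral_lt_top.ne
  rw [relEntropy, if_pos ⟨hac, hP⟩, integral_eq_lintegral_pos_part_sub_lintegral_neg_part hint,
    EReal.coe_sub, EReal.coe_ennreal_toReal hP, EReal.coe_ennreal_toReal hN]

theorem integrable_of_lintegral_parts {f : X → ℝ} (hf : Measurable f)
    (hP : ∫⁻ x, ENNReal.ofReal (f x) ∂μ ≠ ⊤) (hN : ∫⁻ x, ENNReal.ofReal (-f x) ∂μ ≠ ⊤) :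
    Integrable f μ := by
  refine ⟨hf.aestronglyMeasurable, ?_⟩
  rw [hasFiniteIntegral_iff_norm]
  have : ∀ x, ENNReal.ofReal ‖f x‖ = ENNReal.ofReal (f x) + ENNReal.ofReal (-f x) := by
    intro x
    rcases le_total 0 (f x) with h | h
    · rw [Real.norm_of_nonneg h, ENNReal.ofReal_of_nonpos (p := -f x) (by linarith), add_zero]
    · rw [Real.norm_of_nonpos h, ENNReal.ofReal_of_nonpos (p := f x) h, zero_add]
  simp only [this]
  rw [lintegral_add_left hf.ennreal_ofReal]
  exact ENNReal.add_lt_top.2 ⟨hP.lt_top, hN.lt_top⟩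

/-- With `r = ρ / (dμ/dν)` this is `log r ≤ r - 1`, and `∫ r dμ ≤ ∫ ρ dν ≤ 1`. If `log ρ` is
integrable, the negative part of `llr μ ν` is therefore integrable too. -/
theorem exists_lower_bound_llr [SigmaFinite μ] [SigmaFinite ν] (hac : μ ≪ ν) {ρ : X → ℝ≥0∞}
    (hρ : Measurable ρ) (hρ1 : ∫⁻ x, ρ x ∂ν ≤ 1) (hpos : ∀ᵐ x ∂μ, ρ x ≠ 0) :
    ∃ r : X → ℝ, Integrable r μ ∧ ∫ x, r x ∂μ ≤ 1 ∧
      ∀ᵐ x ∂μ, Real.log (ρ x).toReal - (r x - 1) ≤ llr μ ν x := by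
  have hm : Measurable fun x => ρ x / μ.rnDeriv ν x := hρ.div (Measure.measurable_rnDeriv μ ν)
  have hle : ∫⁻ x, ρ x / μ.rnDeriv ν x ∂μ ≤ 1 := by
    rw [← lintegral_rnDeriv_mul hac hm.aemeasurable]
    exact (lintegral_mono fun x => ENNReal.mul_div_le).trans hρ1
  have hne : ∫⁻ x, ρ x / μ.rnDeriv ν x ∂μ ≠ ⊤ := (hle.trans_lt ENNReal.one_lt_top).ne
  refine ⟨fun x => (ρ x / μ.rnDeriv ν x).toReal, integrable_toReal_of_lintegral_ne_top
    hm.aemeasurable hne, ?_, ?_⟩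
  · rw [integral_toReal hm.aemeasurable (ae_lt_top hm hne)]
    exact ENNReal.toReal_le_of_le_ofReal zero_le_one (by simpa using hle)
  · have hρt : ∀ᵐ x ∂μ, ρ x < ⊤ :=
      hac.ae_le (ae_lt_top hρ (hρ1.trans_lt ENNReal.one_lt_top).ne)
    filter_upwards [hpos, hρt, Measure.rnDeriv_pos hac, hac.ae_le (Measure.rnDeriv_lt_top μ ν)]
      with x h1 h2 h3 h4
    have e1 : 0 < (ρ x).toReal := ENNReal.toReal_pos h1 h2.ne
    have e2 : 0 < (μ.rnDeriv ν x).toReal := ENNReal.toReal_pos h3.ne' h4.ne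
    rw [ENNReal.toReal_div, llr_def]
    have := Real.log_le_sub_one_of_pos (div_pos e1 e2)
    rw [Real.log_div e1.ne' e2.ne'] at this
    linarith

/-- The Gibbs variational inequality. -/
theorem integral_log_le_relEntropy [SigmaFinite μ] [SigmaFinite ν] [IsProbabilityMeasure μ]
    {ρ : X → ℝ≥0∞} (hρ : Measurable ρ) (hρ1 : ∫⁻ x, ρ x ∂ν ≤ 1) (hpos : ∀ᵐ x ∂μ, ρ x ≠ 0)
    (hint : Integrable (fun x => Real.log (ρ x).toReal) μ) :
    ((∫ x, Real.log (ρ x).toReal ∂μ : ℝ) : EReal) ≤ relEntropy μ ν := by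
  by_cases h : μ ≪ ν ∧ ∫⁻ x, ENNReal.ofReal (llr μ ν x) ∂μ ≠ ⊤
  · obtain ⟨r, hr, hr1, hle⟩ := exists_lower_bound_llr h.1 hρ hρ1 hpos
    have hlow : Integrable (fun x => Real.log (ρ x).toReal - (r x - 1)) μ :=
      hint.sub (hr.sub (integrable_const 1))
    have hN : ∫⁻ x, ENNReal.ofReal (-llr μ ν x) ∂μ ≠ ⊤ := by
      refine ne_top_of_le_ne_top hlow.neg.lintegral_lt_top.ne (lintegral_mono_ae ?_)
      filter_upwards [hle] with x hx
      exact ENNReal.ofReal_le_ofReal (neg_le_neg hx)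
    have hI := integrable_of_lintegral_parts (measurable_llr μ ν) h.2 hN
    rw [relEntropy_of_integrable h.1 hI]
    refine EReal.coe_le_coe_iff.2 ?_
    have h1 := integral_mono_ae hlow hI hle
    have h2 : Integrable (fun x => r x - 1) μ := hr.sub (integrable_const 1)
    rw [integral_sub hint h2, integral_sub hr (integrable_const 1)] at h1
    simp only [integral_const, probReal_univ, smul_eq_mul, mul_one] at h1
    linarith
  · rw [relEntropy, if_neg h]
    exact le_top

/-- Domination bounds the log-density above by `log c`, and the trial density bounds it below by an
integrable function. -/
theorem integrable_llr_of_le_smul [SigmaFinite μ] [SigmaFinite ν] [IsProbabilityMeasure μ]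
    {c : ℝ} (hc : 0 < c) (hle : μ ≤ ENNReal.ofReal c • ν) {ρ : X → ℝ≥0∞} (hρ : Measurable ρ)
    (hρ1 : ∫⁻ x, ρ x ∂ν ≤ 1) (hpos : ∀ᵐ x ∂μ, ρ x ≠ 0)
    (hint : Integrable (fun x => Real.log (ρ x).toReal) μ) :
    μ ≪ ν ∧ Integrable (llr μ ν) μ ∧ ∀ᵐ x ∂μ, llr μ ν x ≤ Real.log c := by
  have hac : μ ≪ ν := (Measure.absolutelyContinuous_of_le hle).trans Measure.smul_absolutelyContinuous
  have hup : ∀ᵐ x ∂μ, llr μ ν x ≤ Real.log c := by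
    have h1 : μ.rnDeriv ν ≤ᵐ[ν] fun _ => ENNReal.ofReal c := by
      refine ae_le_of_forall_setLIntegral_le_of_sigmaFinite (Measure.measurable_rnDeriv μ ν) ?_
      intro s hs _
      refine (Measure.setLIntegral_rnDeriv_le s).trans ?_
      rw [setLIntegral_const]
      exact hle s
    filter_upwards [hac.ae_le h1, Measure.rnDeriv_pos hac] with x hx hx0
    rw [llr_def]
    refine Real.log_le_log (ENNReal.toReal_pos hx0.ne' (ne_top_of_le_ne_top ENNReal.ofReal_ne_top hx)) ?_
    exact ENNReal.toReal_le_of_le_ofReal hc.le hx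
  refine ⟨hac, ?_, hup⟩
  obtain ⟨r, hr, hr1, hlo⟩ := exists_lower_bound_llr hac hρ hρ1 hpos
  have hlow : Integrable (fun x => Real.log (ρ x).toReal - (r x - 1)) μ :=
    hint.sub (hr.sub (integrable_const 1))
  refine Integrable.mono' (hlow.norm.add (integrable_const |Real.log c|))
    (measurable_llr μ ν).aestronglyMeasurable ?_
  filter_upwards [hup, hlo] with x h1 h2
  rw [Real.norm_eq_abs, Pi.add_apply, abs_le]
  have h3 := abs_le.1 (le_refl |Real.log c|)
  have h4 := abs_le.1 (le_refl |Real.log (ρ x).toReal - (r x - 1)|)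
  have h5 := abs_nonneg (Real.log c)
  have h6 := abs_nonneg (Real.log (ρ x).toReal - (r x - 1))
  simp only [Real.norm_eq_abs]
  constructor <;> linarith

/-! ### Entropy relative to a Gibbs density -/

section WithDensity

variable {H : X → EReal}

theorem sigmaFinite_withDensity_exp [SigmaFinite lam] (hbot : ∀ x, H x ≠ ⊥) :
    SigmaFinite (lam.withDensity fun x => EReal.exp (-H x)) := by
  refine SigmaFinite.withDensity_of_ne_top (Eventually.of_forall fun x => ?_)
  rw [ne_eq, EReal.exp_eq_top_iff, EReal.neg_eq_top_iff]
  exact hbot x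

theorem exp_neg_mul_exp_le {a : EReal} {b : ℝ} (h : (b : EReal) ≤ a) :
    EReal.exp (-a) * ENNReal.ofReal (Real.exp b) ≤ 1 := by
  rw [← EReal.exp_coe, ← EReal.exp_add, EReal.exp_le_one_iff, add_comm, ← sub_eq_add_neg]
  exact EReal.sub_nonpos.2 h

/-- The Gibbs variational inequality for a Hamiltonian. -/
theorem integral_log_add_le_relEntropy [SigmaFinite lam] [IsProbabilityMeasure μ]
    (hH : Measurable H) (hbot : ∀ x, H x ≠ ⊥) {ρ : X → ℝ≥0∞} (hρ : Measurable ρ)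
    (hρ1 : ∫⁻ x, ρ x ∂lam ≤ 1) (hpos : ∀ᵐ x ∂μ, ρ x ≠ 0)
    (hint : Integrable (fun x => Real.log (ρ x).toReal) μ) {B : X → ℝ} (hB : Measurable B)
    (hBH : ∀ x, (B x : EReal) ≤ H x) (hBint : Integrable B μ) :
    ((∫ x, Real.log (ρ x).toReal ∂μ + ∫ x, B x ∂μ : ℝ) : EReal) ≤
      relEntropy μ (lam.withDensity fun x => EReal.exp (-H x)) := by
  have := sigmaFinite_withDensity_exp (lam := lam) hbot
  by_cases hac : μ ≪ lam
  · have hρt : ∀ᵐ x ∂μ, ρ x < ⊤ :=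
      hac.ae_le (ae_lt_top hρ (hρ1.trans_lt ENNReal.one_lt_top).ne)
    have hlog : (fun x => Real.log (ρ x * ENNReal.ofReal (Real.exp (B x))).toReal) =ᵐ[μ]
        fun x => Real.log (ρ x).toReal + B x := by
      filter_upwards [hpos, hρt] with x h1 h2
      rw [ENNReal.toReal_mul, ENNReal.toReal_ofReal (Real.exp_pos _).le,
        Real.log_mul (ENNReal.toReal_pos h1 h2.ne).ne' (Real.exp_pos _).ne', Real.log_exp]
    have hm : Measurable fun x => ENNReal.ofReal (Real.exp (B x)) :=
      (Real.measurable_exp.comp hB).ennreal_ofReal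
    have key := integral_log_le_relEntropy (μ := μ)
      (ν := lam.withDensity fun x => EReal.exp (-H x)) (hρ.mul hm) ?_ ?_ ?_
    · simp only [Pi.mul_apply] at key
      rwa [integral_congr_ae hlog, integral_add hint hBint] at key
    · rw [lintegral_withDensity_eq_lintegral_mul _ (by fun_prop) (hρ.mul hm)]
      refine (lintegral_mono fun x => ?_).trans hρ1
      simp only [Pi.mul_apply]
      calc _ = ρ x * (EReal.exp (-H x) * ENNReal.ofReal (Real.exp (B x))) := by ring
        _ ≤ ρ x * 1 := by gcongr; exact exp_neg_mul_exp_le (hBH x)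
        _ = ρ x := mul_one _
    · filter_upwards [hpos] with x hx
      simp [hx, Real.exp_pos]
    · exact (integrable_congr hlog).2 (hint.add hBint)
  · rw [relEntropy, if_neg fun h => hac (h.1.trans (withDensity_absolutelyContinuous _ _))]
    exact le_top

theorem relEntropy_withDensity [SigmaFinite lam] [IsProbabilityMeasure μ]
    (hH : Measurable H) (hbot : ∀ x, H x ≠ ⊥) (htop : ∀ᵐ x ∂μ, H x ≠ ⊤) (hac : μ ≪ lam)
    (hint : Integrable (llr μ lam) μ) (hHint : Integrable (fun x => (H x).toReal) μ) :
    relEntropy μ (lam.withDensity fun x => EReal.exp (-H x)) =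
      ((∫ x, llr μ lam x ∂μ + ∫ x, (H x).toReal ∂μ : ℝ) : EReal) := by
  have := sigmaFinite_withDensity_exp (lam := lam) hbot
  set ν := lam.withDensity fun x => EReal.exp (-H x) with hν
  set f := μ.rnDeriv lam with hf
  have hfm : Measurable f := Measure.measurable_rnDeriv μ lam
  have hem : Measurable fun x => EReal.exp (H x) := by fun_prop
  have hμ : μ = ν.withDensity (fun x => f x * EReal.exp (H x)) := by
    have hneg : Measurable fun x => EReal.exp (-H x) := by fun_prop
    have hmul := withDensity_mul lam hneg (hfm.mul hem)
    simp only [Pi.mul_def] at hmul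
    rw [hν, ← hmul]
    conv_lhs => rw [← Measure.withDensity_rnDeriv_eq μ lam hac]
    refine withDensity_congr_ae ?_
    -- Where `H = ∞` the factors `exp (-H)` and `exp H` do not cancel, but `μ` does not charge this
    -- set, so its density vanishes there almost everywhere.
    have hS : MeasurableSet {x | H x = ⊤} := hH (measurableSet_singleton _)
    have h0 : ∀ᵐ x ∂lam, x ∈ {x | H x = ⊤} → f x = 0 := by
      rw [← setLIntegral_eq_zero_iff hS hfm, Measure.setLIntegral_rnDeriv hac]
      exact measure_mono_null (fun x hx => by simpa using hx) htop
    filter_upwards [h0] with x hx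
    by_cases ht : H x = ⊤
    · simp [hx ht, ← hf]
    · have he : EReal.exp (-H x) * EReal.exp (H x) = 1 := by
        lift H x to ℝ using ⟨ht, hbot x⟩ with a
        rw [← EReal.exp_add, ← EReal.coe_neg, ← EReal.coe_add]
        simp
      rw [mul_left_comm, he, mul_one]
  have hμν : μ ≪ ν := by rw [hμ]; exact withDensity_absolutelyContinuous _ _
  have hrn : μ.rnDeriv ν =ᵐ[ν] fun x => f x * EReal.exp (H x) := by
    have := Measure.rnDeriv_withDensity ν (hfm.mul hem)
    rw [Pi.mul_def, ← hμ] at this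
    exact this
  have hllr : llr μ ν =ᵐ[μ] fun x => llr μ lam x + (H x).toReal := by
    filter_upwards [hμν.ae_le hrn, htop, Measure.rnDeriv_pos hac,
      hac.ae_le (Measure.rnDeriv_lt_top μ lam)] with x h1 h2 h3 h4
    simp only [llr_def, h1]
    lift H x to ℝ using ⟨h2, hbot x⟩ with a
    rw [EReal.exp_coe, ENNReal.toReal_mul, ENNReal.toReal_ofReal (Real.exp_pos _).le,
      Real.log_mul (ENNReal.toReal_pos h3.ne' h4.ne).ne' (Real.exp_pos _).ne', Real.log_exp,
      EReal.toReal_coe]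
  rw [relEntropy_of_integrable hμν ((integrable_congr hllr).2 (hint.add hHint)),
    integral_congr_ae hllr, integral_add hint hHint]

end WithDensity

end Entropy

/-! ## Energies -/

section Energy

variable {d : ℕ} {E : Type}

/-- The total strength at `φ` of the interactions satisfying `p`. -/
noncomputable def strength (Φ : Potential d E) (φ : HeightFunction d E)
    (p : Finset (Site d) → Prop) : ℝ≥0∞ :=
  ∑' Γ : {Γ : Finset (Site d) // p Γ}, (Φ Γ.1 φ).abs

theorem sum_abs_le_strength (Φ : Potential d E) (φ : HeightFunction d E)
    {p : Finset (Site d) → Prop} (s : Finset (Finset (Site d))) (hs : ∀ Γ ∈ s, p Γ) :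
    ∑ Γ ∈ s, (Φ Γ φ).abs ≤ strength Φ φ p := by
  have h := tsum_subtype {Γ | p Γ} fun Γ => (Φ Γ φ).abs
  have h' : strength Φ φ p = ∑' Γ, {Γ | p Γ}.indicator (fun Γ => (Φ Γ φ).abs) Γ := h
  rw [h']
  refine le_trans (Finset.sum_le_sum fun Γ hΓ => ?_) (ENNReal.sum_le_tsum s)
  rw [Set.indicator_of_mem (s := {Γ | p Γ}) (hs Γ hΓ)]

/-- The finite set `Γ` meets both `Λ` and its complement. -/
def Crosses (Λ Γ : Finset (Site d)) : Prop := (∃ x ∈ Γ, x ∈ Λ) ∧ ∃ y ∈ Γ, y ∉ Λ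

theorem ereal_abs_ne_top {x : EReal} (h : x.abs ≠ ⊤) : x ≠ ⊤ ∧ x ≠ ⊥ :=
  ⟨fun h' => h (by rw [h']; rfl), fun h' => h (by rw [h']; rfl)⟩

theorem ofReal_abs_toReal_le (x : EReal) : ENNReal.ofReal |x.toReal| ≤ x.abs := by
  induction x with
  | bot => exact le_top
  | top => exact le_top
  | coe x => rw [EReal.toReal_coe, EReal.abs_def]

/-- The nonempty subsets of `Λ`. -/
noncomputable def subsets (Λ : Finset (Site d)) : Finset (Finset (Site d)) :=
  Λ.powerset.filter Finset.Nonempty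

theorem mem_subsets {Λ Γ : Finset (Site d)} : Γ ∈ subsets Λ ↔ Γ ⊆ Λ ∧ Γ.Nonempty := by
  simp [subsets]

theorem interiorHamiltonian_eq_sum (Φ : Potential d E) (Λ : Finset (Site d))
    (φ : HeightFunction d E) : interiorHamiltonian Φ Λ φ = ∑ Γ ∈ subsets Λ, Φ Γ φ := by
  rw [interiorHamiltonian, subsets]

/-- The finite part of the interior Hamiltonian. -/
noncomputable def energy (Φ : Potential d E) (Λ : Finset (Site d)) (φ : HeightFunction d E) : ℝ :=
  (interiorHamiltonian Φ Λ φ).toReal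

variable {Φ : Potential d E} {φ : HeightFunction d E} {C : ℝ}

theorem ne_top_of_strength (hC : ∀ x, strength Φ φ (x ∈ ·) ≤ ENNReal.ofReal C)
    {Γ : Finset (Site d)} (hΓ : Γ.Nonempty) : Φ Γ φ ≠ ⊤ ∧ Φ Γ φ ≠ ⊥ := by
  obtain ⟨x, hx⟩ := hΓ
  have h := sum_abs_le_strength Φ φ (p := (x ∈ ·)) {Γ} (by simpa using hx)
  rw [Finset.sum_singleton] at h
  exact ereal_abs_ne_top (ne_top_of_le_ne_top ENNReal.ofReal_ne_top (h.trans (hC x)))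

theorem ereal_coe_sum {ι : Type*} (s : Finset ι) (f : ι → ℝ) :
    ((∑ i ∈ s, f i : ℝ) : EReal) = ∑ i ∈ s, (f i : EReal) := by
  classical
  induction s using Finset.induction_on with
  | empty => simp
  | insert a s ha ih => rw [Finset.sum_insert ha, Finset.sum_insert ha, EReal.coe_add, ih]

theorem interiorHamiltonian_eq_coe (hC : ∀ x, strength Φ φ (x ∈ ·) ≤ ENNReal.ofReal C)
    (Λ : Finset (Site d)) :
    interiorHamiltonian Φ Λ φ = ((∑ Γ ∈ subsets Λ, (Φ Γ φ).toReal : ℝ) : EReal) := by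
  rw [interiorHamiltonian_eq_sum, ereal_coe_sum]
  refine Finset.sum_congr rfl fun Γ hΓ => ?_
  obtain ⟨h1, h2⟩ := ne_top_of_strength hC (mem_subsets.1 hΓ).2
  rw [EReal.coe_toReal h1 h2]

theorem energy_eq_sum (hC : ∀ x, strength Φ φ (x ∈ ·) ≤ ENNReal.ofReal C) (Λ : Finset (Site d)) :
    energy Φ Λ φ = ∑ Γ ∈ subsets Λ, (Φ Γ φ).toReal := by
  rw [energy, interiorHamiltonian_eq_coe hC, EReal.toReal_coe]

theorem coe_energy (hC : ∀ x, strength Φ φ (x ∈ ·) ≤ ENNReal.ofReal C) (Λ : Finset (Site d)) :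
    (energy Φ Λ φ : EReal) = interiorHamiltonian Φ Λ φ := by
  rw [interiorHamiltonian_eq_coe hC, energy_eq_sum hC]

theorem sum_abs_toReal_le {p : Finset (Site d) → Prop} {c : ℝ} (hc : 0 ≤ c)
    (h : strength Φ φ p ≤ ENNReal.ofReal c) (s : Finset (Finset (Site d))) (hs : ∀ Γ ∈ s, p Γ) :
    ∑ Γ ∈ s, |(Φ Γ φ).toReal| ≤ c := by
  have h1 := (sum_abs_le_strength Φ φ s hs).trans h
  have h2 : ENNReal.ofReal (∑ Γ ∈ s, |(Φ Γ φ).toReal|) ≤ ENNReal.ofReal c := by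
    rw [ENNReal.ofReal_sum_of_nonneg fun Γ _ => abs_nonneg _]
    exact (Finset.sum_le_sum fun Γ _ => ofReal_abs_toReal_le _).trans h1
  exact (ENNReal.ofReal_le_ofReal_iff hc).1 h2

open Classical in
/-- A family of sets each of which crosses one of the tiles or meets `U` has small total
strength. -/
theorem sum_abs_le_of_cover {V : Finset (Site d)} {T : Site d → Finset (Site d)}
    {U : Finset (Site d)} {e : ℝ} (hC0 : 0 ≤ C) (he0 : 0 ≤ e)
    (hC : ∀ x, strength Φ φ (x ∈ ·) ≤ ENNReal.ofReal C)
    (he : ∀ v ∈ V, strength Φ φ (Crosses (T v)) ≤ ENNReal.ofReal e)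
    (s : Finset (Finset (Site d)))
    (hs : ∀ Γ ∈ s, (∃ v ∈ V, Crosses (T v) Γ) ∨ ∃ x ∈ U, x ∈ Γ) :
    ∑ Γ ∈ s, |(Φ Γ φ).toReal| ≤ V.card * e + U.card * C := by
  calc ∑ Γ ∈ s, |(Φ Γ φ).toReal|
      ≤ ∑ Γ ∈ s, ((∑ v ∈ V, if Crosses (T v) Γ then |(Φ Γ φ).toReal| else 0) +
          ∑ x ∈ U, if x ∈ Γ then |(Φ Γ φ).toReal| else 0) := by
        refine Finset.sum_le_sum fun Γ hΓ => ?_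
        have n1 : 0 ≤ ∑ v ∈ V, if Crosses (T v) Γ then |(Φ Γ φ).toReal| else 0 :=
          Finset.sum_nonneg fun v _ => by split_ifs <;> simp
        have n2 : 0 ≤ ∑ x ∈ U, if x ∈ Γ then |(Φ Γ φ).toReal| else 0 :=
          Finset.sum_nonneg fun v _ => by split_ifs <;> simp
        rcases hs Γ hΓ with ⟨v, hv, h⟩ | ⟨x, hx, h⟩
        · have := Finset.single_le_sum
            (f := fun v => if Crosses (T v) Γ then |(Φ Γ φ).toReal| else 0)
            (fun v _ => by split_ifs <;> simp) hv
          simp only [h, if_true] at this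
          linarith
        · have := Finset.single_le_sum
            (f := fun x => if x ∈ Γ then |(Φ Γ φ).toReal| else 0)
            (fun v _ => by split_ifs <;> simp) hx
          simp only [h, if_true] at this
          linarith
    _ = ∑ v ∈ V, ∑ Γ ∈ s with Crosses (T v) Γ, |(Φ Γ φ).toReal| +
          ∑ x ∈ U, ∑ Γ ∈ s with x ∈ Γ, |(Φ Γ φ).toReal| := by
        rw [Finset.sum_add_distrib, Finset.sum_comm, Finset.sum_comm (s := s) (t := U)]
        simp only [Finset.sum_filter]
    _ ≤ ∑ v ∈ V, e + ∑ x ∈ U, C := by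
        refine add_le_add (Finset.sum_le_sum fun v hv => ?_) (Finset.sum_le_sum fun x _ => ?_)
        · exact sum_abs_toReal_le he0 (he v hv) _ fun Γ hΓ => (Finset.mem_filter.1 hΓ).2
        · exact sum_abs_toReal_le hC0 (hC x) _ fun Γ hΓ => (Finset.mem_filter.1 hΓ).2
    _ = V.card * e + U.card * C := by simp

theorem abs_energy_le (hC0 : 0 ≤ C) (hC : ∀ x, strength Φ φ (x ∈ ·) ≤ ENNReal.ofReal C)
    (Λ : Finset (Site d)) : |energy Φ Λ φ| ≤ Λ.card * C := by
  rw [energy_eq_sum hC]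
  refine (Finset.abs_sum_le_sum_abs _ _).trans ?_
  have := sum_abs_le_of_cover (V := ∅) (T := fun _ => ∅) (U := Λ) hC0 le_rfl hC (by simp)
    (subsets Λ) fun Γ hΓ => Or.inr ?_
  · simpa using this
  · obtain ⟨h, x, hx⟩ := mem_subsets.1 hΓ
    exact ⟨x, h hx, hx⟩

/-- The energy is superadditive up to the interactions between the tiles. -/
theorem energy_box_ge {n k l : ℕ} (hlk : l ≤ k) {e : ℝ} (hC0 : 0 ≤ C) (he0 : 0 ≤ e)
    (hC : ∀ x, strength Φ φ (x ∈ ·) ≤ ENNReal.ofReal C)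
    (he : ∀ v ∈ tilePositions d n k, strength Φ φ (Crosses (translate v (box d l))) ≤ ENNReal.ofReal e) :
    (∑ v ∈ tilePositions d n k, energy Φ (translate v (box d l)) φ) -
      ((tilePositions d n k).card * e + (uncovered d n k l).card * C) ≤ energy Φ (box d n) φ := by
  classical
  set V := tilePositions d n k
  set T : Site d → Finset (Site d) := fun v => translate v (box d l)
  have hdisj : ((V : Finset (Site d)) : Set (Site d)).PairwiseDisjoint fun v => subsets (T v) := by
    intro v hv v' hv' hne
    refine Finset.disjoint_left.2 fun Γ h h' => ?_
    obtain ⟨h1, x, hx⟩ := mem_subsets.1 h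
    obtain ⟨h2, -⟩ := mem_subsets.1 h'
    exact Finset.disjoint_left.1 (disjoint_tiles hlk hv hv' hne) (h1 hx) (h2 hx)
  have hsub : V.biUnion (fun v => subsets (T v)) ⊆ subsets (box d n) := by
    refine Finset.biUnion_subset.2 fun v hv Γ hΓ => ?_
    obtain ⟨h1, h2⟩ := mem_subsets.1 hΓ
    exact mem_subsets.2 ⟨h1.trans (translate_subset_box hlk hv), h2⟩
  simp only [energy_eq_sum hC]
  rw [← Finset.sum_biUnion hdisj, ← Finset.sum_sdiff hsub]
  have hrest := sum_abs_le_of_cover (Φ := Φ) (φ := φ) (V := V) (T := T) (U := uncovered d n k l)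
    hC0 he0 hC he (subsets (box d n) \ V.biUnion fun v => subsets (T v)) ?_
  · have := (abs_le.1 ((Finset.abs_sum_le_sum_abs (fun Γ => (Φ Γ φ).toReal)
      (subsets (box d n) \ V.biUnion fun v => subsets (T v))).trans hrest)).1
    linarith
  -- A set without uncovered vertices meets some tile; as it is not contained in that tile, it
  -- crosses it.
  · intro Γ hΓ
    obtain ⟨h1, h2⟩ := Finset.mem_sdiff.1 hΓ
    obtain ⟨h3, x, hx⟩ := mem_subsets.1 h1
    by_cases hu : ∃ x ∈ uncovered d n k l, x ∈ Γ
    · exact Or.inr hu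
    · left
      have hxu : x ∈ V.biUnion T := by
        by_contra hcon
        exact hu ⟨x, Finset.mem_sdiff.2 ⟨h3 hx, hcon⟩, hx⟩
      obtain ⟨v, hv, hxv⟩ := Finset.mem_biUnion.1 hxu
      refine ⟨v, hv, ⟨x, hx, hxv⟩, ?_⟩
      by_contra! hcon
      exact h2 (Finset.mem_biUnion.2 ⟨v, hv, mem_subsets.2 ⟨hcon, x, hx⟩⟩)

end Energy

/-! ### Hamiltonians of periodic potentials -/

section PeriodicPotential

variable {d : ℕ} {E : Type} [AddCommGroup E] [MeasurableSpace E] {L : AddSubgroup (Site d)}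
  {Φ Ψ Ξ : Potential d E}

theorem IsPeriodicGradientPotential.add (hΨ : IsPeriodicGradientPotential L Ψ)
    (hΞ : IsPeriodicGradientPotential L Ξ) : IsPeriodicGradientPotential L (Ψ + Ξ) where
  ne_bot Λ φ := by
    simp only [Pi.add_apply, ne_eq, EReal.add_eq_bot_iff, not_or]
    exact ⟨hΨ.ne_bot Λ φ, hΞ.ne_bot Λ φ⟩
  measurable Λ := (hΨ.measurable Λ).add (hΞ.measurable Λ)
  eq_zero Λ h φ := by simp [hΨ.eq_zero Λ h, hΞ.eq_zero Λ h]
  periodic v hv Λ φ := by simp [hΨ.periodic v hv, hΞ.periodic v hv]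

theorem IsPeriodicGradientPotential.measurable_interiorHamiltonian
    (h : IsPeriodicGradientPotential L Φ) (Λ : Finset (Site d)) :
    Measurable[gradientAlgebra (Λ : Set (Site d))] (interiorHamiltonian Φ Λ) := by
  have : Measurable[gradientAlgebra (Λ : Set (Site d))]
      fun φ : HeightFunction d E => ∑ Γ ∈ subsets Λ, Φ Γ φ :=
    Finset.measurable_sum _ fun Γ hΓ => (h.measurable Γ).mono
      (gradientAlgebra_mono (by exact_mod_cast (mem_subsets.1 hΓ).1)) le_rfl
  simpa only [← interiorHamiltonian_eq_sum] using this

theorem IsPeriodicGradientPotential.interiorHamiltonian_ne_bot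
    (h : IsPeriodicGradientPotential L Φ) (Λ : Finset (Site d)) (φ : HeightFunction d E) :
    interiorHamiltonian Φ Λ φ ≠ ⊥ := by
  classical
  rw [interiorHamiltonian_eq_sum]
  induction subsets Λ using Finset.induction_on with
  | empty => simp
  | insert a s ha ih =>
    rw [Finset.sum_insert ha, ne_eq, EReal.add_eq_bot_iff, not_or]
    exact ⟨h.ne_bot a φ, ih⟩

/-- No term is `⊥`, so nothing can cancel a single infinite term of the sum. -/
theorem IsPeriodicGradientPotential.ne_top_of_interiorHamiltonian
    (h : IsPeriodicGradientPotential L Φ) {Λ Γ : Finset (Site d)} {φ : HeightFunction d E}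
    (hΓ : Γ ∈ subsets Λ) (hH : interiorHamiltonian Φ Λ φ ≠ ⊤) : Φ Γ φ ≠ ⊤ := by
  classical
  intro htop
  apply hH
  rw [interiorHamiltonian_eq_sum, ← Finset.add_sum_erase _ _ hΓ, htop]
  refine EReal.top_add_of_ne_bot ?_
  induction (subsets Λ).erase Γ using Finset.induction_on with
  | empty => simp
  | insert a s ha ih =>
    rw [Finset.sum_insert ha, ne_eq, EReal.add_eq_bot_iff, not_or]
    exact ⟨h.ne_bot a φ, ih⟩

theorem translate_injective (v : Site d) :
    Function.Injective (translate v : Finset (Site d) → Finset (Site d)) :=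
  Finset.map_injective _

theorem translate_neg_translate (v : Site d) (Λ : Finset (Site d)) :
    translate (-v) (translate v Λ) = Λ := by
  ext y; simp [mem_translate]

theorem IsPeriodicGradientPotential.interiorHamiltonian_translate
    (h : IsPeriodicGradientPotential L Φ) {v : Site d} (hv : v ∈ L) (Λ : Finset (Site d))
    (φ : HeightFunction d E) :
    interiorHamiltonian Φ (translate v Λ) φ = interiorHamiltonian Φ Λ (shift v φ) := by
  classical
  rw [interiorHamiltonian_eq_sum, interiorHamiltonian_eq_sum]
  have : subsets (translate v Λ) = (subsets Λ).image (translate v) := by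
    ext Γ
    simp only [Finset.mem_image, mem_subsets]
    constructor
    · rintro ⟨h1, h2⟩
      refine ⟨translate (-v) Γ, ⟨fun y hy => ?_, ?_⟩, ?_⟩
      · have := mem_translate.1 (h1 (mem_translate.1 hy))
        simpa using this
      · simpa [translate] using h2
      · simpa using translate_neg_translate (-v) Γ
    · rintro ⟨Γ, ⟨h1, h2⟩, rfl⟩
      exact ⟨Finset.map_subset_map.2 h1, by simpa [translate] using h2⟩
  rw [this, Finset.sum_image fun _ _ _ _ h => translate_injective v h]
  exact Finset.sum_congr rfl fun Γ _ => h.periodic v hv Γ φ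

theorem IsPeriodicGradientPotential.energy_translate
    (h : IsPeriodicGradientPotential L Φ) {v : Site d} (hv : v ∈ L) (Λ : Finset (Site d))
    (φ : HeightFunction d E) : energy Φ (translate v Λ) φ = energy Φ Λ (shift v φ) := by
  rw [energy, h.interiorHamiltonian_translate hv, energy]

/-- The sum of the interactions satisfying `p`, seen from a translated configuration. -/
theorem IsPeriodicGradientPotential.strength_shift (h : IsPeriodicGradientPotential L Φ)
    {v : Site d} (hv : v ∈ L) (φ : HeightFunction d E) (p : Finset (Site d) → Prop) :
    strength Φ (shift v φ) p = strength Φ φ fun Γ => p (translate (-v) Γ) := by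
  rw [strength, strength]
  let e : {Γ : Finset (Site d) // p Γ} ≃ {Γ : Finset (Site d) // p (translate (-v) Γ)} :=
    { toFun := fun Γ => ⟨translate v Γ.1, by rw [translate_neg_translate]; exact Γ.2⟩
      invFun := fun Γ => ⟨translate (-v) Γ.1, Γ.2⟩
      left_inv := fun Γ => Subtype.ext (translate_neg_translate v Γ.1)
      right_inv := fun Γ => Subtype.ext (by simpa using translate_neg_translate (-v) Γ.1) }
  rw [← e.tsum_eq]
  exact tsum_congr fun Γ => by rw [← h.periodic v hv]; rfl

/-- A lower bound for the interior Hamiltonian when the first part of the potential is positive. -/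
theorem interiorHamiltonian_add_ge {C : ℝ} {φ : HeightFunction d E} (hΨ : IsPositive Ψ)
    (hC0 : 0 ≤ C) (hC : ∀ x, strength Ξ φ (x ∈ ·) ≤ ENNReal.ofReal C) (Λ : Finset (Site d)) :
    ((-(Λ.card * C) : ℝ) : EReal) ≤ interiorHamiltonian (Ψ + Ξ) Λ φ := by
  have h1 : interiorHamiltonian Ξ Λ φ ≤ interiorHamiltonian (Ψ + Ξ) Λ φ := by
    rw [interiorHamiltonian_eq_sum, interiorHamiltonian_eq_sum]
    refine Finset.sum_le_sum fun Γ _ => ?_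
    exact le_add_of_nonneg_left (hΨ Γ φ)
  refine le_trans ?_ h1
  rw [← coe_energy hC]
  exact EReal.coe_le_coe_iff.2 (abs_le.1 (abs_energy_le hC0 hC Λ)).1

end PeriodicPotential

/-! ## Free energies in boxes -/

theorem ae_trim_of_ae {X : Type*} {m m₀ : MeasurableSpace X} (hm : m ≤ m₀) {μ : Measure X}
    {p : X → Prop} (hp : MeasurableSet[m] {x | p x}) (h : ∀ᵐ x ∂μ, p x) :
    ∀ᵐ x ∂μ.trim hm, p x := by
  rw [ae_iff] at h ⊢
  have : MeasurableSet[m] {x | ¬ p x} := hp.compl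
  rwa [trim_measurableSet_eq hm this]

section FreeEnergy

variable {d : ℕ} {E : Type} [AddCommGroup E] [MeasurableSpace E] [HeightSpace E]
  [IsRegularHeight E] {L : AddSubgroup (Site d)} {Φ : Potential d E}
  {μ : Measure (HeightFunction d E)}

theorem IsShiftInvariant.measurePreserving (h : IsShiftInvariant L μ) {v : Site d} (hv : v ∈ L) :
    MeasurePreserving (shift v) μ μ :=
  ⟨measurable_shift v, h v hv⟩

theorem IsShiftInvariant.integral_comp (h : IsShiftInvariant L μ) {v : Site d} (hv : v ∈ L)
    {f : HeightFunction d E → ℝ} (hf : Measurable f) :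
    ∫ φ, f (shift v φ) ∂μ = ∫ φ, f φ ∂μ := by
  conv_rhs => rw [← h v hv]
  rw [integral_map (measurable_shift v).aemeasurable hf.aestronglyMeasurable]

theorem IsShiftInvariant.integrable_comp (h : IsShiftInvariant L μ) {v : Site d} (hv : v ∈ L)
    {f : HeightFunction d E → ℝ} (hf : Integrable f μ) :
    Integrable (fun φ => f (shift v φ)) μ :=
  (h.measurePreserving hv).integrable_comp_of_integrable hf

/-- Gibbs' inequality on the gradient sigma-algebra of `Λ`. The real minorant `B` replaces the
Hamiltonian, which may be infinite; it is taken to be either `energy`, which is zero where the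
Hamiltonian is infinite, or a constant. -/
theorem freeEnergy_ge (hΦ : IsPeriodicGradientPotential L Φ) [IsProbabilityMeasure μ]
    {Λ : Finset (Site d)} {x : Site d} (hx : x ∈ Λ) {ρ : HeightFunction d E → ℝ≥0∞}
    (hρ : Measurable[gradientAlgebra (Λ : Set (Site d))] ρ)
    (hρ1 : @lintegral _ (gradientAlgebra (Λ : Set (Site d))) (gradientRef Λ x) ρ ≤ 1)
    (hpos : ∀ᵐ φ ∂μ, ρ φ ≠ 0) (hint : Integrable (fun φ => Real.log (ρ φ).toReal) μ)
    {B : HeightFunction d E → ℝ} (hB : Measurable[gradientAlgebra (Λ : Set (Site d))] B)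
    (hBH : ∀ φ, (B φ : EReal) ≤ interiorHamiltonian Φ Λ φ) (hBint : Integrable B μ) :
    ((∫ φ, Real.log (ρ φ).toReal ∂μ + ∫ φ, B φ ∂μ : ℝ) : EReal) ≤ freeEnergy Φ Λ x μ := by
  have hm := gradientAlgebra_le (E := E) (Λ : Set (Site d))
  have hlogm : Measurable[gradientAlgebra (Λ : Set (Site d))]
      fun φ => Real.log (ρ φ).toReal := Real.measurable_log.comp hρ.ennreal_toReal
  have hp : IsProbabilityMeasure (μ.trim hm) := ⟨by
    rw [trim_measurableSet_eq hm MeasurableSet.univ, measure_univ]⟩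
  have hsf := sigmaFinite_gradientRef (E := E) hx
  have key := integral_log_add_le_relEntropy (m := gradientAlgebra (Λ : Set (Site d)))
    (μ := μ.trim hm) (lam := gradientRef Λ x) (hΦ.measurable_interiorHamiltonian Λ)
    (hΦ.interiorHamiltonian_ne_bot Λ) hρ hρ1
    (ae_trim_of_ae hm (hρ (measurableSet_singleton 0).compl) hpos)
    (hint.trim hm hlogm.stronglyMeasurable) hB hBH (hBint.trim hm hB.stronglyMeasurable)
  rw [integral_trim hm hlogm.stronglyMeasurable, integral_trim hm hB.stronglyMeasurable]
  exact key

/-- The logarithm of the density of `μ` on the gradient sigma-algebra of `Λ`. -/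
noncomputable def logDensity (Λ : Finset (Site d)) (μ : Measure (HeightFunction d E)) :
    HeightFunction d E → ℝ :=
  @llr _ (gradientAlgebra (Λ : Set (Site d))) (μ.trim (gradientAlgebra_le (Λ : Set (Site d))))
    (gradientRef Λ 0)

/-- The density of `μ` on the gradient sigma-algebra of `Λ`. -/
noncomputable def density (Λ : Finset (Site d)) (μ : Measure (HeightFunction d E)) :
    HeightFunction d E → ℝ≥0∞ :=
  @Measure.rnDeriv _ (gradientAlgebra (Λ : Set (Site d)))
    (μ.trim (gradientAlgebra_le (Λ : Set (Site d)))) (gradientRef Λ 0)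

theorem measurable_density (Λ : Finset (Site d)) (μ : Measure (HeightFunction d E)) :
    Measurable[gradientAlgebra (Λ : Set (Site d))] (density Λ μ) :=
  Measure.measurable_rnDeriv _ _

theorem measurable_logDensity (Λ : Finset (Site d)) (μ : Measure (HeightFunction d E)) :
    Measurable[gradientAlgebra (Λ : Set (Site d))] (logDensity Λ μ) :=
  measurable_llr _ _

theorem logDensity_eq (Λ : Finset (Site d)) (μ : Measure (HeightFunction d E))
    (φ : HeightFunction d E) : logDensity Λ μ φ = Real.log (density Λ μ φ).toReal := rfl

theorem lintegral_density_le_one (Λ : Finset (Site d)) [IsProbabilityMeasure μ] :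
    @lintegral _ (gradientAlgebra (Λ : Set (Site d))) (gradientRef Λ 0) (density Λ μ) ≤ 1 := by
  have hm := gradientAlgebra_le (E := E) (Λ : Set (Site d))
  refine (Measure.lintegral_rnDeriv_le (μ := μ.trim hm)).trans ?_
  rw [trim_measurableSet_eq hm MeasurableSet.univ, measure_univ]

theorem density_pos {Λ : Finset (Site d)} (h0 : (0 : Site d) ∈ Λ) [IsProbabilityMeasure μ]
    (hac : μ.trim (gradientAlgebra_le (Λ : Set (Site d))) ≪ gradientRef Λ 0) :
    ∀ᵐ φ ∂μ, density Λ μ φ ≠ 0 ∧ density Λ μ φ ≠ ⊤ := by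
  have hm := gradientAlgebra_le (E := E) (Λ : Set (Site d))
  have hp : IsProbabilityMeasure (μ.trim hm) := ⟨by
    rw [trim_measurableSet_eq hm MeasurableSet.univ, measure_univ]⟩
  have hsf := sigmaFinite_gradientRef (E := E) h0
  refine ae_of_ae_trim hm ?_
  filter_upwards [Measure.rnDeriv_pos hac,
    hac.ae_le (Measure.rnDeriv_lt_top (μ.trim hm) (gradientRef Λ 0))] with φ h1 h2
  exact ⟨h1.ne', h2.ne⟩

theorem logDensity_integrable {Λ : Finset (Site d)} (h0 : (0 : Site d) ∈ Λ)
    [IsProbabilityMeasure μ] {c : ℝ} (hc : 0 < c)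
    (hle : μ.trim (gradientAlgebra_le (Λ : Set (Site d))) ≤ ENNReal.ofReal c • gradientRef Λ 0)
    {ρ : HeightFunction d E → ℝ≥0∞}
    (hρ : Measurable[gradientAlgebra (Λ : Set (Site d))] ρ)
    (hρ1 : @lintegral _ (gradientAlgebra (Λ : Set (Site d))) (gradientRef Λ 0) ρ ≤ 1)
    (hpos : ∀ᵐ φ ∂μ, ρ φ ≠ 0) (hint : Integrable (fun φ => Real.log (ρ φ).toReal) μ) :
    μ.trim (gradientAlgebra_le (Λ : Set (Site d))) ≪ gradientRef Λ 0 ∧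
      Integrable (logDensity Λ μ) μ ∧ ∀ᵐ φ ∂μ, logDensity Λ μ φ ≤ Real.log c := by
  have hm := gradientAlgebra_le (E := E) (Λ : Set (Site d))
  have hp : IsProbabilityMeasure (μ.trim hm) := ⟨by
    rw [trim_measurableSet_eq hm MeasurableSet.univ, measure_univ]⟩
  have hsf := sigmaFinite_gradientRef (E := E) h0
  have hlogm : Measurable[gradientAlgebra (Λ : Set (Site d))]
      fun φ => Real.log (ρ φ).toReal := Real.measurable_log.comp hρ.ennreal_toReal
  obtain ⟨h1, h2, h3⟩ := integrable_llr_of_le_smul (m := gradientAlgebra (Λ : Set (Site d)))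
    (μ := μ.trim hm) (ν := gradientRef Λ 0) hc hle hρ hρ1
    (ae_trim_of_ae hm (hρ (measurableSet_singleton 0).compl) hpos)
    (hint.trim hm hlogm.stronglyMeasurable)
  exact ⟨h1, integrable_of_integrable_trim hm h2, ae_of_ae_trim hm h3⟩

theorem freeEnergy_eq (hΦ : IsPeriodicGradientPotential L Φ) [IsProbabilityMeasure μ]
    {Λ : Finset (Site d)} (h0 : (0 : Site d) ∈ Λ)
    (hac : μ.trim (gradientAlgebra_le (Λ : Set (Site d))) ≪ gradientRef Λ 0)
    (hint : Integrable (logDensity Λ μ) μ) (htop : ∀ᵐ φ ∂μ, interiorHamiltonian Φ Λ φ ≠ ⊤)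
    (hEint : Integrable (energy Φ Λ) μ) :
    freeEnergy Φ Λ 0 μ =
      ((∫ φ, logDensity Λ μ φ ∂μ + ∫ φ, energy Φ Λ φ ∂μ : ℝ) : EReal) := by
  have hm := gradientAlgebra_le (E := E) (Λ : Set (Site d))
  have hp : IsProbabilityMeasure (μ.trim hm) := ⟨by
    rw [trim_measurableSet_eq hm MeasurableSet.univ, measure_univ]⟩
  have hsf := sigmaFinite_gradientRef (E := E) h0
  have hH := hΦ.measurable_interiorHamiltonian Λ
  have hEm : Measurable[gradientAlgebra (Λ : Set (Site d))] (energy Φ Λ) := hH.ereal_toReal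
  have hl := measurable_logDensity Λ μ
  have key := relEntropy_withDensity (m := gradientAlgebra (Λ : Set (Site d)))
    (μ := μ.trim hm) (lam := gradientRef Λ 0) hH (hΦ.interiorHamiltonian_ne_bot Λ)
    (ae_trim_of_ae hm (hH (measurableSet_singleton ⊤).compl) htop) hac
    (hint.trim hm hl.stronglyMeasurable) (hEint.trim hm hEm.stronglyMeasurable)
  rw [freeEnergy, key, integral_trim hm hl.stronglyMeasurable,
    integral_trim hm hEm.stronglyMeasurable]
  rfl

/-- The uniform density for height differences bounded by `K`. -/
noncomputable def unifDensity (E : Type) [AddCommGroup E] [MeasurableSpace E] [HeightSpace E]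
    (K : ℝ) : E → ℝ≥0∞ :=
  {t : E | |HeightSpace.toReal t| ≤ K}.indicator fun _ => ENNReal.ofReal (2 * K + 1)⁻¹

theorem measurableSet_abs_le (K : ℝ) :
    MeasurableSet {t : E | |HeightSpace.toReal t| ≤ K} := by
  have h : Measurable fun t : E => |HeightSpace.toReal t| :=
    (IsRegularHeight.measurable_toReal (E := E)).norm
  exact h measurableSet_Iic

theorem measurable_unifDensity (K : ℝ) : Measurable (unifDensity E K) :=
  measurable_const.indicator (measurableSet_abs_le K)

theorem lintegral_unifDensity_le_one {K : ℝ} (hK : 0 ≤ K) :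
    ∫⁻ t, unifDensity E K t ∂HeightSpace.ref ≤ 1 := by
  rw [unifDensity, lintegral_indicator_const (measurableSet_abs_le K)]
  refine (mul_le_mul_right (IsRegularHeight.ref_le K hK) _).trans ?_
  rw [← ENNReal.ofReal_mul (by positivity), inv_mul_cancel₀ (by positivity), ENNReal.ofReal_one]

theorem unifDensity_of_le {K : ℝ} {t : E} (h : |HeightSpace.toReal t| ≤ K) :
    unifDensity E K t = ENNReal.ofReal (2 * K + 1)⁻¹ :=
  indicator_of_mem (s := {t : E | |HeightSpace.toReal t| ≤ K}) h _

/-- Since steps are bounded by `K`, each uniform factor is almost surely the constant `(2 * K +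
1)⁻¹`. The logarithm is thus a sum over the tiles, whose terms have equal means because the tile
positions lie in `L`, minus `log (2 * K + 1)` for each root other than the origin. -/
theorem integral_log_tileDensity [IsProbabilityMeasure μ]
    (hμ : IsShiftInvariant L μ) {n k l : ℕ} (hl : 1 ≤ l) (hlk : l ≤ k)
    (hL : ∀ v ∈ tilePositions d n k, v ∈ L) {K : ℝ} (hK : 0 ≤ K)
    (hstep : ∀ᵐ φ ∂μ, ∀ (x : Site d) (j : Fin d),
      |HeightSpace.toReal (φ (x + Pi.single j 1) - φ x)| ≤ K)
    {F : HeightFunction d E → ℝ≥0∞}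
    (hF : Measurable[gradientAlgebra (box d l : Set (Site d))] F)
    (hFpos : ∀ᵐ φ ∂μ, F φ ≠ 0 ∧ F φ ≠ ⊤)
    (hFint : Integrable (fun φ => Real.log (F φ).toReal) μ) :
    (∀ᵐ φ ∂μ, tileDensity n k l F (unifDensity E K) φ ≠ 0) ∧
    Integrable (fun φ => Real.log (tileDensity n k l F (unifDensity E K) φ).toReal) μ ∧
    (n / k : ℕ) ^ d * ∫ φ, Real.log (F φ).toReal ∂μ -
      (((n / k : ℕ) ^ d : ℝ) + (uncovered d n k l).card) * Real.log (2 * K + 1) ≤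
      ∫ φ, Real.log (tileDensity n k l F (unifDensity E K) φ).toReal ∂μ := by
  have hFm : Measurable F := hF.mono (gradientAlgebra_le _) le_rfl
  have hlogm : Measurable fun φ => Real.log (F φ).toReal :=
    Real.measurable_log.comp hFm.ennreal_toReal
  have hKc : 0 ≤ Real.log (2 * K + 1) := Real.log_nonneg (by linarith)
  have hFall : ∀ᵐ φ ∂μ, ∀ v ∈ tilePositions d n k, F (shift v φ) ≠ 0 ∧ F (shift v φ) ≠ ⊤ := by
    refine (ae_ball_iff (Finset.countable_toSet (tilePositions d n k))).2 ?_
    exact fun v hv => (hμ.measurePreserving (hL v hv)).quasiMeasurePreserving.ae hFpos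
  have hu : ∀ᵐ φ ∂μ, ∀ i ∈ (blockRoots d n k l).erase 0,
      unifDensity E K (φ i - φ (parent i)) = ENNReal.ofReal (2 * K + 1)⁻¹ := by
    filter_upwards [hstep] with φ hφ i hi
    rw [Finset.mem_erase] at hi
    obtain ⟨j, -, hp⟩ := exists_parent_eq (blockRoots_subset hl hlk hi.2) hi.1
    have := hφ (parent i) j
    rw [hp, sub_add_cancel] at this
    rw [hp]
    exact unifDensity_of_le this
  have hc0 : 0 < (2 * K + 1)⁻¹ := by positivity
  set N := ((blockRoots d n k l).erase 0).card with hN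
  have hlog : (fun φ => Real.log (tileDensity n k l F (unifDensity E K) φ).toReal) =ᵐ[μ]
      fun φ => (∑ v ∈ tilePositions d n k, Real.log (F (shift v φ)).toReal) -
        N * Real.log (2 * K + 1) := by
    filter_upwards [hFall, hu] with φ h1 h2
    rw [tileDensity, Finset.prod_congr rfl h2, Finset.prod_const, ENNReal.toReal_mul,
      ENNReal.toReal_prod, ENNReal.toReal_pow, ENNReal.toReal_ofReal hc0.le, Real.log_mul,
      Real.log_prod, Real.log_pow, Real.log_inv]
    · ring
    · exact fun v hv => (ENNReal.toReal_pos (h1 v hv).1 (h1 v hv).2).ne'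
    · exact Finset.prod_ne_zero_iff.2 fun v hv => (ENNReal.toReal_pos (h1 v hv).1 (h1 v hv).2).ne'
    · positivity
  have hsumint : Integrable (fun φ => ∑ v ∈ tilePositions d n k, Real.log (F (shift v φ)).toReal) μ :=
    integrable_finsetSum _ fun v hv => hμ.integrable_comp (hL v hv) hFint
  have hsum : ∫ φ, ∑ v ∈ tilePositions d n k, Real.log (F (shift v φ)).toReal ∂μ =
      (n / k : ℕ) ^ d * ∫ φ, Real.log (F φ).toReal ∂μ := by
    rw [integral_finsetSum _ fun v hv => hμ.integrable_comp (hL v hv) hFint]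
    rw [Finset.sum_congr rfl fun v hv => hμ.integral_comp (hL v hv) hlogm, Finset.sum_const,
      card_tilePositions (hl.trans hlk), nsmul_eq_mul]
    push_cast
    rfl
  refine ⟨?_, (integrable_congr hlog).2 (hsumint.sub (integrable_const _)), ?_⟩
  · filter_upwards [hFall, hu] with φ h1 h2
    rw [tileDensity, Finset.prod_congr rfl h2, Finset.prod_const]
    refine mul_ne_zero (Finset.prod_ne_zero_iff.2 fun v hv => (h1 v hv).1) (pow_ne_zero _ ?_)
    simpa using hc0
  · rw [integral_congr_ae hlog, integral_sub hsumint (integrable_const _), hsum]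
    simp only [integral_const, probReal_univ, smul_eq_mul, one_mul]
    have hcard : (N : ℝ) ≤ (n / k : ℕ) ^ d + (uncovered d n k l).card := by
      have h1 : N ≤ (n / k) ^ d + (uncovered d n k l).card :=
        (Finset.card_le_card (Finset.erase_subset _ _)).trans (card_blockRoots_le (hl.trans hlk))
      exact_mod_cast h1
    have := mul_le_mul_of_nonneg_right hcard hKc
    linarith

/-- The lower bound for the free energy in a box obtained from a density on the tiles. -/
theorem freeEnergy_tile_ge (hΦ : IsPeriodicGradientPotential L Φ) [IsProbabilityMeasure μ]
    (hμ : IsShiftInvariant L μ) {n k l : ℕ} (hn : 1 ≤ n) (hl : 1 ≤ l) (hlk : l ≤ k)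
    (hL : ∀ v ∈ tilePositions d n k, v ∈ L) {K : ℝ} (hK : 0 ≤ K)
    (hstep : ∀ᵐ φ ∂μ, ∀ (x : Site d) (j : Fin d),
      |HeightSpace.toReal (φ (x + Pi.single j 1) - φ x)| ≤ K)
    {F : HeightFunction d E → ℝ≥0∞}
    (hF : Measurable[gradientAlgebra (box d l : Set (Site d))] F)
    (hF1 : @lintegral _ (gradientAlgebra (box d l : Set (Site d))) (gradientRef (box d l) 0) F ≤ 1)
    (hFpos : ∀ᵐ φ ∂μ, F φ ≠ 0 ∧ F φ ≠ ⊤) (hFint : Integrable (fun φ => Real.log (F φ).toReal) μ)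
    {B : HeightFunction d E → ℝ} (hB : Measurable[gradientAlgebra (box d n : Set (Site d))] B)
    (hBH : ∀ φ, (B φ : EReal) ≤ interiorHamiltonian Φ (box d n) φ) (hBint : Integrable B μ) :
    (((n / k : ℕ) ^ d * ∫ φ, Real.log (F φ).toReal ∂μ -
      (((n / k : ℕ) ^ d : ℝ) + (uncovered d n k l).card) * Real.log (2 * K + 1) + ∫ φ, B φ ∂μ : ℝ) :
        EReal) ≤ freeEnergy Φ (box d n) 0 μ := by
  obtain ⟨h1, h2, h3⟩ := integral_log_tileDensity hμ hl hlk hL hK hstep hF hFpos hFint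
  exact le_trans (EReal.coe_le_coe_iff.2 (by linarith)) (freeEnergy_ge hΦ (zero_mem_box hn)
    (measurable_tileDensity hl hlk hF (measurable_unifDensity K))
    (lintegral_tileDensity_le_one hn hl hlk hF hF1 (measurable_unifDensity K)
      (lintegral_unifDensity_le_one hK)) h1 h2 hB hBH hBint)

/-- There is no position at all, except in dimension zero, where the only one is the zero vector. -/
theorem tilePositions_lt_mem {n k : ℕ} (hnk : n < k) {v : Site d} (hv : v ∈ tilePositions d n k) :
    v ∈ L := by
  simp only [tilePositions, Nat.div_eq_of_lt hnk, Finset.mem_image] at hv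
  obtain ⟨w, hw, rfl⟩ := hv
  have : (k : ℤ) • w = 0 := by
    ext j
    have := mem_box.1 hw j
    push_cast at this
    omega
  rw [this]
  exact zero_mem L

theorem lintegral_one_gradientRef (d : ℕ) (E : Type) [AddCommGroup E] [MeasurableSpace E]
    [HeightSpace E] [IsRegularHeight E] :
    @lintegral _ (gradientAlgebra (box d 1 : Set (Site d)))
      (gradientRef (E := E) (box d 1) 0) (fun _ => 1) ≤ 1 := by
  have hbox : (box d 1).erase 0 = ∅ := by
    ext y
    simp only [Finset.mem_erase, mem_box, Finset.notMem_empty, iff_false, not_and]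
    intro h1 h2
    exact h1 (funext fun j => by have := h2 j; simp only [Pi.zero_apply]; omega)
  rw [← lmarginal_gradient (zero_mem_box le_rfl) measurable_const 0 0, hbox]
  simp

/-- The density of independent uniform steps. -/
theorem exists_product_density [IsProbabilityMeasure μ] (hμ : IsShiftInvariant L μ) {n : ℕ}
    (hn : 1 ≤ n) {K : ℝ} (hK : 0 ≤ K)
    (hstep : ∀ᵐ φ ∂μ, ∀ (x : Site d) (j : Fin d),
      |HeightSpace.toReal (φ (x + Pi.single j 1) - φ x)| ≤ K) :
    ∃ ρ : HeightFunction d E → ℝ≥0∞, Measurable[gradientAlgebra (box d n : Set (Site d))] ρ ∧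
      @lintegral _ (gradientAlgebra (box d n : Set (Site d))) (gradientRef (box d n) 0) ρ ≤ 1 ∧
      (∀ᵐ φ ∂μ, ρ φ ≠ 0) ∧ Integrable (fun φ => Real.log (ρ φ).toReal) μ ∧
      -((n : ℝ) ^ d * Real.log (2 * K + 1)) ≤ ∫ φ, Real.log (ρ φ).toReal ∂μ := by
  -- Cells of side `n + 1` do not fit in the box and the tile factor is one, so only the uniform
  -- steps remain.
  obtain ⟨h1, h2, h3⟩ := integral_log_tileDensity (F := fun _ => 1) (n := n) (k := n + 1) hμ le_rfl
    (by omega) (fun v hv => tilePositions_lt_mem (by omega) hv) hK hstep measurable_const (by simp)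
    (by simp)
  refine ⟨_, measurable_tileDensity le_rfl (by omega) measurable_const (measurable_unifDensity K),
    lintegral_tileDensity_le_one hn le_rfl (by omega) measurable_const
      (lintegral_one_gradientRef d E) (measurable_unifDensity K) (lintegral_unifDensity_le_one hK),
    h1, h2, le_trans (le_of_eq ?_) h3⟩
  have hc := card_uncovered (d := d) (n := n) (k := n + 1) (l := 1) (by omega) (by omega)
  rw [one_pow, mul_one] at hc
  have hc' : ((uncovered d n (n + 1) 1).card : ℝ) + (n / (n + 1) : ℕ) ^ d = (n : ℝ) ^ d := by
    exact_mod_cast hc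
  simp only [ENNReal.toReal_one, Real.log_one, integral_zero, mul_zero, zero_sub]
  rw [← hc']
  ring

end FreeEnergy

/-! ## Existence of the specific free energy -/

section Limit

variable {d : ℕ} {E : Type} [AddCommGroup E] [MeasurableSpace E] [HeightSpace E]
  [IsRegularHeight E] {L : AddSubgroup (Site d)} {Φ : Potential d E}
  {μ : Measure (HeightFunction d E)}

/-- The height function has bounded steps and the interactions are bounded at it. -/
structure IsTame (L : AddSubgroup (Site d)) (Φ : Potential d E) (K C : ℝ) (e : ℕ → ℝ)
    (φ : HeightFunction d E) : Prop where
  step : ∀ (x : Site d) (j : Fin d), |HeightSpace.toReal (φ (x + Pi.single j 1) - φ x)| ≤ K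
  strength_le : ∀ x, strength Φ φ (x ∈ ·) ≤ ENNReal.ofReal C
  cross_le : ∀ v ∈ L, ∀ l, strength Φ φ (Crosses (translate v (box d l))) ≤ ENNReal.ofReal (e l)

/-- The invariant measures on tame height functions with bounded densities. -/
structure IsTameMeasure (L : AddSubgroup (Site d)) (Φ : Potential d E) (K C c : ℝ) (e : ℕ → ℝ)
    (μ : Measure (HeightFunction d E)) : Prop where
  prob : IsProbabilityMeasure μ
  inv : IsShiftInvariant L μ
  tame : ∀ᵐ φ ∂μ, IsTame L Φ K C e φ
  density_le : ∀ n, 1 ≤ n → μ.trim (gradientAlgebra_le (box d n : Set (Site d))) ≤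
    ENNReal.ofReal (c ^ n ^ d) • gradientRef (box d n) 0

/-- The free energy in a box, as a real number. -/
noncomputable def realFreeEnergy (Φ : Potential d E) (n : ℕ) (μ : Measure (HeightFunction d E)) :
    ℝ :=
  ∫ φ, logDensity (box d n) μ φ ∂μ + ∫ φ, energy Φ (box d n) φ ∂μ

theorem IsPeriodicGradientPotential.measurable_energy (hΦ : IsPeriodicGradientPotential L Φ)
    (Λ : Finset (Site d)) : Measurable[gradientAlgebra (Λ : Set (Site d))] (energy Φ Λ) :=
  (hΦ.measurable_interiorHamiltonian Λ).ereal_toReal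

section Tame

variable {K C c : ℝ} {e : ℕ → ℝ} (hΦ : IsPeriodicGradientPotential L Φ)
  (hμ : IsTameMeasure L Φ K C c e μ) (hK : 0 ≤ K) (hC : 0 ≤ C) (hc : 1 ≤ c)

include hΦ hμ hC in
theorem IsTameMeasure.integrable_energy (Λ : Finset (Site d)) : Integrable (energy Φ Λ) μ := by
  have := hμ.prob
  refine Integrable.mono' (integrable_const (Λ.card * C))
    ((hΦ.measurable_energy Λ).mono (gradientAlgebra_le _) le_rfl).aestronglyMeasurable ?_
  filter_upwards [hμ.tame] with φ hφ
  exact abs_energy_le hC hφ.strength_le Λ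

include hμ hC in
theorem IsTameMeasure.abs_integral_energy_le (Λ : Finset (Site d)) :
    |∫ φ, energy Φ Λ φ ∂μ| ≤ Λ.card * C := by
  have := hμ.prob
  have h := norm_integral_le_of_norm_le_const (f := energy Φ Λ) (μ := μ) (C := Λ.card * C)
    (hμ.tame.mono fun φ hφ => abs_energy_le hC hφ.strength_le Λ)
  simpa using h

include hμ hK hc in
theorem IsTameMeasure.logDensity {n : ℕ} (hn : 1 ≤ n) :
    μ.trim (gradientAlgebra_le (box d n : Set (Site d))) ≪ gradientRef (box d n) 0 ∧
      Integrable (logDensity (box d n) μ) μ ∧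
      ∫ φ, logDensity (box d n) μ φ ∂μ ≤ n ^ d * Real.log c := by
  have := hμ.prob
  obtain ⟨ρ, h1, h2, h3, h4, -⟩ := exists_product_density hμ.inv hn hK
    (hμ.tame.mono fun φ hφ => hφ.step)
  obtain ⟨h5, h6, h7⟩ := logDensity_integrable (zero_mem_box hn)
    (show 0 < c ^ n ^ d by positivity) (hμ.density_le n hn) h1 h2 h3 h4
  refine ⟨h5, h6, ?_⟩
  have h8 := integral_mono_ae h6 (integrable_const _) h7
  simp only [integral_const, probReal_univ, smul_eq_mul, one_mul, Real.log_pow] at h8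
  exact_mod_cast h8

include hΦ hμ hK hC hc in
theorem IsTameMeasure.freeEnergy_eq {n : ℕ} (hn : 1 ≤ n) :
    freeEnergy Φ (box d n) 0 μ = (realFreeEnergy Φ n μ : EReal) := by
  have := hμ.prob
  obtain ⟨h1, h2, -⟩ := hμ.logDensity hK hc hn
  refine LipschitzSurface.freeEnergy_eq hΦ (zero_mem_box hn) h1 h2 ?_
    (hμ.integrable_energy hΦ hC _)
  filter_upwards [hμ.tame] with φ hφ
  rw [interiorHamiltonian_eq_coe hφ.strength_le]
  exact EReal.coe_ne_top _

include hμ hK hC hc in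
theorem IsTameMeasure.realFreeEnergy_le {n : ℕ} (hn : 1 ≤ n) :
    realFreeEnergy Φ n μ ≤ n ^ d * (Real.log c + C) := by
  have h1 := (hμ.logDensity hK hc hn).2.2
  have h2 := (abs_le.1 (hμ.abs_integral_energy_le hC (box d n))).2
  rw [card_box] at h2
  push_cast at h2
  rw [realFreeEnergy]
  linarith

include hΦ hμ hC in
theorem IsTameMeasure.integral_energy_box_ge {n k l : ℕ} (hlk : l ≤ k) (hk : 1 ≤ k)
    (he : 0 ≤ e l) (hL : ∀ v ∈ tilePositions d n k, v ∈ L) :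
    (n / k : ℕ) ^ d * (∫ φ, energy Φ (box d l) φ ∂μ - e l) - (uncovered d n k l).card * C ≤
      ∫ φ, energy Φ (box d n) φ ∂μ := by
  have := hμ.prob
  have hm := (hΦ.measurable_energy (box d l)).mono (gradientAlgebra_le _) le_rfl
  have hI := hμ.integrable_energy hΦ hC
  have h1 : ∫ φ, ((∑ v ∈ tilePositions d n k, energy Φ (translate v (box d l)) φ) -
      ((tilePositions d n k).card * e l + (uncovered d n k l).card * C)) ∂μ ≤
      ∫ φ, energy Φ (box d n) φ ∂μ := by
    refine integral_mono_ae ((integrable_finsetSum _ fun v _ => hI _).sub (integrable_const _))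
      (hI _) ?_
    filter_upwards [hμ.tame] with φ hφ
    exact energy_box_ge hlk hC he hφ.strength_le fun v hv => hφ.cross_le v (hL v hv) l
  rw [integral_sub (integrable_finsetSum _ fun v _ => hI _) (integrable_const _),
    integral_finsetSum _ fun v _ => hI _] at h1
  have h2 : ∀ v ∈ tilePositions d n k, ∫ φ, energy Φ (translate v (box d l)) φ ∂μ =
      ∫ φ, energy Φ (box d l) φ ∂μ := fun v hv => by
    rw [← hμ.inv.integral_comp (hL v hv) hm]
    simp only [hΦ.energy_translate (hL v hv)]
  rw [Finset.sum_congr rfl h2, Finset.sum_const, card_tilePositions hk, nsmul_eq_mul] at h1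
  simp only [integral_const, probReal_univ, smul_eq_mul, one_mul] at h1
  push_cast at h1
  linarith

include hΦ hμ hK hC hc in
-- The trial density copies the density of `μ` in the box of side `l` over all tiles. A tile loses
-- `log (2 * K + 1)` for attaching its root and `e l` for the interactions crossing its boundary; an
-- uncovered vertex loses `log (2 * K + 1) + C`.
theorem IsTameMeasure.realFreeEnergy_superadditive {n k l : ℕ} (hn : 1 ≤ n) (hl : 1 ≤ l)
    (hlk : l ≤ k) (he : 0 ≤ e l) (hL : ∀ v ∈ tilePositions d n k, v ∈ L) :
    (n / k : ℕ) ^ d * (realFreeEnergy Φ l μ - Real.log (2 * K + 1) - e l) -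
      (uncovered d n k l).card * (Real.log (2 * K + 1) + C) ≤ realFreeEnergy Φ n μ := by
  have := hμ.prob
  obtain ⟨h1, h2, -⟩ := hμ.logDensity hK hc hl
  have key := freeEnergy_ge (Φ := Φ) (μ := μ) hΦ (zero_mem_box hn) (B := energy Φ (box d n))
    (measurable_tileDensity (n := n) hl hlk (measurable_density (box d l) μ)
      (measurable_unifDensity K))
    (lintegral_tileDensity_le_one hn hl hlk (measurable_density (box d l) μ)
      (lintegral_density_le_one _) (measurable_unifDensity K) (lintegral_unifDensity_le_one hK))
  obtain ⟨h3, h4, h5⟩ := integral_log_tileDensity hμ.inv hl hlk hL hK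
    (hμ.tame.mono fun φ hφ => hφ.step) (measurable_density (box d l) μ)
    (density_pos (zero_mem_box hl) h1) h2
  have key' := key h3 h4 (hΦ.measurable_energy _) (fun φ => ?_) (hμ.integrable_energy hΦ hC _)
  · rw [hμ.freeEnergy_eq hΦ hK hC hc hn, EReal.coe_le_coe_iff] at key'
    have h6 := hμ.integral_energy_box_ge hΦ hC hlk (hl.trans hlk) he hL (n := n)
    simp only [← logDensity_eq] at h5
    have h7 : realFreeEnergy Φ l μ =
      ∫ φ, LipschitzSurface.logDensity (box d l) μ φ ∂μ + ∫ φ, energy Φ (box d l) φ ∂μ := rfl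
    rw [h7]
    linarith
  · exact EReal.coe_toReal_le (hΦ.interiorHamiltonian_ne_bot _ _)

include hΦ hμ hK hC hc in
theorem IsTameMeasure.realFreeEnergy_ge {n : ℕ} (hn : 1 ≤ n) :
    -(n ^ d * (Real.log (2 * K + 1) + C)) ≤ realFreeEnergy Φ n μ := by
  have := hμ.prob
  obtain ⟨ρ, h1, h2, h3, h4, h5⟩ := exists_product_density hμ.inv hn hK
    (hμ.tame.mono fun φ hφ => hφ.step)
  have key := freeEnergy_ge (Φ := Φ) (μ := μ) hΦ (zero_mem_box hn) (B := energy Φ (box d n))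
    h1 h2 h3 h4 (hΦ.measurable_energy _)
    (fun φ => EReal.coe_toReal_le (hΦ.interiorHamiltonian_ne_bot _ _))
    (hμ.integrable_energy hΦ hC _)
  rw [hμ.freeEnergy_eq hΦ hK hC hc hn, EReal.coe_le_coe_iff] at key
  have h2 := (abs_le.1 (hμ.abs_integral_energy_le hC (box d n))).1
  rw [card_box] at h2
  push_cast at h2
  linarith

end Tame

/-- The side of the cells containing the tiles of side `l`. -/
def cellSide (m l : ℕ) : ℕ := m * (l / m + 1)

/-- Being a multiple of `m`, a cell side makes the tile positions lattice vectors as soon as `L`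
contains all multiples of `m`. It exceeds `l` by at most `m`, so the uncovered fraction becomes
negligible for large `l`. -/
theorem le_cellSide {m : ℕ} (hm : 1 ≤ m) (l : ℕ) : l ≤ cellSide m l := by
  rw [cellSide]
  have := Nat.div_add_mod l m
  have := Nat.mod_lt l hm
  nlinarith

theorem cellSide_le (m l : ℕ) : cellSide m l ≤ l + m := by
  rw [cellSide]
  have := Nat.mul_div_le l m
  nlinarith

theorem tendsto_cellSide {m : ℕ} (hm : 1 ≤ m) :
    Tendsto (fun l : ℕ => (l : ℝ) / cellSide m l) atTop (𝓝 1) := by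
  have h1 : Tendsto (fun l : ℕ => (l : ℝ) / (l + m : ℝ)) atTop (𝓝 1) :=
    tendsto_natCast_div_add_atTop (m : ℝ)
  refine tendsto_of_tendsto_of_tendsto_of_le_of_le' h1 tendsto_const_nhds ?_ ?_
  · filter_upwards [eventually_ge_atTop 1] with l hl
    have h2 : (0 : ℝ) < cellSide m l := by
      exact_mod_cast (Nat.lt_of_lt_of_le hl (le_cellSide hm l))
    have h3 : (cellSide m l : ℝ) ≤ l + m := by exact_mod_cast cellSide_le m l
    gcongr
  · filter_upwards [eventually_ge_atTop 1] with l hl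
    have h2 : (0 : ℝ) < cellSide m l := by
      exact_mod_cast (Nat.lt_of_lt_of_le hl (le_cellSide hm l))
    rw [div_le_one h2]
    exact_mod_cast le_cellSide hm l

theorem tendsto_div_div {k : ℕ} (hk : 1 ≤ k) :
    Tendsto (fun n : ℕ => ((n / k : ℕ) : ℝ) / n) atTop (𝓝 (k : ℝ)⁻¹) := by
  have h := (tendsto_nat_floor_mul_div_atTop (R := ℝ) (a := (k : ℝ)⁻¹) (by positivity)).comp
    tendsto_natCast_atTop_atTop
  refine h.congr fun n => ?_
  simp only [Function.comp]
  rw [inv_mul_eq_div, Nat.floor_div_natCast, Nat.floor_natCast]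

/-- The lower bound for the specific free energy obtained from the box of side `l`. -/
noncomputable def boxBound (d m : ℕ) (D C : ℝ) (e : ℕ → ℝ) (l : ℕ) (g : ℝ) : ℝ :=
  ((l : ℝ) / cellSide m l) ^ d * (g - (D + e l) / (l : ℝ) ^ d) -
    (1 - ((l : ℝ) / cellSide m l) ^ d) * (D + C)

/-- All losses per vertex vanish for large tiles: the covered fraction tends to one and `(D + e l) /
l ^ d` tends to zero. Boundedness of `g` is needed since it multiplies the uncovered fraction. -/
theorem tendsto_boxBound_sub {m : ℕ} (hm : 1 ≤ m) (hd : d ≠ 0) {D C M : ℝ} {e g : ℕ → ℝ}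
    (he : Tendsto (fun l : ℕ => e l / (l : ℝ) ^ d) atTop (𝓝 0)) (hg : ∀ l, 1 ≤ l → |g l| ≤ M) :
    Tendsto (fun l => g l - boxBound d m D C e l (g l)) atTop (𝓝 0) := by
  have h1 : Tendsto (fun l : ℕ => ((l : ℝ) / cellSide m l) ^ d) atTop (𝓝 1) := by
    simpa using (tendsto_cellSide hm).pow d
  have h2 : Tendsto (fun l : ℕ => (D + e l) / (l : ℝ) ^ d) atTop (𝓝 0) := by
    have : Tendsto (fun l : ℕ => D / (l : ℝ) ^ d) atTop (𝓝 0) :=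
      tendsto_const_nhds.div_atTop ((tendsto_pow_atTop hd).comp tendsto_natCast_atTop_atTop)
    simpa [add_div] using this.add he
  have h3 : Tendsto (fun l : ℕ => (1 - ((l : ℝ) / cellSide m l) ^ d) * g l) atTop (𝓝 0) := by
    have hz : Tendsto (fun l : ℕ => 1 - ((l : ℝ) / cellSide m l) ^ d) atTop (𝓝 0) := by
      simpa using h1.const_sub 1
    rw [tendsto_zero_iff_norm_tendsto_zero] at hz ⊢
    have hz' := hz.mul_const M
    rw [zero_mul] at hz'
    refine tendsto_of_tendsto_of_tendsto_of_le_of_le' tendsto_const_nhds hz'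
      (Eventually.of_forall fun l => norm_nonneg _) ?_
    filter_upwards [eventually_ge_atTop 1] with l hl
    rw [norm_mul]
    exact mul_le_mul_of_nonneg_left (hg l hl) (norm_nonneg _)
  have h4 := (h3.add (h1.mul h2)).add ((h1.const_sub 1).mul_const (D + C))
  simp only [sub_self, zero_mul, mul_zero, add_zero] at h4
  refine h4.congr fun l => ?_
  rw [boxBound]
  ring

theorem boxBound_div {m l : ℕ} (hl : 1 ≤ l) (D C G : ℝ) (e : ℕ → ℝ) :
    (cellSide m l : ℝ)⁻¹ ^ d * (G - D - e l) - (1 - (cellSide m l : ℝ)⁻¹ ^ d * (l : ℝ) ^ d) * (D + C)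
      = boxBound d m D C e l (G / (l : ℝ) ^ d) := by
  have hl' : (l : ℝ) ^ d ≠ 0 := by positivity
  have h : G - D - e l = (G / (l : ℝ) ^ d - (D + e l) / (l : ℝ) ^ d) * (l : ℝ) ^ d := by
    field_simp
    ring
  rw [boxBound, h, div_pow, inv_pow]
  ring

theorem sub_mul_div_pow {n : ℕ} (hn : 1 ≤ n) (x G c B : ℝ) :
    ((x / n) ^ d * G - (1 - (x / n) ^ d * c) * B) * (n : ℝ) ^ d =
      x ^ d * G - ((n : ℝ) ^ d - x ^ d * c) * B := by
  have hn' : (n : ℝ) ^ d ≠ 0 := by positivity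
  rw [div_pow]
  field_simp

/-- A version of Fekete's lemma for tilings by cubes. -/
theorem exists_tendsto_of_superadditive {m : ℕ} (hm : 1 ≤ m) (hd : d ≠ 0) {D C M : ℝ} {e : ℕ → ℝ}
    (he : Tendsto (fun l : ℕ => e l / (l : ℝ) ^ d) atTop (𝓝 0)) {G : ℕ → ℝ}
    (hup : ∀ n, 1 ≤ n → G n ≤ n ^ d * M) (hlo : ∀ n, 1 ≤ n → -(n ^ d * (D + C)) ≤ G n)
    (hG : ∀ n l, 1 ≤ n → 1 ≤ l → ((n / cellSide m l : ℕ) : ℝ) ^ d * (G l - D - e l) -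
      ((n : ℝ) ^ d - ((n / cellSide m l : ℕ) : ℝ) ^ d * (l : ℝ) ^ d) * (D + C) ≤ G n) :
    ∃ h : ℝ, Tendsto (fun n : ℕ => G n / (n : ℝ) ^ d) atTop (𝓝 h) ∧
      (∀ l, 1 ≤ l → boxBound d m D C e l (G l / (l : ℝ) ^ d) ≤ h) ∧ h ≤ M := by
  obtain ⟨a, ha⟩ : ∃ a : ℕ → ℝ, ∀ n, a n = G n / (n : ℝ) ^ d := ⟨_, fun _ => rfl⟩
  simp only [← ha]
  have hup : ∀ n, 1 ≤ n → a n ≤ M := fun n hn => by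
    have : (0 : ℝ) < n := by exact_mod_cast hn
    rw [ha, div_le_iff₀ (by positivity), mul_comm]
    exact hup n hn
  have hlo : ∀ n, 1 ≤ n → -(D + C) ≤ a n := fun n hn => by
    have : (0 : ℝ) < n := by exact_mod_cast hn
    rw [ha, le_div_iff₀ (by positivity)]
    linarith [hlo n hn]
  have hbdu : IsBoundedUnder (· ≤ ·) atTop a :=
    ⟨_, eventually_map.2 ((eventually_ge_atTop 1).mono hup)⟩
  have hbdl : IsBoundedUnder (· ≥ ·) atTop a :=
    ⟨_, eventually_map.2 ((eventually_ge_atTop 1).mono hlo)⟩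
  -- For fixed `l`, divide the superadditivity by `n ^ d` and let `n` grow; the number of cells per
  -- vertex tends to `(cellSide m l)⁻¹ ^ d`.
  have hR : ∀ l, 1 ≤ l → boxBound d m D C e l (a l) ≤ liminf a atTop := by
    intro l hl
    have hk1 : 1 ≤ cellSide m l := hl.trans (le_cellSide hm l)
    obtain ⟨b, hb⟩ : ∃ b : ℕ → ℝ, ∀ n, b n = (((n / cellSide m l : ℕ) : ℝ) / n) ^ d *
      (G l - D - e l) - (1 - (((n / cellSide m l : ℕ) : ℝ) / n) ^ d * (l : ℝ) ^ d) * (D + C) :=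
      ⟨_, fun _ => rfl⟩
    have hba : ∀ n, 1 ≤ n → b n ≤ a n := by
      intro n hn
      have hnr : (0 : ℝ) < n := by exact_mod_cast hn
      rw [ha, hb, le_div_iff₀ (by positivity), sub_mul_div_pow hn]
      exact hG n l hn hl
    have hblim : Tendsto b atTop (𝓝 (boxBound d m D C e l (a l))) := by
      have h1 : Tendsto (fun n : ℕ => (((n / cellSide m l : ℕ) : ℝ) / n) ^ d) atTop
          (𝓝 ((cellSide m l : ℝ)⁻¹ ^ d)) := (tendsto_div_div hk1).pow d
      have h2 := (h1.mul_const (G l - D - e l)).sub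
        (((h1.mul_const ((l : ℝ) ^ d)).const_sub 1).mul_const (D + C))
      rw [boxBound_div hl] at h2
      rw [ha]
      exact h2.congr fun n => (hb n).symm
    rw [← hblim.liminf_eq]
    exact liminf_le_liminf ((eventually_ge_atTop 1).mono hba) hblim.isBoundedUnder_ge
      hbdu.isCoboundedUnder_ge
  have hδ := tendsto_boxBound_sub (d := d) (D := D) (C := C) (g := a)
    (M := max M (D + C)) hm hd he (fun l hl => abs_le.2
      ⟨by have := hlo l hl; have := le_max_right M (D + C); linarith,
        (hup l hl).trans (le_max_left _ _)⟩)
  -- As `a l` exceeds its box bound by a vanishing amount and every box bound is below the lower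
  -- limit, the upper and lower limits agree.
  have hlim : Tendsto a atTop (𝓝 (liminf a atTop)) := by
    refine tendsto_of_le_liminf_of_limsup_le le_rfl ?_ hbdu hbdl
    refine le_of_forall_pos_le_add fun ε hε => ?_
    refine limsup_le_of_le hbdl.isCoboundedUnder_le ?_
    filter_upwards [hδ.eventually (gt_mem_nhds hε), eventually_ge_atTop 1] with l h1 h2
    have := hR l h2
    linarith
  exact ⟨liminf a atTop, hlim, hR, le_of_tendsto hlim ((eventually_ge_atTop 1).mono hup)⟩

/-- The specific free energy of a tame measure exists, and is bounded from below in terms of the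
free energy in any box. -/
theorem IsTameMeasure.exists_limit {K C c : ℝ} {e : ℕ → ℝ}
    (hΦ : IsPeriodicGradientPotential L Φ)
    (hμ : IsTameMeasure L Φ K C c e μ) (hK : 0 ≤ K) (hC : 0 ≤ C) (hc : 1 ≤ c) (hd : d ≠ 0)
    (he0 : ∀ l, 0 ≤ e l) (he : Tendsto (fun l : ℕ => e l / (l : ℝ) ^ d) atTop (𝓝 0))
    {m : ℕ} (hm : 1 ≤ m) (hmL : ∀ v : Site d, (m : ℤ) • v ∈ L) :
    ∃ h : ℝ, Tendsto (fun n : ℕ => realFreeEnergy Φ n μ / (n : ℝ) ^ d) atTop (𝓝 h) ∧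
      (∀ l, 1 ≤ l → boxBound d m (Real.log (2 * K + 1)) C e l (realFreeEnergy Φ l μ / (l : ℝ) ^ d)
        ≤ h) ∧ h ≤ Real.log c + C ∧ IsSpecificFreeEnergy Φ μ h := by
  have hsup : ∀ n l, 1 ≤ n → 1 ≤ l → ((n / cellSide m l : ℕ) : ℝ) ^ d *
      (realFreeEnergy Φ l μ - Real.log (2 * K + 1) - e l) -
      ((n : ℝ) ^ d - ((n / cellSide m l : ℕ) : ℝ) ^ d * (l : ℝ) ^ d) *
        (Real.log (2 * K + 1) + C) ≤ realFreeEnergy Φ n μ := by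
    intro n l hn hl
    have hlk : l ≤ cellSide m l := le_cellSide hm l
    have hLk : ∀ v ∈ tilePositions d n (cellSide m l), v ∈ L := by
      intro v hv
      simp only [tilePositions, Finset.mem_image] at hv
      obtain ⟨w, -, rfl⟩ := hv
      have := hmL (((l / m + 1 : ℕ) : ℤ) • w)
      rwa [smul_smul, ← Nat.cast_mul] at this
    have h1 := hμ.realFreeEnergy_superadditive hΦ hK hC hc hn hl hlk (he0 l) hLk
    have h2 := card_uncovered (d := d) (n := n) (hl.trans hlk) hlk
    have h3 : ((uncovered d n (cellSide m l) l).card : ℝ) =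
        (n : ℝ) ^ d - ((n / cellSide m l : ℕ) : ℝ) ^ d * (l : ℝ) ^ d := by
      rw [eq_sub_iff_add_eq]; exact_mod_cast h2
    rwa [h3] at h1
  obtain ⟨h, h1, h2, h3⟩ := exists_tendsto_of_superadditive hm hd he
    (fun n hn => hμ.realFreeEnergy_le hK hC hc hn)
    (fun n hn => hμ.realFreeEnergy_ge hΦ hK hC hc hn) hsup
  refine ⟨h, h1, h2, h3, ?_⟩
  rw [IsSpecificFreeEnergy]
  have h4 := (continuous_coe_real_ereal.tendsto _).comp h1
  refine h4.congr' ?_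
  filter_upwards [eventually_ge_atTop 1] with n hn
  rw [hμ.freeEnergy_eq hΦ hK hC hc hn, ← EReal.coe_mul, Function.comp, div_eq_inv_mul]

end Limit

/-! ## The support of measures of finite specific free energy -/

section Support

variable {d : ℕ} {L : AddSubgroup (Site d)}

theorem exists_nsmul_mem (L : AddSubgroup (Site d)) [L.FiniteIndex] :
    ∃ m : ℕ, 1 ≤ m ∧ ∀ v : Site d, (m : ℤ) • v ∈ L := by
  refine ⟨L.index, Nat.one_le_iff_ne_zero.2 AddSubgroup.FiniteIndex.index_ne_zero, fun v => ?_⟩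
  rw [natCast_zsmul]
  exact L.nsmul_index_mem v

theorem exists_bound_of_periodic [L.FiniteIndex] {F : Site d → ℝ}
    (hF : ∀ v ∈ L, ∀ x, F (x + v) = F x) : ∃ K : ℝ, 0 ≤ K ∧ ∀ x, |F x| ≤ K := by
  obtain ⟨K, hK⟩ := (Set.finite_range fun r : Site d ⧸ L => |F r.out|).bddAbove
  refine ⟨max K 0, le_max_right _ _, fun x => ?_⟩
  obtain ⟨v, hv, hx⟩ := exists_out L x
  rw [hx, hF v hv]
  exact (hK ⟨_, rfl⟩).trans (le_max_left _ _)

/-- A finite set of vertices can be moved into all large boxes by a vector of the lattice. -/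
theorem exists_translate_mem_box [L.FiniteIndex] (Λ : Finset (Site d)) :
    ∃ v ∈ L, ∃ N : ℕ, ∀ n ≥ N, ∀ x ∈ Λ, x + v ∈ box d n := by
  obtain ⟨m, hm, hmL⟩ := exists_nsmul_mem L
  obtain ⟨M, hM⟩ : ∃ M : ℕ, ∀ x ∈ Λ, ∀ j, (x j).natAbs ≤ M := by
    refine ⟨Λ.sup fun x => Finset.univ.sup fun j => (x j).natAbs, fun x hx j => ?_⟩
    exact (Finset.le_sup (f := fun j => (x j).natAbs) (Finset.mem_univ j)).trans
      (Finset.le_sup (f := fun x : Site d => Finset.univ.sup fun j => (x j).natAbs) hx)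
  refine ⟨_, hmL fun _ => (M : ℤ), m * M + M + 1, fun n hn x hx => mem_box.2 fun j => ?_⟩
  have h1 := hM x hx j
  have h2 : (M : ℤ) ≤ m * M := by exact_mod_cast Nat.le_mul_of_pos_left M hm
  have h3 : ((m * M + M + 1 : ℕ) : ℤ) ≤ n := by exact_mod_cast hn
  simp only [Pi.add_apply, Pi.smul_apply, smul_eq_mul]
  push_cast at h3
  omega

variable {E : Type} [AddCommGroup E] [MeasurableSpace E] [HeightSpace E]
  [IsRegularHeight E] {Φ Ψ Ξ : Potential d E} {A : SimpleGraph (Site d)}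
  {q : Site d → Site d → ℝ} {μ : Measure (HeightFunction d E)}

theorem measurable_toReal_gradient (x y : Site d) :
    Measurable fun φ : HeightFunction d E => HeightSpace.toReal (φ y - φ x) :=
  IsRegularHeight.measurable_toReal.comp (measurable_gradient x y)

theorem ac_of_relEntropy_ne_top {X : Type} {m : MeasurableSpace X} {μ ν : Measure X}
    (h : relEntropy μ ν ≠ ⊤) : μ ≪ ν := by
  by_contra h'
  exact h (by rw [relEntropy, if_neg fun h'' => h' h''.1])

/-- Finite entropy includes absolute continuity with respect to a measure with density `exp (-H)`,
which does not charge `{H = ∞}`. -/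
theorem ae_ne_top_of_freeEnergy (hΦ : IsPeriodicGradientPotential L Φ) {Λ : Finset (Site d)}
    {x : Site d} (h : freeEnergy Φ Λ x μ ≠ ⊤) : ∀ᵐ φ ∂μ, interiorHamiltonian Φ Λ φ ≠ ⊤ := by
  have h1 := ac_of_relEntropy_ne_top h
  have hm := hΦ.measurable_interiorHamiltonian Λ
  have hS : MeasurableSet[gradientAlgebra (Λ : Set (Site d))]
      {φ | interiorHamiltonian Φ Λ φ = ⊤} := hm (measurableSet_singleton ⊤)
  have h2 := h1 (s := {φ | interiorHamiltonian Φ Λ φ = ⊤}) (by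
    rw [withDensity_apply _ hS]
    rw [setLIntegral_congr_fun (g := fun _ => 0) hS fun φ hφ => ?_]
    · simp
    · simp only [mem_ofPred_eq] at hφ
      simp [hφ])
  rw [trim_measurableSet_eq _ hS] at h2
  simpa [ae_iff] using h2

theorem IsSpecificFreeEnergy.eventually_ne_top {h : EReal} (hh : IsSpecificFreeEnergy Φ μ h)
    (htop : h < ⊤) : ∀ᶠ n in atTop, freeEnergy Φ (box d n) 0 μ ≠ ⊤ := by
  filter_upwards [hh.eventually (gt_mem_nhds htop), eventually_ge_atTop 1] with n h1 hn h2
  rw [h2, EReal.coe_mul_top_of_pos (by positivity)] at h1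
  exact lt_irrefl _ h1

/-- Under a measure of finite specific free energy, the height functions are Lipschitz. -/
theorem ae_lipschitz [L.FiniteIndex] (hΨ : IsPeriodicGradientPotential L Ψ)
    (hΞ : IsPeriodicGradientPotential L Ξ) (hq : IsLipschitzPotential L A q Ψ)
    (hμ : IsShiftInvariant L μ) {h : EReal}
    (hh : IsSpecificFreeEnergy (Ψ + Ξ) μ h) (htop : h < ⊤) :
    ∀ᵐ φ ∂μ, ∀ x y, HeightSpace.toReal (φ y - φ x) ≤ q x y := by
  have hΦ := hΨ.add hΞ
  have hedge : ∀ x y, A.Adj x y → ∀ᵐ φ ∂μ, HeightSpace.toReal (φ y - φ x) ≤ q x y := by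
    intro x y hxy
    -- An edge may lie outside all boxes `[0,n)^d`. A lattice vector moves it inside, and shift
    -- invariance of `μ` carries the conclusion back.
    obtain ⟨v, hv, N, hN⟩ := exists_translate_mem_box (L := L) {x, y}
    obtain ⟨n, h1, h2⟩ := ((hh.eventually_ne_top htop).and (eventually_ge_atTop N)).exists
    have hx := hN n h2 x (by simp)
    have hy := hN n h2 y (by simp)
    have key : ∀ᵐ φ ∂μ, HeightSpace.toReal (shift v φ y - shift v φ x) ≤ q x y := by
      filter_upwards [ae_ne_top_of_freeEnergy hΦ h1] with φ hφ
      have h3 := hΦ.ne_top_of_interiorHamiltonian (Γ := {x + v, y + v}) (mem_subsets.2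
        ⟨by simp [Finset.insert_subset_iff, hx, hy], by simp⟩) hφ
      have h4 : Ψ {x + v, y + v} φ ≠ ⊤ := fun h5 => h3 (by
        rw [Pi.add_apply, Pi.add_apply, h5, EReal.top_add_of_ne_bot (hΞ.ne_bot _ _)])
      by_contra! h5
      refine h4 ((hq.2 _ _).2 ⟨x + v, y + v, rfl, (hq.1.graph.periodic v hv x y).2 hxy, ?_⟩)
      rw [hq.1.quasimetric.periodic v hv]
      exact h5
    have hP : MeasurableSet {φ : HeightFunction d E | HeightSpace.toReal (φ y - φ x) ≤ q x y} :=
      measurable_toReal_gradient x y measurableSet_Iic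
    have := (ae_map_iff (μ := μ) (measurable_shift v).aemeasurable hP).2 key
    rwa [hμ v hv] at this
  have hall : ∀ᵐ φ ∂μ, ∀ x y, A.Adj x y → HeightSpace.toReal (φ y - φ x) ≤ q x y := by
    rw [ae_all_iff]; intro x
    rw [ae_all_iff]; intro y
    by_cases hxy : A.Adj x y
    · filter_upwards [hedge x y hxy] with φ hφ _ using hφ
    · exact Eventually.of_forall fun φ h => absurd h hxy
  filter_upwards [hall] with φ hφ x y
  rw [map_sub]
  exact hq.1.le_of_edges (g := fun x => HeightSpace.toReal (φ x))
    (fun x y hxy => by rw [← map_sub]; exact hφ x y hxy) x y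

theorem HasSlope.mem_slopeSet [IsProbabilityMeasure μ] {u : Slope d} (hu : HasSlope L μ u)
    (hμ : ∀ᵐ φ ∂μ, ∀ x y, HeightSpace.toReal (φ y - φ x) ≤ q x y) : u ∈ slopeSet L q := by
  intro x hx y hy
  rw [hu.2 x hx, hu.2 y hy, ← integral_sub (hu.1 _ _) (hu.1 _ _)]
  have h1 : ∫ φ, HeightSpace.toReal (φ y - φ x) ∂μ ≤ ∫ _, q x y ∂μ :=
    integral_mono_ae (hu.1 _ _) (integrable_const _) (hμ.mono fun φ hφ => hφ x y)
  simp only [integral_const, probReal_univ, smul_eq_mul, one_mul] at h1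
  refine le_of_eq_of_le (integral_congr_ae (Eventually.of_forall fun φ => ?_)) h1
  simp only [map_sub]
  ring

/-- The slope prescribes means of increments from the origin only. The increment from `a` differs
from the one from `0` by a function minus its shift by `w`, which has mean zero. The tight pairs
below may start outside the lattice. -/
theorem HasSlope.integral_sub_eq {u : Slope d} (hu : HasSlope L μ u) (hμ : IsShiftInvariant L μ)
    (a : Site d) {w : Site d} (hw : w ∈ L) :
    ∫ φ, HeightSpace.toReal (φ (a + w) - φ a) ∂μ = u (toVec w) := by
  have h1 : ∀ φ : HeightFunction d E, HeightSpace.toReal (φ (a + w) - φ a) =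
      HeightSpace.toReal (shift w φ a - shift w φ 0) - HeightSpace.toReal (φ a - φ 0) +
        HeightSpace.toReal (φ w - φ 0) := fun φ => by
    simp only [shift, zero_add, map_sub]
    ring
  have h2 := hμ.integrable_comp hw (hu.1 0 a)
  rw [integral_congr_ae (Eventually.of_forall h1),
    integral_add (f := fun φ : HeightFunction d E => HeightSpace.toReal (shift w φ a - shift w φ 0) -
      HeightSpace.toReal (φ a - φ 0)) (h2.sub (hu.1 0 a)) (hu.1 0 w),
    integral_sub h2 (hu.1 0 a),
    hμ.integral_comp hw (measurable_toReal_gradient 0 a), sub_self, zero_add, hu.2 w hw]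

theorem exists_step_bound [L.FiniteIndex] (hq : ∀ v ∈ L, ∀ x y, q (x + v) (y + v) = q x y) :
    ∃ K : ℝ, 0 ≤ K ∧ ∀ φ : HeightFunction d E, (∀ x y, HeightSpace.toReal (φ y - φ x) ≤ q x y) →
      ∀ (x : Site d) (j : Fin d), |HeightSpace.toReal (φ (x + Pi.single j 1) - φ x)| ≤ K := by
  obtain ⟨K, hK, hK'⟩ := exists_bound_of_periodic (L := L)
    (F := fun x => ∑ j, (|q x (x + Pi.single j 1)| + |q (x + Pi.single j 1) x|)) fun v hv x =>
    Finset.sum_congr rfl fun j _ => by rw [add_right_comm x v, hq v hv, hq v hv]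
  refine ⟨K, hK, fun φ hφ x j => ?_⟩
  have h1 := (le_abs_self _).trans (hK' x)
  have h2 := Finset.single_le_sum (f := fun j => |q x (x + Pi.single j 1)| +
    |q (x + Pi.single j 1) x|) (fun j _ => by positivity) (Finset.mem_univ j)
  have h3 := hφ x (x + Pi.single j 1)
  have h4 := hφ (x + Pi.single j 1) x
  rw [← neg_sub, map_neg] at h4
  have h5 := le_abs_self (q x (x + Pi.single j 1))
  have h6 := le_abs_self (q (x + Pi.single j 1) x)
  have h7 := abs_nonneg (q x (x + Pi.single j 1))
  have h8 := abs_nonneg (q (x + Pi.single j 1) x)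
  beta_reduce at h1 h2
  rw [abs_le]
  constructor <;> linarith

/-- Real bounds for the interactions at a vertex, for a summable potential. -/
theorem IsSummable.exists_bound (hΞ : IsSummable Ξ) :
    ∃ C : ℝ, 0 ≤ C ∧ ∀ φ x, strength Ξ φ (x ∈ ·) ≤ ENNReal.ofReal C := by
  refine ⟨(⨆ (x : Site d) (φ : HeightFunction d E),
    ∑' Λ : {Λ : Finset (Site d) // x ∈ Λ}, (Ξ Λ.1 φ).abs).toReal, ENNReal.toReal_nonneg,
    fun φ x => ?_⟩
  rw [ENNReal.ofReal_toReal (ne_of_lt hΞ)]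
  exact le_iSup₂_of_le x φ le_rfl

end Support

/-! ## The interactions between a box and its complement -/

section Crossing

variable {d : ℕ}

theorem ereal_abs_add_le (a b : EReal) : (a + b).abs ≤ a.abs + b.abs := by
  induction a with
  | bot => simp
  | top => simp
  | coe a =>
    induction b with
    | bot => simp
    | top => simp
    | coe b =>
      rw [← EReal.coe_add, EReal.abs_def, EReal.abs_def, EReal.abs_def,
        ← ENNReal.ofReal_add (abs_nonneg _) (abs_nonneg _)]
      exact ENNReal.ofReal_le_ofReal (abs_add_le a b)

theorem ereal_abs_of_nonneg {a : EReal} (h : 0 ≤ a) : a.abs = a.toENNReal := by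
  induction a with
  | bot => simp at h
  | top => simp
  | coe a => rw [EReal.abs_def, EReal.toENNReal_of_ne_top (EReal.coe_ne_top _), EReal.toReal_coe,
      abs_of_nonneg (EReal.coe_nonneg.1 h)]

theorem abs_toInt_sub_le_d1 (x y : Site d) (j : Fin d) : |x j - y j| ≤ d1 x y := by
  rw [Int.abs_eq_natAbs, d1]
  exact_mod_cast Finset.single_le_sum (f := fun i => (x i - y i).natAbs) (fun i _ => Nat.zero_le _)
    (Finset.mem_univ j)

section Strength

variable {E : Type} {Φ Ψ Ξ : Potential d E} {φ : HeightFunction d E}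

theorem strength_add_le (Ψ Ξ : Potential d E) (φ : HeightFunction d E)
    (p : Finset (Site d) → Prop) :
    strength (Ψ + Ξ) φ p ≤ strength Ψ φ p + strength Ξ φ p := by
  rw [strength, strength, strength, ← ENNReal.tsum_add]
  exact ENNReal.tsum_le_tsum fun Γ => ereal_abs_add_le _ _

theorem strength_le_sum {p : Finset (Site d) → Prop} {U : Finset (Site d)}
    (h : ∀ Γ, p Γ → Φ Γ φ ≠ 0 → ∃ x ∈ U, x ∈ Γ) :
    strength Φ φ p ≤ ∑ x ∈ U, strength Φ φ (x ∈ ·) := by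
  have h1 : ∀ p : Finset (Site d) → Prop,
      strength Φ φ p = ∑' Γ, {Γ | p Γ}.indicator (fun Γ => (Φ Γ φ).abs) Γ := fun p =>
    tsum_subtype {Γ | p Γ} fun Γ => (Φ Γ φ).abs
  simp only [h1]
  rw [← Summable.tsum_finsetSum fun _ _ => ENNReal.summable]
  refine ENNReal.tsum_le_tsum fun Γ => ?_
  by_cases hΓ : p Γ
  swap
  · rw [indicator_of_notMem (s := {Γ | p Γ}) hΓ]
    exact zero_le
  rw [indicator_of_mem (s := {Γ | p Γ}) hΓ]
  by_cases h0 : Φ Γ φ = 0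
  · simp [h0]
  · obtain ⟨x, hx, hxΓ⟩ := h Γ hΓ h0
    refine le_trans (le_of_eq ?_) (Finset.single_le_sum
      (f := fun x => {Γ : Finset (Site d) | x ∈ Γ}.indicator (fun Γ => (Φ Γ φ).abs) Γ)
      (fun _ _ => zero_le) hx)
    exact (indicator_of_mem (s := {Γ : Finset (Site d) | x ∈ Γ}) hxΓ
      (fun Γ => (Φ Γ φ).abs)).symm

theorem strength_crosses_le (Ξ : Potential d E) (φ : HeightFunction d E) (Λ : Finset (Site d)) :
    strength Ξ φ (Crosses Λ) ≤ lowerExteriorBound Ξ Λ :=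
  le_iSup (fun φ : HeightFunction d E =>
    ∑' Δ : {Δ : Finset (Site d) // (∃ x ∈ Δ, x ∈ Λ) ∧ ∃ y ∈ Δ, y ∉ Λ}, (Ξ Δ.1 φ).abs) φ

/-- An interaction of range `R` crossing the boundary of a box cannot meet the concentric box of
side `l - 2 * R`, so it meets the shell between them. Truncated subtraction covers small `l`. -/
theorem strength_crosses_box_le {R : ℕ}
    (hR : ∀ Λ : Finset (Site d), (∃ x ∈ Λ, ∃ y ∈ Λ, R < d1 x y) → ∀ φ, Ψ Λ φ = 0) {C : ℝ}
    (hC : ∀ x, strength Ψ φ (x ∈ ·) ≤ ENNReal.ofReal C) (v : Site d) (l : ℕ) :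
    strength Ψ φ (Crosses (translate v (box d l))) ≤
      ENNReal.ofReal (((l : ℝ) ^ d - ((l - 2 * R : ℕ) : ℝ) ^ d) * C) := by
  set W := translate (v + fun _ => (R : ℤ)) (box d (l - 2 * R)) with hW
  have hWs : W ⊆ translate v (box d l) := by
    intro x hx
    rw [hW, mem_translate, mem_box] at hx
    rw [mem_translate, mem_box]
    intro j
    have := hx j
    simp only [Pi.sub_apply, Pi.add_apply] at this ⊢
    omega
  have h1 := strength_le_sum (Φ := Ψ) (φ := φ) (p := Crosses (translate v (box d l)))
    (U := translate v (box d l) \ W) (fun Γ hΓ h0 => by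
      obtain ⟨⟨x, hx, hx'⟩, y, hy, hy'⟩ := hΓ
      refine ⟨x, Finset.mem_sdiff.2 ⟨hx', fun hxW => hy' ?_⟩, hx⟩
      have h2 : d1 x y ≤ R := by
        by_contra! h2
        exact h0 (hR Γ ⟨x, hx, y, hy, h2⟩ φ)
      rw [hW, mem_translate, mem_box] at hxW
      rw [mem_translate, mem_box]
      intro j
      have h3 := hxW j
      have h4 := abs_le.1 (abs_toInt_sub_le_d1 x y j)
      simp only [Pi.sub_apply, Pi.add_apply] at h3 ⊢
      omega)
  refine h1.trans ((Finset.sum_le_sum fun x _ => hC x).trans (le_of_eq ?_))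
  rw [Finset.sum_const, nsmul_eq_mul, Finset.card_sdiff_of_subset hWs, hW, card_translate,
    card_translate, card_box, card_box, ENNReal.ofReal_mul]
  · rw [← Nat.cast_pow, ← Nat.cast_pow, ← Nat.cast_sub (by gcongr; omega), ENNReal.ofReal_natCast]
  · rw [sub_nonneg]
    gcongr
    omega

/-- A bound for the interactions between a box and its complement. -/
noncomputable def crossBound (Ξ : Potential d E) (R : ℕ) (C : ℝ) (l : ℕ) : ℝ :=
  (lowerExteriorBound Ξ (box d l)).toReal + ((l : ℝ) ^ d - ((l - 2 * R : ℕ) : ℝ) ^ d) * C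

theorem crossBound_nonneg (Ξ : Potential d E) (R : ℕ) {C : ℝ} (hC : 0 ≤ C) (l : ℕ) :
    0 ≤ crossBound Ξ R C l := by
  have : 0 ≤ (l : ℝ) ^ d - ((l - 2 * R : ℕ) : ℝ) ^ d := by
    rw [sub_nonneg]
    gcongr
    omega
  rw [crossBound]
  positivity

end Strength

theorem tendsto_natCast_sub_div (r : ℕ) :
    Tendsto (fun l : ℕ => ((l - r : ℕ) : ℝ) / l) atTop (𝓝 1) := by
  have h1 : Tendsto (fun l : ℕ => 1 - (r : ℝ) / l) atTop (𝓝 1) := by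
    simpa using (tendsto_const_div_atTop_nhds_zero_nat (r : ℝ)).const_sub 1
  refine h1.congr' ?_
  filter_upwards [eventually_ge_atTop r, eventually_ge_atTop 1] with l h1 h2
  have : (l : ℝ) ≠ 0 := by positivity
  rw [Nat.cast_sub h1]
  field_simp

theorem isVanHove_box (hd : d ≠ 0) : IsVanHove (fun n => box d n) := by
  constructor
  · simp only [card_box]
    exact tendsto_pow_atTop hd
  · have h1 : Tendsto (fun n : ℕ => (((n : ℝ) + 2) / n) ^ d - 1) atTop (𝓝 0) := by
      have h2 : Tendsto (fun n : ℕ => 1 + (2 : ℝ) / n) atTop (𝓝 1) := by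
        simpa using (tendsto_const_div_atTop_nhds_zero_nat (2 : ℝ)).const_add 1
      have h3 := (h2.pow d).sub_const 1
      rw [one_pow, sub_self] at h3
      refine h3.congr' ((eventually_ge_atTop 1).mono fun n hn => ?_)
      have : (n : ℝ) ≠ 0 := by positivity
      simp only
      congr 2
      field_simp
    refine tendsto_of_tendsto_of_tendsto_of_le_of_le' tendsto_const_nhds h1
      (Eventually.of_forall fun n => by positivity) ((eventually_ge_atTop 1).mono fun n hn => ?_)
    have hsub : outerBoundary (box d n) ⊆
        ↑(translate (fun _ => (-1 : ℤ)) (box d (n + 2)) \ box d n) := by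
      rintro y ⟨hy, x, hx, hxy⟩
      rw [Finset.mem_coe, Finset.mem_sdiff]
      refine ⟨?_, hy⟩
      rw [mem_translate, mem_box]
      intro j
      have h2 := mem_box.1 hx j
      have h3 := abs_le.1 (abs_toInt_sub_le_d1 x y j)
      rw [hxy] at h3
      simp only [Pi.sub_apply]
      push_cast at h3 ⊢
      omega
    have hsub' : box d n ⊆ translate (fun _ => (-1 : ℤ)) (box d (n + 2)) := by
      intro x hx
      rw [mem_translate, mem_box]
      intro j
      have h2 := mem_box.1 hx j
      simp only [Pi.sub_apply]
      push_cast
      omega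
    have h4 := Set.ncard_le_ncard hsub (Finset.finite_toSet _)
    rw [Set.ncard_coe_finset, Finset.card_sdiff_of_subset hsub', card_translate, card_box,
      card_box] at h4
    have hn' : (0 : ℝ) < (n : ℝ) ^ d := by positivity
    rw [card_box, div_le_iff₀ (by exact_mod_cast hn'), div_pow]
    have h5 : ((outerBoundary (box d n)).ncard : ℝ) ≤ (((n + 2) ^ d - n ^ d : ℕ) : ℝ) := by
      exact_mod_cast h4
    rw [Nat.cast_sub (by gcongr; omega)] at h5
    push_cast at h5 ⊢
    refine h5.trans (le_of_eq ?_)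
    field_simp

theorem tendsto_crossBound {E : Type} {Ξ : Potential d E} {L : AddSubgroup (Site d)} (hd : d ≠ 0)
    (hΞ : IsAmenable L (lowerExteriorBound Ξ)) (R : ℕ) (C : ℝ) :
    Tendsto (fun l : ℕ => crossBound Ξ R C l / (l : ℝ) ^ d) atTop (𝓝 0) := by
  have h1 := (ENNReal.tendsto_toReal ENNReal.zero_ne_top).comp
    (hΞ.vanHove _ (isVanHove_box (d := d) hd))
  have h2 := ((((tendsto_natCast_sub_div (2 * R)).pow d).const_sub 1).mul_const C)
  rw [one_pow, sub_self, zero_mul] at h2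
  have h3 := h1.add h2
  rw [ENNReal.toReal_zero, add_zero] at h3
  refine h3.congr' ((eventually_ge_atTop 1).mono fun l hl => ?_)
  have hl' : (l : ℝ) ^ d ≠ 0 := by positivity
  simp only [Function.comp, crossBound]
  rw [card_box, ENNReal.toReal_div, ENNReal.toReal_natCast, div_pow]
  push_cast
  field_simp

/-- Lipschitz functions at which the strong interaction is bounded are tame. -/
theorem isTame_of_strength_le {E : Type} [AddCommGroup E] [MeasurableSpace E] [HeightSpace E]
    {Ψ Ξ : Potential d E} {L : AddSubgroup (Site d)} {K C C' : ℝ} {R : ℕ}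
    (hC : 0 ≤ C) (hC0 : 0 ≤ C')
    (hR : ∀ Λ : Finset (Site d), (∃ x ∈ Λ, ∃ y ∈ Λ, R < d1 x y) → ∀ φ, Ψ Λ φ = 0)
    (hΞ : IsAmenable L (lowerExteriorBound Ξ))
    (hC' : ∀ φ x, strength Ξ φ (x ∈ ·) ≤ ENNReal.ofReal C')
    {φ : HeightFunction d E} (hφ : ∀ x, strength Ψ φ (x ∈ ·) ≤ ENNReal.ofReal C)
    (hstep : ∀ (x : Site d) (j : Fin d), |HeightSpace.toReal (φ (x + Pi.single j 1) - φ x)| ≤ K) :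
    IsTame L (Ψ + Ξ) K (C + C') (crossBound Ξ R C) φ where
  step := hstep
  strength_le x := (strength_add_le Ψ Ξ φ _).trans (by
    rw [ENNReal.ofReal_add hC hC0]
    exact add_le_add (hφ x) (hC' φ x))
  cross_le v hv l := (strength_add_le Ψ Ξ φ _).trans (by
    rw [crossBound, add_comm, ENNReal.ofReal_add ENNReal.toReal_nonneg,
      ENNReal.ofReal_toReal (hΞ.finite _)]
    · refine add_le_add ?_ (strength_crosses_box_le hR hφ v l)
      rw [← hΞ.periodic v hv]
      exact strength_crosses_le Ξ φ _
    · refine mul_nonneg ?_ hC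
      rw [sub_nonneg]
      gcongr
      omega)

end Crossing

/-! ## Measures of finite specific free energy with a given slope, for real heights -/

section Perturbation

theorem lmarginal_le_of_le_smul {δ : Type*} [DecidableEq δ] {X : Type*} [MeasurableSpace X]
    {μ ν : Measure X} [SigmaFinite μ] [SigmaFinite ν] {c : ℝ≥0∞} (h : ν ≤ c • μ)
    {F : (δ → X) → ℝ≥0∞} (hF : Measurable F) (s : Finset δ) (φ : δ → X) :
    (∫⋯∫⁻_s, F ∂fun _ => ν) φ ≤ c ^ s.card * (∫⋯∫⁻_s, F ∂fun _ => μ) φ := by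
  induction s using Finset.induction_on generalizing φ with
  | empty => simp
  | insert i s hi ih =>
    rw [lmarginal_insert _ hF hi, lmarginal_insert _ hF hi, Finset.card_insert_of_notMem hi,
      pow_succ', mul_assoc]
    have hm : Measurable fun x => (∫⋯∫⁻_s, F ∂fun _ => μ) (Function.update φ i x) :=
      (hF.lmarginal _).comp (measurable_update φ)
    rw [← lintegral_const_mul _ hm, ← smul_eq_mul, ← lintegral_smul_measure]
    exact (lintegral_mono fun x => ih _).trans (lintegral_mono' h le_rfl)

/-- The uniform distribution on `[0, δ]`. -/
noncomputable def unif (δ : ℝ) : Measure ℝ := ENNReal.ofReal δ⁻¹ • volume.restrict (Icc 0 δ)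

theorem isProbabilityMeasure_unif {δ : ℝ} (hδ : 0 < δ) : IsProbabilityMeasure (unif δ) := ⟨by
  rw [unif, Measure.smul_apply, Measure.restrict_apply_univ, Real.volume_Icc, sub_zero,
    smul_eq_mul, ← ENNReal.ofReal_mul (by positivity), inv_mul_cancel₀ hδ.ne', ENNReal.ofReal_one]⟩

theorem unif_le (δ : ℝ) : unif δ ≤ ENNReal.ofReal δ⁻¹ • volume := by
  rw [unif]
  gcongr
  exact Measure.restrict_le_self

theorem ae_unif (δ : ℝ) : ∀ᵐ t ∂unif δ, t ∈ Icc 0 δ :=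
  Measure.ae_smul_measure (ae_restrict_mem measurableSet_Icc) _

/-- Laws on `Ω` record only gradients, so random height functions that differ by a random constant
have the same law. -/
theorem map_eq_of_gradient_eq {d : ℕ} {E : Type} [AddCommGroup E] [MeasurableSpace E]
    {X : Type*} [MeasurableSpace X] {P : Measure X} {g g' : X → HeightFunction d E}
    (hg : Measurable g) (hg' : Measurable g') (h : ∀ a x y, g a y - g a x = g' a y - g' a x) :
    P.map g = P.map g' := by
  ext S hS
  rw [Measure.map_apply hg hS, Measure.map_apply hg' hS]
  congr 1
  ext a
  exact ⟨mem_of_gradient_eq hS fun x _ y _ => h a x y,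
    mem_of_gradient_eq hS fun x _ y _ => (h a x y).symm⟩

variable {d : ℕ}

/-- The function `f` with independent uniform perturbations. -/
noncomputable def perturbation (f : Site d → ℝ) (ξ : Site d → ℝ) : HeightFunction d ℝ :=
  fun x => ξ x + f x

variable {f : Site d → ℝ} {δ : ℝ}

theorem measurable_perturbation (f : Site d → ℝ) : Measurable (perturbation f) :=
  measurable_gradientAlgebra fun x _ y _ =>
    ((measurable_pi_apply y).add_const _).sub ((measurable_pi_apply x).add_const _)

/-- The law of the perturbation of `f`. -/
noncomputable def perturbedLaw (f : Site d → ℝ) (δ : ℝ) : Measure (HeightFunction d ℝ) :=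
  (Measure.infinitePi fun _ => unif δ).map (perturbation f)

theorem isProbabilityMeasure_perturbedLaw (hδ : 0 < δ) :
    IsProbabilityMeasure (perturbedLaw f δ) :=
  have := isProbabilityMeasure_unif hδ
  Measure.isProbabilityMeasure_map (measurable_perturbation f).aemeasurable

theorem ae_infinitePi_unif (hδ : 0 < δ) :
    ∀ᵐ ξ ∂Measure.infinitePi fun _ : Site d => unif δ, ∀ x, ξ x ∈ Icc 0 δ := by
  have := isProbabilityMeasure_unif hδ
  rw [ae_all_iff]
  intro x
  exact (measurePreserving_eval_infinitePi (fun _ : Site d => unif δ) x).quasiMeasurePreserving.ae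
    (ae_unif δ)

/-- Translating `f` by `v` adds the constant `u v`, invisible to gradients, and independent
identically distributed noise is shift invariant. -/
theorem isShiftInvariant_perturbedLaw {L : AddSubgroup (Site d)} {u : Slope d} (hδ : 0 < δ)
    (hf : ∀ x, ∀ v ∈ L, f (x + v) = f x + u (toVec v)) :
    IsShiftInvariant L (perturbedLaw f δ) := by
  have := isProbabilityMeasure_unif hδ
  intro v hv
  have h1 : (Measure.infinitePi fun _ : Site d => unif δ).map (fun ξ x => ξ (x + v)) =
      Measure.infinitePi fun _ : Site d => unif δ :=
    Measure.map_infinitePi_infinitePi_of_inj (add_left_injective v)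
  have hm : Measurable fun (ξ : Site d → ℝ) x => ξ (x + v) := by fun_prop
  rw [perturbedLaw, Measure.map_map (measurable_shift v) (measurable_perturbation f)]
  conv_rhs => rw [← h1, Measure.map_map (measurable_perturbation f) hm]
  refine map_eq_of_gradient_eq ((measurable_shift v).comp (measurable_perturbation f))
    ((measurable_perturbation f).comp hm) fun ξ x y => ?_
  simp only [Function.comp, shift, perturbation, hf _ v hv]
  ring

/-- Noise in `[0, δ]` raises a height difference by at most `δ`. Passing through this measurable
event allows an arbitrary predicate `p`. -/
theorem ae_perturbedLaw (hδ : 0 < δ) {p : HeightFunction d ℝ → Prop}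
    (h : ∀ φ : HeightFunction d ℝ, (∀ x y, φ y - φ x ≤ f y - f x + δ) → p φ) :
    ∀ᵐ φ ∂perturbedLaw f δ, p φ := by
  have hS : MeasurableSet {φ : HeightFunction d ℝ | ∀ x y, φ y - φ x ≤ f y - f x + δ} := by
    simp only [Set.ofPred_forall]
    exact MeasurableSet.iInter fun x => MeasurableSet.iInter fun y =>
      measurable_gradient x y measurableSet_Iic
  have h1 : ∀ᵐ φ ∂perturbedLaw f δ, ∀ x y, φ y - φ x ≤ f y - f x + δ := by
    rw [perturbedLaw, ae_map_iff (measurable_perturbation f).aemeasurable hS]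
    filter_upwards [ae_infinitePi_unif hδ] with ξ hξ x y
    have hx := hξ x
    have hy := hξ y
    simp only [perturbation]
    linarith [hx.1, hy.2]
  exact h1.mono h

theorem hasSlope_perturbedLaw {L : AddSubgroup (Site d)} {u : Slope d} (hδ : 0 < δ)
    (hf : ∀ x, ∀ v ∈ L, f (x + v) = f x + u (toVec v)) : HasSlope L (perturbedLaw f δ) u := by
  have := isProbabilityMeasure_unif hδ
  have := isProbabilityMeasure_perturbedLaw (f := f) hδ
  refine ⟨fun x y => ?_, fun x hx => ?_⟩
  · refine Integrable.mono' (integrable_const (|f y - f x| + δ))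
      (measurable_toReal_gradient x y).aestronglyMeasurable
      (ae_perturbedLaw hδ fun φ hφ => ?_)
    have h1 := hφ x y
    have h2 := hφ y x
    have h3 := abs_le.1 (le_refl |f y - f x|)
    change |φ y - φ x| ≤ _
    rw [abs_le]
    constructor <;> linarith [h3.1, h3.2]
  · have hint : ∀ x : Site d, Integrable (fun ξ : Site d → ℝ => ξ x)
        (Measure.infinitePi fun _ => unif δ) := fun x =>
      Integrable.mono' (integrable_const δ) (measurable_pi_apply x).aestronglyMeasurable
        ((ae_infinitePi_unif hδ).mono fun ξ hξ => by
          rw [Real.norm_eq_abs, abs_of_nonneg (hξ x).1]; exact (hξ x).2)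
    have heq : ∀ x : Site d, ∫ ξ : Site d → ℝ, ξ x ∂(Measure.infinitePi fun _ => unif δ) =
        ∫ t, t ∂unif δ := fun x => by
      have h := integral_map (φ := Function.eval x) (μ := Measure.infinitePi fun _ : Site d => unif δ)
        (f := fun t : ℝ => t) (measurable_pi_apply x).aemeasurable
        measurable_id.aestronglyMeasurable
      rw [(measurePreserving_eval_infinitePi (fun _ : Site d => unif δ) x).map_eq] at h
      exact h.symm
    rw [perturbedLaw, integral_map (measurable_perturbation f).aemeasurable
      (measurable_toReal_gradient 0 x).aestronglyMeasurable]
    have h1 : ∀ ξ : Site d → ℝ, HeightSpace.toReal (perturbation f ξ x - perturbation f ξ 0) =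
        ξ x - ξ 0 + u (toVec x) := fun ξ => by
      have h2 := hf 0 x hx
      rw [zero_add] at h2
      change (ξ x + f x) - (ξ 0 + f 0) = _
      linarith
    rw [integral_congr_ae (Eventually.of_forall h1), integral_add
      (f := fun ξ : Site d → ℝ => ξ x - ξ 0) ((hint x).sub (hint 0))
      (integrable_const _), integral_sub (hint x) (hint 0), heq, heq]
    simp

/-- Given the height at the origin, each of the other `n ^ d - 1` heights in the box has density at
most `δ⁻¹`. The maximum with one allows the exponent to be rounded up to `n ^ d`. -/
theorem perturbedLaw_trim_le (hδ : 0 < δ) {n : ℕ} (hn : 1 ≤ n) :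
    (perturbedLaw f δ).trim (gradientAlgebra_le (box d n : Set (Site d))) ≤
      ENNReal.ofReal ((max 1 δ⁻¹) ^ n ^ d) • gradientRef (box d n) 0 := by
  have := isProbabilityMeasure_unif hδ
  rw [Measure.le_iff]
  intro S hS
  have hS' := gradientAlgebra_le (E := ℝ) (box d n : Set (Site d)) S hS
  rw [trim_measurableSet_eq _ hS, perturbedLaw, Measure.map_apply (measurable_perturbation f) hS']
  set F : (Site d → ℝ) → ℝ≥0∞ := fun ξ => S.indicator 1 (ξ + f) with hF
  have hSm : Measurable[gradientAlgebra (box d n : Set (Site d))]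
      (S.indicator (1 : HeightFunction d ℝ → ℝ≥0∞)) := by
    exact Measurable.indicator measurable_const hS
  have hFm : Measurable F := ((measurable_one.indicator hS').comp measurable_of_pi).comp
    (measurable_id.add_const f)
  have hbox : ∀ ξ, F (Function.updateFinset 0 (box d n) ((box d n).restrict ξ)) = F ξ := by
    intro ξ
    refine eq_of_gradient_eq hSm fun x hx y hy => ?_
    simp only [Finset.mem_coe] at hx hy
    simp [Function.updateFinset, hx, hy]
  have h1 : (Measure.infinitePi fun _ => unif δ) (perturbation f ⁻¹' S) =
      (∫⋯∫⁻_box d n, F ∂fun _ => unif δ) 0 := by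
    rw [lmarginal, ← lintegral_restrict_infinitePi (μ := fun _ : Site d => unif δ)
      (f := fun y => F (Function.updateFinset 0 (box d n) y)) (hFm.comp measurable_updateFinset)]
    simp only [hbox]
    rw [← lintegral_indicator_one (measurable_perturbation f hS')]
    rfl
  have hle : unif δ ≤ ENNReal.ofReal (max 1 δ⁻¹) • (HeightSpace.ref : Measure ℝ) :=
    (unif_le δ).trans (by
      change _ ≤ ENNReal.ofReal (max 1 δ⁻¹) • volume
      gcongr
      exact le_max_right _ _)
  have : SigmaFinite (HeightSpace.ref : Measure ℝ) := IsRegularHeight.sigmaFinite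
  have h0 := zero_mem_box (d := d) hn
  rw [h1, lmarginal_erase _ hFm h0]
  refine (lintegral_mono fun t => lmarginal_le_of_le_smul hle hFm _ _).trans ?_
  simp only [hF, lmarginal_gradient h0 hSm f]
  rw [lintegral_const, measure_univ, mul_one, lintegral_indicator_one hS, Measure.smul_apply,
    smul_eq_mul, ENNReal.ofReal_pow (by positivity)]
  gcongr
  · exact ENNReal.one_le_ofReal.2 (le_max_left _ _)
  · rw [← card_box d n]
    exact Finset.card_le_card (Finset.erase_subset _ _)

end Perturbation

/-! ### Finiteness of the surface tension at interior slopes, for real heights -/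

section Interior

variable {d : ℕ} {L : AddSubgroup (Site d)} {A : SimpleGraph (Site d)}
  {q : Site d → Site d → ℝ} {Ψ Ξ : Potential d ℝ}

/-- The room `c` below `q` is split into `ε`, spent on passing to `q_ε`, and `c - ε`, spent on the
noise. The noisy function is `q_ε`-Lipschitz, and taking `ε = min c η / 2` below `η` makes local
boundedness of `Ψ` apply, so its law is tame. -/
theorem surfaceTension_lt_top_of_mem_interior [L.FiniteIndex] (hd : d ≠ 0)
    (hΨ : IsStrongInteractionReal L A q Ψ) (hΞ : IsWeakInteraction L Ξ) {u : Slope d}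
    (hu : u ∈ interior (slopeSet L q)) : surfaceTension L (Ψ + Ξ) u < ⊤ := by
  have hq := hΨ.lipschitz.1
  obtain ⟨c, hc, f, hf, hfA⟩ := exists_strict_equivariant hq hu
  obtain ⟨η, hη, hη'⟩ := hΨ.locallyBounded
  have hε : 0 < min c η / 2 := by positivity
  have hεc : min c η / 2 < c := by linarith [min_le_left c η]
  have hεη : min c η / 2 < η := by linarith [min_le_right c η]
  obtain ⟨p, hp, hfp⟩ := exists_shrunk hq hεc hfA
  obtain ⟨C, hC⟩ := hη' _ hε hεη p hp
  have hδ : 0 < c - min c η / 2 := by linarith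
  have hpq : ∀ x y, p x y ≤ q x y := hq.maximal p hp.1.1 fun x y hxy => by
    linarith [hp.1.2 x y hxy]
  obtain ⟨K, hK, hstep⟩ := exists_step_bound (E := ℝ) hq.quasimetric.periodic
  obtain ⟨C', hC'0, hC'⟩ := hΞ.summable.exists_bound
  obtain ⟨R, hR⟩ := hΨ.finiteRange
  obtain ⟨m, hm, hmL⟩ := exists_nsmul_mem L
  have hC0 : 0 ≤ max C 0 := le_max_right _ _
  have hμ : IsTameMeasure L (Ψ + Ξ) K (max C 0 + C') (max 1 (c - min c η / 2)⁻¹)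
      (crossBound Ξ R (max C 0)) (perturbedLaw f (c - min c η / 2)) := by
    refine ⟨isProbabilityMeasure_perturbedLaw hδ, isShiftInvariant_perturbedLaw hδ hf,
      ae_perturbedLaw hδ fun φ hφ => ?_, fun n hn => perturbedLaw_trim_le hδ hn⟩
    have hφp : ∀ x y, φ y - φ x ≤ p x y := by
      intro x y
      by_cases hxy : x = y
      · rw [hxy, sub_self, hp.1.1.self]
      · linarith [hφ x y, hfp x y hxy]
    refine isTame_of_strength_le hC0 hC'0 hR hΞ.amenable hC' (fun x => ?_)
      (hstep φ fun x y => (hφp x y).trans (hpq x y))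
    refine le_trans (le_of_eq ?_) ((hC x φ fun y _ => ⟨hφp x y, hφp y x⟩).trans
      (ENNReal.ofReal_le_ofReal (le_max_left _ _)))
    exact tsum_congr fun Γ => ereal_abs_of_nonneg (hΨ.positive _ _)
  obtain ⟨h, -, -, -, hh⟩ := hμ.exists_limit (hΨ.potential.add hΞ.potential) hK
    (by positivity) (le_max_left _ _) hd (crossBound_nonneg Ξ R hC0)
    (tendsto_crossBound hd hΞ.amenable R _) hm hmL
  refine lt_of_le_of_lt (sInf_le ⟨_, hμ.prob, hμ.inv, hasSlope_perturbedLaw hδ hf, hh⟩)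
    (EReal.coe_lt_top h)

end Interior

/-! ### Identification of the allowable slopes -/

section Allowable

variable {d : ℕ} {E : Type} [AddCommGroup E] [MeasurableSpace E] [HeightSpace E]
  [IsRegularHeight E] {L : AddSubgroup (Site d)} {A : SimpleGraph (Site d)}
  {q : Site d → Site d → ℝ} {Ψ Ξ : Potential d E}

theorem mem_slopeSet_of_surfaceTension_lt_top [L.FiniteIndex]
    (hΨ : IsPeriodicGradientPotential L Ψ) (hΞ : IsPeriodicGradientPotential L Ξ)
    (hq : IsLipschitzPotential L A q Ψ) {u : Slope d}
    (hu : surfaceTension L (Ψ + Ξ) u < ⊤) : u ∈ slopeSet L q := by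
  obtain ⟨h, ⟨μ, hμ, hinv, hslope, hh⟩, htop⟩ := sInf_lt_iff.1 hu
  exact hslope.mem_slopeSet (ae_lipschitz hΨ hΞ hq hinv hh htop)

/-- The allowable slopes are determined between the interior of the set of Lipschitz slopes and
that set itself. -/
theorem allowableSlopes_eq [L.FiniteIndex]
    (hΨ : IsPeriodicGradientPotential L Ψ) (hΞ : IsPeriodicGradientPotential L Ξ)
    (hq : IsLipschitzPotential L A q Ψ)
    (hlt : ∀ u ∈ interior (slopeSet L q), surfaceTension L (Ψ + Ξ) u < ⊤) :
    allowableSlopes L (Ψ + Ξ) = lipschitzSlopes L q :=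
  subset_antisymm
    (interior_mono fun _ hu => mem_slopeSet_of_surfaceTension_lt_top hΨ hΞ hq hu)
    (interior_maximal hlt isOpen_interior)

end Allowable

/-! ## The surface tension near the boundary, for real heights -/

section TightDensity

open ProbabilityTheory

variable {d : ℕ}

/-- The factors of the trial density for slopes at which the constraint between `a` and `b` is
nearly tight. -/
noncomputable def tightFactor (a b : Site d) (K r Q : ℝ) (x : Site d) (φ : Site d → ℝ) : ℝ≥0∞ :=
  if x = b then exponentialPDF r (Q - (φ b - φ a)) else unifDensity ℝ K (φ x - φ 0)

/-- The trial density for slopes at which the constraint between `a` and `b` is nearly tight. -/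
noncomputable def tightDensity (l : ℕ) (a b : Site d) (K r Q : ℝ) (φ : HeightFunction d ℝ) :
    ℝ≥0∞ :=
  ∏ x ∈ (box d l).erase 0, tightFactor a b K r Q x φ

variable {l : ℕ} {a b : Site d} {K r Q : ℝ}

theorem tightFactor_self (a b : Site d) (K r Q : ℝ) :
    tightFactor a b K r Q b = fun φ => exponentialPDF r (Q - (φ b - φ a)) :=
  funext fun _ => if_pos rfl

theorem tightFactor_of_ne {x b : Site d} (h : x ≠ b) (a : Site d) (K r Q : ℝ) :
    tightFactor a b K r Q x = fun φ => unifDensity ℝ K (φ x - φ 0) :=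
  funext fun _ => if_neg h

theorem measurable_exponentialPDF (r : ℝ) : Measurable (exponentialPDF r) :=
  (measurable_exponentialPDFReal r).ennreal_ofReal

theorem measurable_tightDensity (ha : a ∈ box d l) (hb : b ∈ box d l) :
    Measurable[gradientAlgebra (box d l : Set (Site d))] (tightDensity l a b K r Q) := by
  refine Finset.measurable_prod (m := gradientAlgebra (box d l : Set (Site d))) _ fun x hx => ?_
  have hx' := Finset.mem_of_mem_erase hx
  have h0 : (0 : Site d) ∈ box d l := by
    rw [mem_box] at ha ⊢
    intro j
    have := ha j
    simp only [Pi.zero_apply]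
    omega
  by_cases hxb : x = b
  · rw [hxb, tightFactor_self]
    exact (measurable_exponentialPDF r).comp ((measurable_sub_apply (E := ℝ) (by exact_mod_cast ha)
      (by exact_mod_cast hb)).const_sub Q)
  · rw [tightFactor_of_ne hxb]
    exact (measurable_unifDensity K).comp (measurable_sub_apply (E := ℝ) (by exact_mod_cast h0)
      (by exact_mod_cast hx'))

/-- The vertex `b` gets the higher rank and is integrated first: its factor involves the height at
`a`, whereas no other factor involves the height at `b`. The condition `b ≠ 0` is essential, as the
height at the origin is held fixed. -/
theorem lintegral_tightDensity_le_one (ha : a ∈ box d l) (hb : b ∈ box d l) (hab : a ≠ b)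
    (hb0 : b ≠ 0) (hl : 1 ≤ l) (hK : 0 ≤ K) (hr : 0 < r) :
    @lintegral _ (gradientAlgebra (box d l : Set (Site d))) (gradientRef (box d l) 0)
      (tightDensity l a b K r Q) ≤ 1 := by
  rw [← lmarginal_gradient (zero_mem_box hl) (measurable_tightDensity ha hb) 0 0]
  simp only [add_zero]
  have : SigmaFinite (HeightSpace.ref : Measure ℝ) := IsRegularHeight.sigmaFinite
  have hG : ∀ x, Measurable (tightFactor a b K r Q x) := by
    intro x
    by_cases hxb : x = b
    · rw [hxb, tightFactor_self]
      exact (measurable_exponentialPDF r).comp (by fun_prop)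
    · rw [tightFactor_of_ne hxb]
      exact (measurable_unifDensity K).comp (by fun_prop)
  have key := lmarginal_prod_le_one (μ := fun _ : Site d => (HeightSpace.ref : Measure ℝ))
    ((box d l).erase 0) (fun x => if x = b then 1 else 0) (fun x => {x}) (tightFactor a b K r Q) hG
    (fun x _ y _ hxy => by simpa using hxy) (fun i hi j hj hij hrank φ y => ?_)
    (fun x hx φ => ?_) 0
  · simpa [tightDensity] using key
  · by_cases hib : i = b
    · rw [if_pos hib] at hrank
      by_cases hjb : j = b
      · exact absurd (hib.trans hjb.symm) hij
      · rw [if_neg hjb] at hrank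
        omega
    · have h0 : (0 : Site d) ≠ j := (Finset.ne_of_mem_erase hj).symm
      simp [tightFactor, if_neg hib, Function.updateFinset, hij, h0]
  · rw [lmarginal_singleton]
    by_cases hxb : x = b
    · subst hxb
      simp only [tightFactor, if_true, Function.update_self, Function.update_of_ne hab]
      have h1 : ∀ t : ℝ, Q - (t - φ a) = (Q + φ a) - t := fun t => by ring
      simp only [h1]
      change ∫⁻ t, exponentialPDF r (Q + φ a - t) ∂volume ≤ 1
      rw [lintegral_sub_left_eq_self (fun t => exponentialPDF r t),
        lintegral_exponentialPDF_eq_one hr]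
    · have h0 : (0 : Site d) ≠ x := (Finset.ne_of_mem_erase hx).symm
      simp only [tightFactor, if_neg hxb, Function.update_self, Function.update_of_ne h0]
      change ∫⁻ t, unifDensity ℝ K (t - φ 0) ∂volume ≤ 1
      rw [lintegral_sub_right_eq_self (fun t => unifDensity ℝ K t)]
      exact lintegral_unifDensity_le_one hK

theorem tightDensity_eq (hb : b ∈ box d l) (hb0 : b ≠ 0) (hr : 0 < r) {φ : HeightFunction d ℝ}
    (hφ : ∀ x ∈ box d l, |φ x - φ 0| ≤ K) (hQ : φ b - φ a ≤ Q) :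
    tightDensity l a b K r Q φ = ENNReal.ofReal (r * Real.exp (-(r * (Q - (φ b - φ a)))) *
      (2 * K + 1)⁻¹ ^ (((box d l).erase 0).erase b).card) := by
  have hb' : b ∈ (box d l).erase 0 := Finset.mem_erase.2 ⟨hb0, hb⟩
  have hK : 0 ≤ K := (abs_nonneg _).trans (hφ b hb)
  rw [tightDensity, ← Finset.mul_prod_erase _ _ hb', Finset.prod_congr rfl
    (g := fun _ => ENNReal.ofReal (2 * K + 1)⁻¹) fun x hx => ?_, Finset.prod_const]
  · rw [tightFactor_self]
    beta_reduce
    rw [exponentialPDF_of_nonneg (by linarith),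
      ← ENNReal.ofReal_pow (by positivity), ← ENNReal.ofReal_mul (by positivity)]
  · rw [tightFactor_of_ne (Finset.ne_of_mem_erase hx)]
    exact unifDensity_of_le (E := ℝ)
      (hφ x (Finset.mem_of_mem_erase (Finset.mem_of_mem_erase hx)))

theorem log_tightDensity (hb : b ∈ box d l) (hb0 : b ≠ 0) (hr : 0 < r) {φ : HeightFunction d ℝ}
    (hφ : ∀ x ∈ box d l, |φ x - φ 0| ≤ K) (hQ : φ b - φ a ≤ Q) :
    (tightDensity l a b K r Q φ ≠ 0 ∧ tightDensity l a b K r Q φ ≠ ⊤) ∧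
    Real.log (tightDensity l a b K r Q φ).toReal = Real.log r - r * (Q - (φ b - φ a)) -
      (((box d l).erase 0).erase b).card * Real.log (2 * K + 1) := by
  have hK : 0 ≤ K := (abs_nonneg _).trans (hφ b hb)
  rw [tightDensity_eq hb hb0 hr hφ hQ]
  refine ⟨⟨?_, ENNReal.ofReal_ne_top⟩, ?_⟩
  · rw [Ne, ENNReal.ofReal_eq_zero, not_le]
    positivity
  · rw [ENNReal.toReal_ofReal (by positivity), Real.log_mul (by positivity) (by positivity),
      Real.log_mul (by positivity) (by positivity), Real.log_exp, Real.log_pow, Real.log_inv]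
    ring

end TightDensity

/-! ### Blow-up of the surface tension at boundary slopes -/

section Boundary

variable {d : ℕ} {L : AddSubgroup (Site d)} {A : SimpleGraph (Site d)}
  {q : Site d → Site d → ℝ} {Ψ Ξ : Potential d ℝ} {μ : Measure (HeightFunction d ℝ)}

/-- The increment from `a` to `a + w` has mean `u w`, so the exponential factor contributes `log r -
r * (Q - u w)` per tile. When `u w` is close to `Q`, a large `r` makes this as large as desired. -/
theorem specificFreeEnergy_ge_of_tight (hΨ : IsPeriodicGradientPotential L Ψ)
    (hpos : IsPositive Ψ) (hΞ : IsPeriodicGradientPotential L Ξ) {C K K' : ℝ} (hC : 0 ≤ C)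
    (hC' : ∀ φ x, strength Ξ φ (x ∈ ·) ≤ ENNReal.ofReal C) (hK : 0 ≤ K) (hK' : 0 ≤ K')
    [IsProbabilityMeasure μ] (hμ : IsShiftInvariant L μ)
    (hstep : ∀ᵐ φ ∂μ, ∀ (x : Site d) (j : Fin d),
      |HeightSpace.toReal (φ (x + Pi.single j 1) - φ x)| ≤ K)
    {l : ℕ} (hl : 1 ≤ l) (hlL : ∀ v : Site d, (l : ℤ) • v ∈ L) {a w : Site d} (hw : w ∈ L)
    (hw0 : w ≠ 0) (ha : a ∈ box d l) (hb : a + w ∈ box d l) (hb0 : a + w ≠ 0)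
    (hbox : ∀ᵐ φ ∂μ, ∀ x ∈ box d l, |φ x - φ 0| ≤ K') {Q : ℝ}
    (hQ : ∀ᵐ φ ∂μ, φ (a + w) - φ a ≤ Q) {u : Slope d} (hu : HasSlope L μ u) {r : ℝ} (hr : 0 < r)
    {h : EReal} (hh : IsSpecificFreeEnergy (Ψ + Ξ) μ h) :
    (((((l : ℝ) ^ d)⁻¹ * (Real.log r - r * (Q - u (toVec w)) -
      (((box d l).erase 0).erase (a + w)).card * Real.log (2 * K' + 1) - Real.log (2 * K + 1)) - C) :
        ℝ) : EReal) ≤ h := by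
  have hab : a ≠ a + w := fun h => hw0 (by simpa using h.symm)
  have hint : Integrable (fun φ : HeightFunction d ℝ => φ (a + w) - φ a) μ := hu.1 a (a + w)
  have hIw : ∫ φ, (φ (a + w) - φ a) ∂μ = u (toVec w) := hu.integral_sub_eq hμ a hw
  have hlog : ∀ᵐ φ ∂μ, Real.log (tightDensity l a (a + w) K' r Q φ).toReal =
      Real.log r - r * (Q - (φ (a + w) - φ a)) -
        (((box d l).erase 0).erase (a + w)).card * Real.log (2 * K' + 1) := by
    filter_upwards [hbox, hQ] with φ h1 h2 using (log_tightDensity hb hb0 hr h1 h2).2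
  have hFint' : Integrable (fun φ : HeightFunction d ℝ => Real.log r -
      r * (Q - (φ (a + w) - φ a)) -
        (((box d l).erase 0).erase (a + w)).card * Real.log (2 * K' + 1)) μ :=
    ((integrable_const _).sub (((integrable_const _).sub hint).const_mul r)).sub
      (integrable_const _)
  have hI : ∫ φ, Real.log (tightDensity l a (a + w) K' r Q φ).toReal ∂μ =
      Real.log r - r * (Q - u (toVec w)) -
        (((box d l).erase 0).erase (a + w)).card * Real.log (2 * K' + 1) := by
    have h1 : Integrable (fun φ : HeightFunction d ℝ => r * (Q - (φ (a + w) - φ a))) μ :=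
      ((integrable_const _).sub hint).const_mul r
    rw [integral_congr_ae hlog, integral_sub (f := fun φ : HeightFunction d ℝ => Real.log r -
      r * (Q - (φ (a + w) - φ a))) ((integrable_const _).sub h1) (integrable_const _),
      integral_sub (integrable_const _) h1, integral_const_mul,
      integral_sub (f := fun _ => Q) (integrable_const _) hint, hIw]
    simp
  have hFint := hFint'.congr (hlog.mono fun φ hφ => hφ.symm)
  -- The limit is known to exist, so it may be taken along multiples of `l`, where the tiles fill
  -- the box exactly.
  have hsub : Tendsto (fun J : ℕ => J * l) atTop atTop :=
    tendsto_id.atTop_mul_const' (by omega)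
  refine ge_of_tendsto (hh.comp hsub) ((eventually_ge_atTop 1).mono fun J hJ => ?_)
  have hn : 1 ≤ J * l := Nat.mul_pos hJ hl
  have hdiv : J * l / l = J := Nat.mul_div_cancel _ hl
  have hunc : (uncovered d (J * l) l l).card = 0 := by
    have := card_uncovered (d := d) (n := J * l) hl (le_refl l)
    rw [hdiv, mul_pow] at this
    omega
  have key := freeEnergy_tile_ge (n := J * l) (k := l) (hΨ.add hΞ) hμ hn hl le_rfl
    (fun v hv => by
      simp only [tilePositions, Finset.mem_image] at hv
      obtain ⟨w, -, rfl⟩ := hv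
      exact hlL w) hK hstep (measurable_tightDensity (K := K') (r := r) (Q := Q) ha hb)
    (lintegral_tightDensity_le_one ha hb hab hb0 hl hK' hr)
    (by filter_upwards [hbox, hQ] with φ h1 h2 using (log_tightDensity hb hb0 hr h1 h2).1) hFint
    (B := fun _ => -((box d (J * l)).card * C)) measurable_const
    (fun φ => interiorHamiltonian_add_ge hpos hC (hC' φ) _) (integrable_const _)
  rw [hI, hunc, hdiv] at key
  have hn' : (0 : ℝ) < (J * l : ℕ) := by exact_mod_cast hn
  have hn'' : (0 : ℝ) < ((J * l : ℕ) : ℝ) ^ d := by positivity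
  refine le_trans (le_of_eq ?_)
    (mul_le_mul_of_nonneg_left key (EReal.coe_nonneg.2 (inv_nonneg.2 hn''.le)))
  rw [← EReal.coe_mul]
  congr 1
  simp only [integral_const, probReal_univ, smul_eq_mul, one_mul, card_box]
  have hJ' : (J : ℝ) ≠ 0 := by positivity
  have hl' : (l : ℝ) ≠ 0 := by positivity
  push_cast
  rw [mul_pow]
  field_simp
  ring

/-- The surface tension tends to infinity at the boundary of the set of allowable slopes. -/
theorem tendsto_surfaceTension_of_tight [L.FiniteIndex] (hd : d ≠ 0)
    (hΨ : IsStrongInteractionReal L A q Ψ) (hΞ : IsWeakInteraction L Ξ) {v : Slope d}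
    (hv : v ∈ slopeSet L q) (hv' : v ∉ interior (slopeSet L q)) :
    Tendsto (surfaceTension L (Ψ + Ξ)) (𝓝 v) (𝓝 ⊤) := by
  have hq := hΨ.lipschitz.1
  obtain ⟨K, hK, hstep⟩ := exists_step_bound (E := ℝ) hq.quasimetric.periodic
  obtain ⟨C, hC, hC'⟩ := hΞ.summable.exists_bound
  obtain ⟨m, hm, hmL⟩ := exists_nsmul_mem L
  obtain ⟨a₀, w, hw, hw0, htight⟩ := exists_tight hq hv hv'
  -- The third vertex forces every coordinate of the translate of `a₀ + w` to be at least one, which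
  -- keeps it away from the origin.
  obtain ⟨t, ht, N, hN⟩ := exists_translate_mem_box (L := L) {a₀, a₀ + w, a₀ + w - fun _ => 1}
  obtain ⟨a, ha⟩ : ∃ a, a = a₀ + t := ⟨_, rfl⟩
  -- A multiple of `m`, so that the tile positions are lattice vectors, and at least `N`, so that
  -- the tile contains the tight pair.
  obtain ⟨l, hl⟩ : ∃ l, l = m * (N + 1) := ⟨_, rfl⟩
  have hlN : N ≤ l := by rw [hl]; nlinarith
  have hl1 : 1 ≤ l := by rw [hl]; nlinarith
  have hlL : ∀ v : Site d, (l : ℤ) • v ∈ L := fun v => by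
    have := hmL (((N + 1 : ℕ) : ℤ) • v)
    rwa [smul_smul, ← Nat.cast_mul, ← hl] at this
  have haw : a + w = a₀ + w + t := by rw [ha]; abel
  have ha' : a ∈ box d l := ha ▸ hN l hlN a₀ (by simp)
  have hb' : a + w ∈ box d l := haw ▸ hN l hlN (a₀ + w) (by simp)
  have hb0 : a + w ≠ 0 := fun h0 => by
    have h1 := mem_box.1 (hN l hlN (a₀ + w - fun _ => 1) (by simp)) ⟨0, Nat.pos_of_ne_zero hd⟩
    have h2 := congrFun h0 ⟨0, Nat.pos_of_ne_zero hd⟩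
    rw [haw] at h2
    simp only [Pi.add_apply, Pi.sub_apply, Pi.zero_apply] at h1 h2
    omega
  have hQ : q a (a + w) = v (toVec w) := by
    rw [htight, haw, ha, hq.quasimetric.periodic t ht]
  obtain ⟨K', hK', hbox⟩ : ∃ K' : ℝ, 0 ≤ K' ∧ ∀ φ : HeightFunction d ℝ,
      (∀ x y, HeightSpace.toReal (φ y - φ x) ≤ q x y) → ∀ x ∈ box d l, |φ x - φ 0| ≤ K' := by
    refine ⟨∑ x ∈ box d l, (|q 0 x| + |q x 0|), by positivity, fun φ hφ x hx => ?_⟩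
    refine le_trans ?_ (Finset.single_le_sum (f := fun x => |q 0 x| + |q x 0|)
      (fun _ _ => by positivity) hx)
    have h1 : φ x - φ 0 ≤ q 0 x := hφ 0 x
    have h2 : φ 0 - φ x ≤ q x 0 := hφ x 0
    rw [abs_le]
    constructor <;> linarith [le_abs_self (q 0 x), le_abs_self (q x 0), abs_nonneg (q 0 x),
      abs_nonneg (q x 0)]
  rw [EReal.tendsto_nhds_top_iff_real]
  intro X
  have hld : (0 : ℝ) < (l : ℝ) ^ d := by positivity
  -- The rate is fixed first, with `log r` paying for all constants and one more unit. Only then is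
  -- the slope taken so close to `v` that the loss `r * (v w - u w)` is below that unit.
  obtain ⟨r, hr, hr'⟩ := ((eventually_gt_atTop (0 : ℝ)).and
    (Real.tendsto_log_atTop.eventually_gt_atTop ((X + C) * (l : ℝ) ^ d + 1 +
      (((box d l).erase 0).erase (a + w)).card * Real.log (2 * K' + 1) +
        Real.log (2 * K + 1)))).exists
  have hcont : Tendsto (fun u : Slope d => r * (v (toVec w) - u (toVec w))) (𝓝 v) (𝓝 0) := by
    have : Continuous fun u : Slope d => r * (v (toVec w) - u (toVec w)) := by fun_prop
    simpa using this.tendsto v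
  filter_upwards [hcont.eventually (gt_mem_nhds zero_lt_one)] with u hu
  have hlt : (X : EReal) < (((((l : ℝ) ^ d)⁻¹ * (Real.log r - 1 -
      (((box d l).erase 0).erase (a + w)).card * Real.log (2 * K' + 1) - Real.log (2 * K + 1)) - C) :
        ℝ) : EReal) := by
    rw [EReal.coe_lt_coe_iff, lt_sub_iff_add_lt, lt_inv_mul_iff₀ hld]
    linarith
  refine hlt.trans_le (le_sInf ?_)
  rintro h ⟨μ, hprob, hinv, hslope, hh⟩
  rcases eq_or_ne h ⊤ with rfl | htop
  · exact le_top
  have hlip := ae_lipschitz hΨ.potential hΞ.potential hΨ.lipschitz hinv hh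
    (lt_top_iff_ne_top.2 htop)
  refine le_trans ?_ (specificFreeEnergy_ge_of_tight hΨ.potential hΨ.positive hΞ.potential hC hC'
    hK hK' hinv (hlip.mono fun φ hφ => hstep φ hφ) hl1 hlL hw hw0 ha' hb' hb0
    (hlip.mono fun φ hφ => hbox φ hφ) (Q := v (toVec w))
    (hlip.mono fun φ hφ => hQ ▸ hφ a (a + w)) hslope hr hh)
  rw [EReal.coe_le_coe_iff]
  gcongr

theorem real_heights [L.FiniteIndex] (hd : d ≠ 0) (hΨ : IsStrongInteractionReal L A q Ψ)
    (hΞ : IsWeakInteraction L Ξ) :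
    allowableSlopes L (Ψ + Ξ) = lipschitzSlopes L q ∧
      Tendsto (surfaceTension L (Ψ + Ξ)) (𝓝ˢ (frontier (allowableSlopes L (Ψ + Ξ)))) (𝓝 ⊤) := by
  have h := allowableSlopes_eq hΨ.potential hΞ.potential hΨ.lipschitz fun u hu =>
    surfaceTension_lt_top_of_mem_interior hd hΨ hΞ hu
  refine ⟨h, ?_⟩
  rw [h, nhdsSet, sSup_image, tendsto_iSup]
  intro v
  rw [tendsto_iSup]
  intro hv
  have hv1 : v ∈ closure (interior (slopeSet L q)) := hv.1
  have hv2 : v ∉ interior (interior (slopeSet L q)) := hv.2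
  rw [interior_interior] at hv2
  exact tendsto_surfaceTension_of_tight hd hΨ hΞ
    (closure_minimal interior_subset (isClosed_slopeSet L q) hv1) hv2

end Boundary

/-! ## Integral heights: Lipschitz functions are tame -/

section IntTame

variable {d : ℕ} {L : AddSubgroup (Site d)} {A : SimpleGraph (Site d)}
  {q : Site d → Site d → ℝ} {Ψ Ξ : Potential d ℤ} {μ : Measure (HeightFunction d ℤ)}

/-- The height function `φ` is `q`-Lipschitz. -/
def IsLipschitz (q : Site d → Site d → ℝ) (φ : HeightFunction d ℤ) : Prop :=
  ∀ x y, ((φ y - φ x : ℤ) : ℝ) ≤ q x y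

theorem IsLipschitz.shift (hq : ∀ v ∈ L, ∀ x y, q (x + v) (y + v) = q x y)
    {φ : HeightFunction d ℤ} (h : IsLipschitz q φ) {v : Site d} (hv : v ∈ L) :
    IsLipschitz q (shift v φ) := fun x y => by
  rw [← hq v hv]
  exact h (x + v) (y + v)

theorem measurableSet_isLipschitz (q : Site d → Site d → ℝ) :
    MeasurableSet {φ : HeightFunction d ℤ | IsLipschitz q φ} := by
  simp only [IsLipschitz, Set.ofPred_forall]
  exact MeasurableSet.iInter fun x => MeasurableSet.iInter fun y =>
    measurable_toReal_gradient (E := ℤ) x y measurableSet_Iic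

theorem IsLipschitz.abs_le {φ : HeightFunction d ℤ} (h : IsLipschitz q φ) (x y : Site d) :
    |φ y - φ x| ≤ ⌈|q x y| + |q y x|⌉ := by
  have h1 : ((|φ y - φ x| : ℤ) : ℝ) ≤ |q x y| + |q y x| := by
    have h2 := h x y
    have h3 := h y x
    push_cast at h2 h3 ⊢
    rw [_root_.abs_le]
    constructor <;> linarith [le_abs_self (q x y), le_abs_self (q y x), abs_nonneg (q x y),
      abs_nonneg (q y x)]
  exact_mod_cast (Int.cast_le (R := ℝ)).1 (h1.trans (Int.le_ceil _))

/-- The patterns of Lipschitz functions on a finite set are finitely many. -/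
theorem finite_patterns (q : Site d → Site d → ℝ) (B : Finset (Site d)) (x : Site d) :
    ((fun (φ : HeightFunction d ℤ) (y : B) => φ y - φ x) '' {φ | IsLipschitz q φ}).Finite := by
  refine (Set.Finite.pi' (t := fun y : B => Set.Icc (-⌈|q x y| + |q y x|⌉) ⌈|q x y| + |q y x|⌉)
    fun y => Set.finite_Icc _ _).subset ?_
  rintro _ ⟨φ, hφ, rfl⟩ y
  exact _root_.abs_le.1 (IsLipschitz.abs_le hφ x y)

/-- A local function which is finite on Lipschitz functions is bounded on Lipschitz functions. -/
theorem exists_bound_of_local {g : HeightFunction d ℤ → ℝ≥0∞} {B : Finset (Site d)} {x : Site d}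
    (hx : x ∈ B) (hg : ∀ φ ψ : HeightFunction d ℤ, (∀ y ∈ B, φ y - φ x = ψ y - ψ x) → g φ = g ψ)
    (hfin : ∀ φ, IsLipschitz q φ → g φ ≠ ⊤) :
    ∃ C : ℝ, 0 ≤ C ∧ ∀ φ, IsLipschitz q φ → g φ ≤ ENNReal.ofReal C := by
  obtain ⟨C, hC⟩ := ((finite_patterns q B x).image fun p : B → ℤ =>
    (g fun y => if h : y ∈ B then p ⟨y, h⟩ else 0).toReal).bddAbove
  refine ⟨max C 0, le_max_right _ _, fun φ hφ => ?_⟩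
  have h1 := hC ⟨_, ⟨φ, hφ, rfl⟩, rfl⟩
  have h2 : g (fun y => if h : y ∈ B then φ y - φ x else 0) = g φ := hg _ _ fun y hy => by
    simp [hy, hx]
  have h3 : (g fun y => if h : y ∈ B then φ y - φ x else 0).toReal ≤ C := h1
  rw [h2] at h3
  rw [← ENNReal.ofReal_toReal (hfin φ hφ)]
  exact ENNReal.ofReal_le_ofReal (h3.trans (le_max_left _ _))

theorem strength_congr_of_finiteRange (hΨ : IsPeriodicGradientPotential L Ψ) {R : ℕ}
    (hR : ∀ Λ : Finset (Site d), (∃ x ∈ Λ, ∃ y ∈ Λ, R < d1 x y) → ∀ φ, Ψ Λ φ = 0) {x : Site d}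
    {φ ψ : HeightFunction d ℤ}
    (h : ∀ y ∈ Fintype.piFinset fun j => Finset.Icc (x j - R) (x j + R), φ y - φ x = ψ y - ψ x) :
    strength Ψ φ (x ∈ ·) = strength Ψ ψ (x ∈ ·) := by
  refine tsum_congr fun Γ => ?_
  obtain ⟨Γ, hΓ⟩ := Γ
  by_cases hd : ∃ x ∈ Γ, ∃ y ∈ Γ, R < d1 x y
  · rw [hR Γ hd, hR Γ hd]
  · push Not at hd
    have hsub : ∀ y ∈ Γ, φ y - φ x = ψ y - ψ x := fun y hy => h y (by
      rw [Fintype.mem_piFinset]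
      intro j
      have h1 := _root_.abs_le.1 (abs_toInt_sub_le_d1 x y j)
      have h2 : (d1 x y : ℤ) ≤ R := by exact_mod_cast hd x hΓ y hy
      rw [Finset.mem_Icc]
      constructor <;> linarith [h1.1, h1.2])
    rw [eq_of_gradient_eq (hΨ.measurable Γ) (φ := ψ) (ψ := φ) fun y hy z hz => by
      have h1 := hsub y hy
      have h2 := hsub z hz
      linarith]

/-- Finite range leaves finitely many nonzero terms at `x`, and an infinite term would require a
violated edge constraint. -/
theorem strength_ne_top_of_finiteRange (hq : IsLipschitzPotential L A q Ψ)
    (hΨ : IsPeriodicGradientPotential L Ψ) {R : ℕ}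
    (hR : ∀ Λ : Finset (Site d), (∃ x ∈ Λ, ∃ y ∈ Λ, R < d1 x y) → ∀ φ, Ψ Λ φ = 0) (x : Site d)
    {φ : HeightFunction d ℤ} (hφ : IsLipschitz q φ) : strength Ψ φ (x ∈ ·) ≠ ⊤ := by
  have h1 : strength Ψ φ (x ∈ ·) =
      ∑' Γ, {Γ : Finset (Site d) | x ∈ Γ}.indicator (fun Γ => (Ψ Γ φ).abs) Γ :=
    tsum_subtype {Γ : Finset (Site d) | x ∈ Γ} fun Γ => (Ψ Γ φ).abs
  rw [h1, tsum_eq_sum (s := (Fintype.piFinset fun j =>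
    Finset.Icc (x j - (R : ℤ)) (x j + R)).powerset) fun Γ hΓ => ?_]
  · refine (ENNReal.sum_lt_top.2 fun Γ _ => lt_of_le_of_lt (indicator_le_self _ _ Γ) ?_).ne
    have htop : Ψ Γ φ ≠ ⊤ := fun h => by
      obtain ⟨a, b, -, -, hab⟩ := (hq.2 Γ φ).1 h
      exact absurd (hφ a b) (not_le.2 hab)
    obtain ⟨r, hr⟩ : ∃ r : ℝ, Ψ Γ φ = r :=
      ⟨(Ψ Γ φ).toReal, (EReal.coe_toReal htop (hΨ.ne_bot Γ φ)).symm⟩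
    rw [hr, EReal.abs_def]
    exact ENNReal.ofReal_lt_top
  · by_cases hx : x ∈ Γ
    · rw [indicator_of_mem (s := {Γ : Finset (Site d) | x ∈ Γ}) hx]
      rw [Finset.mem_powerset, Finset.not_subset] at hΓ
      obtain ⟨y, hy, hyB⟩ := hΓ
      rw [hR Γ, EReal.abs_zero]
      refine ⟨x, hx, y, hy, ?_⟩
      by_contra! h2
      refine hyB (Fintype.mem_piFinset.2 fun j => ?_)
      have h1 := _root_.abs_le.1 (abs_toInt_sub_le_d1 x y j)
      have h2 : (d1 x y : ℤ) ≤ R := by exact_mod_cast h2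
      rw [Finset.mem_Icc]
      constructor <;> linarith [h1.1, h1.2]
    · exact indicator_of_notMem (s := {Γ : Finset (Site d) | x ∈ Γ}) hx _

/-- A strong interaction is bounded on Lipschitz functions. -/
theorem exists_strength_bound [L.FiniteIndex] (hΨ : IsStrongInteractionInt L A q Ψ) :
    ∃ C : ℝ, 0 ≤ C ∧ ∀ φ, IsLipschitz q φ → ∀ x, strength Ψ φ (x ∈ ·) ≤ ENNReal.ofReal C := by
  obtain ⟨R, hR⟩ := hΨ.finiteRange
  have h1 : ∀ x : Site d, ∃ C : ℝ, 0 ≤ C ∧ ∀ φ, IsLipschitz q φ →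
      strength Ψ φ (x ∈ ·) ≤ ENNReal.ofReal C := fun x =>
    exists_bound_of_local (x := x) (B := Fintype.piFinset fun j => Finset.Icc (x j - (R : ℤ)) (x j + R))
      (by simp [Fintype.mem_piFinset])
      (fun φ ψ h => strength_congr_of_finiteRange hΨ.potential hR h)
      (fun φ hφ => strength_ne_top_of_finiteRange hΨ.lipschitz hΨ.potential hR x hφ)
  choose C hC0 hC using h1
  obtain ⟨M, hM⟩ := (Set.finite_range fun r : Site d ⧸ L => C r.out).bddAbove
  refine ⟨max M 0, le_max_right _ _, fun φ hφ x => ?_⟩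
  obtain ⟨v, hv, hx⟩ := exists_out L x
  have h2 := hΨ.potential.strength_shift hv φ fun Γ => (x : Site d ⧸ L).out ∈ Γ
  have h3 : ∀ Γ : Finset (Site d), (x : Site d ⧸ L).out ∈ translate (-v) Γ ↔ x ∈ Γ := fun Γ => by
    rw [mem_translate, sub_neg_eq_add, ← hx]
  simp only [h3] at h2
  rw [← h2]
  exact (hC _ _ (hφ.shift hΨ.lipschitz.1.quasimetric.periodic hv)).trans
    (ENNReal.ofReal_le_ofReal ((hM ⟨_, rfl⟩).trans (le_max_left _ _)))

/-- The normalised representative of any point of `S` is an atom of mass one for counting measure.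
Hence discrete probability measures have densities at most one, so their log-densities are
nonpositive. -/
theorem one_le_gradientRef {Λ : Finset (Site d)} {x : Site d} {S : Set (HeightFunction d ℤ)}
    (hS : MeasurableSet[gradientAlgebra (Λ : Set (Site d))] S) (hne : S.Nonempty) :
    1 ≤ gradientRef (E := ℤ) Λ x S := by
  obtain ⟨φ, hφ⟩ := hne
  rw [gradientRef, Measure.map_apply (measurable_extendZero Λ x _) hS]
  have h1 : (fun y : ↥(Λ.erase x) => φ y - φ x) ∈ extendZero Λ x ⁻¹' S := by
    have h3 : ∀ y ∈ Λ, extendZero Λ x (fun y : ↥(Λ.erase x) => φ y - φ x) y = φ y - φ x := by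
      intro y hy
      by_cases hyx : y = x
      · simp [extendZero, hyx]
      · simp [extendZero, hyx, hy]
    refine mem_of_gradient_eq hS (fun y hy z hz => ?_) hφ
    rw [h3 y hy, h3 z hz]
    ring
  have : SigmaFinite (HeightSpace.ref : Measure ℤ) := IsRegularHeight.sigmaFinite
  refine le_trans (le_of_eq ?_) (measure_mono (singleton_subset_iff.2 h1))
  rw [Measure.pi_singleton]
  refine (Finset.prod_eq_one fun y _ => ?_).symm
  exact Measure.count_singleton _

theorem trim_le_gradientRef [IsProbabilityMeasure μ] (Λ : Finset (Site d)) (x : Site d) :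
    μ.trim (gradientAlgebra_le (Λ : Set (Site d))) ≤ gradientRef Λ x := by
  rw [Measure.le_iff]
  intro S hS
  rcases S.eq_empty_or_nonempty with rfl | hne
  · simp
  · rw [trim_measurableSet_eq _ hS]
    exact prob_le_one.trans (one_le_gradientRef hS hne)

/-- The invariant measures on Lipschitz functions. -/
structure IsLipschitzMeasure (L : AddSubgroup (Site d)) (q : Site d → Site d → ℝ)
    (μ : Measure (HeightFunction d ℤ)) : Prop where
  prob : IsProbabilityMeasure μ
  inv : IsShiftInvariant L μ
  lipschitz : ∀ᵐ φ ∂μ, IsLipschitz q φ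

/-- The constants in the estimates for the free energies of measures on Lipschitz functions. -/
structure IsTameModel (L : AddSubgroup (Site d)) (q : Site d → Site d → ℝ) (Φ : Potential d ℤ)
    (K C : ℝ) (e : ℕ → ℝ) (m : ℕ) : Prop where
  dim : d ≠ 0
  potential : IsPeriodicGradientPotential L Φ
  step_nonneg : 0 ≤ K
  bound_nonneg : 0 ≤ C
  cross_nonneg : ∀ l, 0 ≤ e l
  tendsto_cross : Tendsto (fun l : ℕ => e l / (l : ℝ) ^ d) atTop (𝓝 0)
  one_le : 1 ≤ m
  smul_mem : ∀ v : Site d, (m : ℤ) • v ∈ L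
  tame : ∀ φ, IsLipschitz q φ → IsTame L Φ K C e φ
  lipschitz_of_lt_top : ∀ μ, IsProbabilityMeasure μ → IsShiftInvariant L μ → ∀ h,
    IsSpecificFreeEnergy Φ μ h → h < ⊤ → IsLipschitzMeasure L q μ

theorem exists_isTameModel [L.FiniteIndex] (hd : d ≠ 0) (hΨ : IsStrongInteractionInt L A q Ψ)
    (hΞ : IsWeakInteraction L Ξ) : ∃ K C e m, IsTameModel L q (Ψ + Ξ) K C e m := by
  obtain ⟨K, hK, hstep⟩ := exists_step_bound (E := ℤ) hΨ.lipschitz.1.quasimetric.periodic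
  obtain ⟨C, hC, hC'⟩ := exists_strength_bound hΨ
  obtain ⟨D, hD, hD'⟩ := hΞ.summable.exists_bound
  obtain ⟨R, hR⟩ := hΨ.finiteRange
  obtain ⟨m, hm, hmL⟩ := exists_nsmul_mem L
  exact ⟨K, C + D, crossBound Ξ R C, m,
    { dim := hd
      potential := hΨ.potential.add hΞ.potential
      step_nonneg := hK
      bound_nonneg := by positivity
      cross_nonneg := crossBound_nonneg Ξ R hC
      tendsto_cross := tendsto_crossBound hd hΞ.amenable R C
      one_le := hm
      smul_mem := hmL
      tame := fun φ hφ => isTame_of_strength_le hC hD hR hΞ.amenable hD' (hC' φ hφ) (hstep φ hφ)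
      lipschitz_of_lt_top := fun μ hμ hinv h hh htop =>
        ⟨hμ, hinv, ae_lipschitz hΨ.potential hΞ.potential hΨ.lipschitz hinv hh htop⟩ }⟩

variable {Φ : Potential d ℤ} {K C : ℝ} {e : ℕ → ℝ} {m : ℕ}

theorem IsTameModel.isTameMeasure (hM : IsTameModel L q Φ K C e m)
    (hμ : IsLipschitzMeasure L q μ) : IsTameMeasure L Φ K C 1 e μ where
  prob := hμ.prob
  inv := hμ.inv
  tame := hμ.lipschitz.mono hM.tame
  density_le n _ := by
    have := hμ.prob
    rw [one_pow, ENNReal.ofReal_one, one_smul]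
    exact trim_le_gradientRef _ _

theorem IsTameModel.exists_limit (hM : IsTameModel L q Φ K C e m)
    (hμ : IsLipschitzMeasure L q μ) :
    ∃ h : ℝ, Tendsto (fun n : ℕ => realFreeEnergy Φ n μ / (n : ℝ) ^ d) atTop (𝓝 h) ∧
      (∀ l, 1 ≤ l → boxBound d m (Real.log (2 * K + 1)) C e l (realFreeEnergy Φ l μ / (l : ℝ) ^ d)
        ≤ h) ∧ h ≤ C ∧ -(Real.log (2 * K + 1) + C) ≤ h ∧ IsSpecificFreeEnergy Φ μ h := by
  have ht := hM.isTameMeasure hμ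
  obtain ⟨h, h1, h2, h3, h4⟩ := ht.exists_limit hM.potential hM.step_nonneg hM.bound_nonneg le_rfl
    hM.dim hM.cross_nonneg hM.tendsto_cross hM.one_le hM.smul_mem
  rw [Real.log_one, zero_add] at h3
  refine ⟨h, h1, h2, h3, ge_of_tendsto h1 ((eventually_ge_atTop 1).mono fun n hn => ?_), h4⟩
  have h5 := ht.realFreeEnergy_ge hM.potential hM.step_nonneg hM.bound_nonneg le_rfl hn
  have : (0 : ℝ) < (n : ℝ) ^ d := by positivity
  rw [le_div_iff₀ this]
  linarith

end IntTame

/-! ## Invariant measures on integral Lipschitz functions with a given slope -/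

section Floor

theorem integral_unif_one (g : ℝ → ℝ) : ∫ t, g t ∂unif 1 = ∫ t in (0 : ℝ)..1, g t := by
  rw [unif, inv_one, ENNReal.ofReal_one, one_smul, intervalIntegral.integral_of_le zero_le_one,
    integral_Icc_eq_integral_Ioc]

theorem integral_unif_one_add {g : ℝ → ℝ} (hg : Function.Periodic g 1) (s : ℝ) :
    ∫ t, g (t + s) ∂unif 1 = ∫ t, g t ∂unif 1 := by
  rw [integral_unif_one, integral_unif_one, intervalIntegral.integral_comp_add_right]
  have h := hg.intervalIntegral_add_eq s 0
  rw [zero_add] at h ⊢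
  rw [add_comm 1 s, h]

/-- A set invariant under adding one is a set on the circle, where the uniform distribution is
invariant under rotations. -/
theorem unif_one_preimage_add {A : Set ℝ} (hA : MeasurableSet A) (hper : ∀ t, t + 1 ∈ A ↔ t ∈ A)
    (s : ℝ) : unif 1 ((fun t => t + s) ⁻¹' A) = unif 1 A := by
  have := isProbabilityMeasure_unif one_pos
  have h1 : Function.Periodic (A.indicator (1 : ℝ → ℝ)) 1 := fun t => by
    by_cases ht : t ∈ A
    · rw [indicator_of_mem ht, indicator_of_mem ((hper t).2 ht)]; rfl
    · rw [indicator_of_notMem ht, indicator_of_notMem fun h => ht ((hper t).1 h)]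
  have h2 := integral_unif_one_add h1 s
  rw [integral_indicator_one hA] at h2
  have h3 : ∀ t, A.indicator (1 : ℝ → ℝ) (t + s) =
      ((fun t => t + s) ⁻¹' A).indicator (1 : ℝ → ℝ) t := fun t => rfl
  simp only [h3] at h2
  rw [integral_indicator_one ((measurable_add_const s) hA)] at h2
  exact (measureReal_eq_measureReal_iff).1 h2

variable {d : ℕ}

/-- The discretisation of a real function. -/
noncomputable def floorHeight (f : Site d → ℝ) (t : ℝ) : HeightFunction d ℤ := fun x => ⌊t + f x⌋

/-- The law of the discretisation with a uniform shift. -/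
noncomputable def floorLaw (f : Site d → ℝ) : Measure (HeightFunction d ℤ) :=
  (unif 1).map (floorHeight f)

variable {f : Site d → ℝ} {L : AddSubgroup (Site d)} {q : Site d → Site d → ℝ}

theorem measurable_floorHeight (f : Site d → ℝ) : Measurable (floorHeight f) :=
  measurable_gradientAlgebra fun x _ y _ =>
    (Int.measurable_floor.comp (measurable_id.add_const (f y))).sub
      (Int.measurable_floor.comp (measurable_id.add_const (f x)))

/-- Translation by `v` rotates the phase by `u v`, and gradients depend on the phase only modulo
one. -/
theorem isShiftInvariant_floorLaw {u : Slope d} (hf : ∀ x, ∀ v ∈ L, f (x + v) = f x + u (toVec v)) :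
    IsShiftInvariant L (floorLaw f) := by
  intro v hv
  have h1 : shift v ∘ floorHeight f = floorHeight f ∘ fun t => t + u (toVec v) := by
    funext t x
    simp only [Function.comp, shift, floorHeight, hf x v hv]
    congr 1
    ring
  have hm := measurable_floorHeight f
  rw [floorLaw, Measure.map_map (measurable_shift v) hm, h1]
  ext S hS
  rw [Measure.map_apply (hm.comp (measurable_add_const _)) hS, Measure.map_apply hm hS,
    preimage_comp]
  refine unif_one_preimage_add (hm hS) (fun t => ?_) _
  have h2 : ∀ x y, floorHeight f (t + 1) y - floorHeight f (t + 1) x =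
      floorHeight f t y - floorHeight f t x := fun x y => by
    simp only [floorHeight, add_right_comm t 1, Int.floor_add_one]
    ring
  exact ⟨mem_of_gradient_eq hS fun x _ y _ => h2 x y,
    mem_of_gradient_eq hS fun x _ y _ => (h2 x y).symm⟩

/-- Integrality of `q` enters here: an integral bound on an increment survives rounding, since the
floor commutes with adding an integer. -/
theorem isLipschitz_floorHeight (hq : ∀ x y, ∃ k : ℤ, q x y = k) (hf : ∀ x y, f y - f x ≤ q x y)
    (t : ℝ) : IsLipschitz q (floorHeight f t) := by
  intro x y
  obtain ⟨k, hk⟩ := hq x y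
  rw [hk, Int.cast_le, sub_le_iff_le_add]
  have h := hf x y
  rw [hk] at h
  have h1 : ⌊t + f y⌋ ≤ ⌊t + f x + k⌋ := Int.floor_le_floor (by linarith)
  rw [Int.floor_add_intCast] at h1
  change ⌊t + f y⌋ ≤ k + ⌊t + f x⌋
  linarith

theorem isLipschitzMeasure_floorLaw (hq : ∀ x y, ∃ k : ℤ, q x y = k)
    (hfq : ∀ x y, f y - f x ≤ q x y) {u : Slope d}
    (hf : ∀ x, ∀ v ∈ L, f (x + v) = f x + u (toVec v)) :
    IsLipschitzMeasure L q (floorLaw f) where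
  prob := have := isProbabilityMeasure_unif one_pos
    Measure.isProbabilityMeasure_map (measurable_floorHeight f).aemeasurable
  inv := isShiftInvariant_floorLaw hf
  lipschitz := (ae_map_iff (measurable_floorHeight f).aemeasurable
    (measurableSet_isLipschitz q)).2 (Eventually.of_forall (isLipschitz_floorHeight hq hfq))

theorem IsLipschitzMeasure.integrable {μ : Measure (HeightFunction d ℤ)}
    (hμ : IsLipschitzMeasure L q μ) (x y : Site d) :
    Integrable (fun φ : HeightFunction d ℤ => HeightSpace.toReal (φ y - φ x)) μ := by
  have := hμ.prob
  refine Integrable.mono' (integrable_const ((⌈|q x y| + |q y x|⌉ : ℤ) : ℝ))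
    (measurable_toReal_gradient x y).aestronglyMeasurable (hμ.lipschitz.mono fun φ hφ => ?_)
  have h := hφ.abs_le x y
  rw [Real.norm_eq_abs]
  change |((φ y - φ x : ℤ) : ℝ)| ≤ _
  exact_mod_cast h

/-- The mean fractional part of `t + a` over a full period does not depend on `a`, so rounding does
not change mean increments. -/
theorem hasSlope_floorLaw (hq : ∀ x y, ∃ k : ℤ, q x y = k)
    (hfq : ∀ x y, f y - f x ≤ q x y) {u : Slope d}
    (hf : ∀ x, ∀ v ∈ L, f (x + v) = f x + u (toVec v)) : HasSlope L (floorLaw f) u := by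
  have := isProbabilityMeasure_unif one_pos
  refine ⟨(isLipschitzMeasure_floorLaw hq hfq hf).integrable, fun x hx => ?_⟩
  rw [floorLaw, integral_map (measurable_floorHeight f).aemeasurable
    (measurable_toReal_gradient 0 x).aestronglyMeasurable]
  have h1 : ∀ t, HeightSpace.toReal (floorHeight f t x - floorHeight f t 0) =
      u (toVec x) - Int.fract (t + f x) + Int.fract (t + f 0) := fun t => by
    have h2 := hf 0 x hx
    rw [zero_add] at h2
    change ((⌊t + f x⌋ - ⌊t + f 0⌋ : ℤ) : ℝ) = _
    rw [Int.fract, Int.fract, h2]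
    push_cast
    ring
  have h3 : ∀ a : ℝ, Integrable (fun t : ℝ => Int.fract (t + a)) (unif 1) := fun a =>
    Integrable.mono' (integrable_const 1)
      (measurable_fract.comp (measurable_id.add_const a)).aestronglyMeasurable
      (Eventually.of_forall fun t => by
        rw [Real.norm_eq_abs, abs_of_nonneg (Int.fract_nonneg _)]
        exact (Int.fract_lt_one _).le)
  have h4 : ∀ a : ℝ, ∫ t, Int.fract (t + a) ∂unif 1 = ∫ t, Int.fract t ∂unif 1 :=
    integral_unif_one_add (Int.fract_periodic ℝ)
  rw [integral_congr_ae (Eventually.of_forall h1), integral_add (f := fun t =>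
    u (toVec x) - Int.fract (t + f x)) ((integrable_const _).sub (h3 _)) (h3 _),
    integral_sub (integrable_const _) (h3 _), h4, h4]
  simp

/-- No room below the constraint is needed, so slopes on the boundary are included. This keeps the
surface tension bounded up to the boundary, unlike for real heights. -/
theorem exists_isLipschitzMeasure {A : SimpleGraph (Site d)}
    (h : IsLocalLipschitzConstraint L A q) (hq : ∀ x y, ∃ k : ℤ, q x y = k) {u : Slope d}
    (hu : u ∈ slopeSet L q) : ∃ μ, IsLipschitzMeasure L q μ ∧ HasSlope L μ u := by
  obtain ⟨f, hf, hfA⟩ := exists_equivariant h.graph h.quasimetric.periodic u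
    fun n a v hv s hs => (h.quasimetric.slope_le hu a hv).trans
      (le_weight_of_hasWalk (fun x => (h.quasimetric.self x).le) h.quasimetric.triangle
        (fun _ _ _ => le_rfl) hs)
  exact ⟨_, isLipschitzMeasure_floorLaw hq (h.le_of_edges hfA) hf,
    hasSlope_floorLaw hq (h.le_of_edges hfA) hf⟩

end Floor

/-! ## Convexity of the free energy -/

section Mixture

variable {d : ℕ} {L : AddSubgroup (Site d)} {q : Site d → Site d → ℝ} {Φ : Potential d ℤ}
  {K C : ℝ} {e : ℕ → ℝ} {m : ℕ} {μ μ₀ μ₁ : Measure (HeightFunction d ℤ)} {t : ℝ}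

/-- The mixture of two measures. -/
noncomputable def mixture (t : ℝ) (μ₀ μ₁ : Measure (HeightFunction d ℤ)) :
    Measure (HeightFunction d ℤ) :=
  ENNReal.ofReal (1 - t) • μ₀ + ENNReal.ofReal t • μ₁

theorem IsLipschitzMeasure.mixture (h₀ : IsLipschitzMeasure L q μ₀)
    (h₁ : IsLipschitzMeasure L q μ₁) (ht0 : 0 ≤ t) (ht1 : t ≤ 1) :
    IsLipschitzMeasure L q (mixture t μ₀ μ₁) where
  prob := ⟨by
    have := h₀.prob
    have := h₁.prob
    simp only [LipschitzSurface.mixture, Measure.add_apply, Measure.smul_apply, measure_univ,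
      smul_eq_mul, mul_one]
    rw [← ENNReal.ofReal_add (by linarith) ht0]
    simp⟩
  inv v hv := by
    rw [LipschitzSurface.mixture, Measure.map_add _ _ (measurable_shift v), Measure.map_smul,
      Measure.map_smul, h₀.inv v hv, h₁.inv v hv]
  lipschitz := by
    rw [LipschitzSurface.mixture, ae_add_measure_iff]
    exact ⟨Measure.ae_smul_measure h₀.lipschitz _, Measure.ae_smul_measure h₁.lipschitz _⟩

theorem integrable_mixture {g : HeightFunction d ℤ → ℝ} (h₀ : Integrable g μ₀)
    (h₁ : Integrable g μ₁) : Integrable g (mixture t μ₀ μ₁) :=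
  (h₀.smul_measure ENNReal.ofReal_ne_top).add_measure (h₁.smul_measure ENNReal.ofReal_ne_top)

theorem integral_mixture (ht0 : 0 ≤ t) (ht1 : t ≤ 1) {g : HeightFunction d ℤ → ℝ}
    (h₀ : Integrable g μ₀) (h₁ : Integrable g μ₁) :
    ∫ φ, g φ ∂mixture t μ₀ μ₁ = (1 - t) * ∫ φ, g φ ∂μ₀ + t * ∫ φ, g φ ∂μ₁ := by
  rw [mixture, integral_add_measure (h₀.smul_measure ENNReal.ofReal_ne_top)
    (h₁.smul_measure ENNReal.ofReal_ne_top), integral_smul_measure, integral_smul_measure,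
    ENNReal.toReal_ofReal (by linarith), ENNReal.toReal_ofReal ht0, smul_eq_mul, smul_eq_mul]

/-- Gibbs' inequality for the free energies of measures on Lipschitz functions. -/
theorem IsTameModel.integral_log_add_le (hM : IsTameModel L q Φ K C e m)
    (hμ : IsLipschitzMeasure L q μ) {n : ℕ} (hn : 1 ≤ n) {ρ : HeightFunction d ℤ → ℝ≥0∞}
    (hρ : Measurable[gradientAlgebra (box d n : Set (Site d))] ρ)
    (hρ1 : @lintegral _ (gradientAlgebra (box d n : Set (Site d))) (gradientRef (box d n) 0) ρ ≤ 1)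
    (hpos : ∀ᵐ φ ∂μ, ρ φ ≠ 0) (hint : Integrable (fun φ => Real.log (ρ φ).toReal) μ) :
    ∫ φ, Real.log (ρ φ).toReal ∂μ + ∫ φ, energy Φ (box d n) φ ∂μ ≤ realFreeEnergy Φ n μ := by
  have := hμ.prob
  have ht := hM.isTameMeasure hμ
  have key := freeEnergy_ge (Φ := Φ) (μ := μ) hM.potential (zero_mem_box hn)
    (B := energy Φ (box d n)) hρ hρ1 hpos hint (hM.potential.measurable_energy _)
    (fun φ => EReal.coe_toReal_le (hM.potential.interiorHamiltonian_ne_bot _ _))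
    (ht.integrable_energy hM.potential hM.bound_nonneg _)
  rwa [ht.freeEnergy_eq hM.potential hM.step_nonneg hM.bound_nonneg le_rfl hn,
    EReal.coe_le_coe_iff] at key

/-- The density of the mixture serves as trial density for both components. Its logarithm and the
energy integrate affinely over the mixture, so the two Gibbs bounds combine to the claim. -/
theorem IsTameModel.realFreeEnergy_mixture_le (hM : IsTameModel L q Φ K C e m)
    (h₀ : IsLipschitzMeasure L q μ₀) (h₁ : IsLipschitzMeasure L q μ₁) (ht0 : 0 < t) (ht1 : t < 1)
    {n : ℕ} (hn : 1 ≤ n) :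
    realFreeEnergy Φ n (mixture t μ₀ μ₁) ≤
      (1 - t) * realFreeEnergy Φ n μ₀ + t * realFreeEnergy Φ n μ₁ := by
  have h := h₀.mixture h₁ ht0.le ht1.le
  have := h.prob
  obtain ⟨hac, hint, -⟩ := (hM.isTameMeasure h).logDensity hM.step_nonneg le_rfl hn
  have hpos := (density_pos (zero_mem_box hn) hac).mono fun φ hφ => hφ.1
  have hint0 : Integrable (logDensity (box d n) (mixture t μ₀ μ₁)) μ₀ := by
    have h2 := hint.mono_measure (μ := ENNReal.ofReal (1 - t) • μ₀) (Measure.le_add_right le_rfl)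
    exact (integrable_smul_measure (ENNReal.ofReal_pos.2 (by linarith)).ne'
      ENNReal.ofReal_ne_top).1 h2
  have hint1 : Integrable (logDensity (box d n) (mixture t μ₀ μ₁)) μ₁ := by
    have h2 := hint.mono_measure (μ := ENNReal.ofReal t • μ₁) (Measure.le_add_left le_rfl)
    exact (integrable_smul_measure (ENNReal.ofReal_pos.2 ht0).ne' ENNReal.ofReal_ne_top).1 h2
  have hpos' := hpos
  rw [mixture, ae_add_measure_iff, Measure.ae_ennreal_smul_measure_iff
    (ENNReal.ofReal_pos.2 (by linarith)).ne', Measure.ae_ennreal_smul_measure_iff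
    (ENNReal.ofReal_pos.2 ht0).ne'] at hpos'
  have g0 := hM.integral_log_add_le h₀ hn (measurable_density (box d n) (mixture t μ₀ μ₁))
    (lintegral_density_le_one _) hpos'.1 hint0
  have g1 := hM.integral_log_add_le h₁ hn (measurable_density (box d n) (mixture t μ₀ μ₁))
    (lintegral_density_le_one _) hpos'.2 hint1
  have i0 := (hM.isTameMeasure h₀).integrable_energy hM.potential hM.bound_nonneg (box d n)
  have i1 := (hM.isTameMeasure h₁).integrable_energy hM.potential hM.bound_nonneg (box d n)
  rw [realFreeEnergy, integral_mixture ht0.le ht1.le hint0 hint1,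
    integral_mixture ht0.le ht1.le i0 i1]
  simp only [← logDensity_eq] at g0 g1
  nlinarith [mul_le_mul_of_nonneg_left g0 (by linarith : 0 ≤ 1 - t),
    mul_le_mul_of_nonneg_left g1 ht0.le]

theorem hasSlope_mixture {u₀ u₁ : Slope d} (ht0 : 0 ≤ t) (ht1 : t ≤ 1) (h₀ : HasSlope L μ₀ u₀)
    (h₁ : HasSlope L μ₁ u₁) : HasSlope L (mixture t μ₀ μ₁) ((1 - t) • u₀ + t • u₁) := by
  refine ⟨fun x y => integrable_mixture (h₀.1 x y) (h₁.1 x y), fun x hx => ?_⟩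
  rw [integral_mixture ht0 ht1 (h₀.1 0 x) (h₁.1 0 x), ← h₀.2 x hx, ← h₁.2 x hx]
  rfl

end Mixture

/-! ## Upper semicontinuity of the surface tension, for integral heights -/

section UpperSemicontinuity

variable {d : ℕ} {L : AddSubgroup (Site d)} {A : SimpleGraph (Site d)}
  {q : Site d → Site d → ℝ} {Φ : Potential d ℤ}
  {K C : ℝ} {e : ℕ → ℝ} {m : ℕ} {u w : Slope d}

theorem IsTameModel.exists_of_surfaceTension_lt (hM : IsTameModel L q Φ K C e m) {z : ℝ}
    (hz : surfaceTension L Φ u < z) :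
    ∃ μ, IsLipschitzMeasure L q μ ∧ HasSlope L μ u ∧ ∃ h : ℝ, h < z ∧
      Tendsto (fun n : ℕ => realFreeEnergy Φ n μ / (n : ℝ) ^ d) atTop (𝓝 h) ∧
      ∀ l, 1 ≤ l → boxBound d m (Real.log (2 * K + 1)) C e l
        (realFreeEnergy Φ l μ / (l : ℝ) ^ d) ≤ h := by
  obtain ⟨h', ⟨μ, hprob, hinv, hslope, hh'⟩, hlt⟩ := sInf_lt_iff.1 hz
  have hμ := hM.lipschitz_of_lt_top μ hprob hinv h' hh' (hlt.trans (EReal.coe_lt_top z))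
  obtain ⟨h, h1, h2, -, -, h3⟩ := hM.exists_limit hμ
  have heq : h' = h := tendsto_nhds_unique hh' h3
  exact ⟨μ, hμ, hslope, h, EReal.coe_lt_coe_iff.1 (heq ▸ hlt), h1, h2⟩

theorem IsTameModel.surfaceTension_le (hM : IsTameModel L q Φ K C e m)
    {μ : Measure (HeightFunction d ℤ)} (hμ : IsLipschitzMeasure L q μ) (hu : HasSlope L μ u) {h : ℝ}
    (hh : Tendsto (fun n : ℕ => realFreeEnergy Φ n μ / (n : ℝ) ^ d) atTop (𝓝 h)) :
    surfaceTension L Φ u ≤ h := by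
  obtain ⟨h', h1, -, -, -, h3⟩ := hM.exists_limit hμ
  rw [tendsto_nhds_unique hh h1]
  exact sInf_le ⟨μ, hμ.prob, hμ.inv, hu, h3⟩

theorem IsTameModel.surfaceTension_ge (hM : IsTameModel L q Φ K C e m) :
    ((-(Real.log (2 * K + 1) + C) : ℝ) : EReal) ≤ surfaceTension L Φ u := by
  refine le_sInf ?_
  rintro h' ⟨μ, hprob, hinv, -, hh'⟩
  rcases eq_or_ne h' ⊤ with rfl | htop
  · exact le_top
  obtain ⟨h, -, -, -, h2, h3⟩ := hM.exists_limit
    (hM.lipschitz_of_lt_top μ hprob hinv h' hh' (lt_top_iff_ne_top.2 htop))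
  rw [tendsto_nhds_unique hh' h3]
  exact EReal.coe_le_coe_iff.2 h2

theorem IsTameModel.surfaceTension_le_const (hM : IsTameModel L q Φ K C e m)
    (hA : IsLocalLipschitzConstraint L A q) (hq : ∀ x y, ∃ k : ℤ, q x y = k)
    (hu : u ∈ slopeSet L q) : surfaceTension L Φ u ≤ C := by
  obtain ⟨μ, hμ, hslope⟩ := exists_isLipschitzMeasure hA hq hu
  obtain ⟨h, h1, -, h2, -⟩ := hM.exists_limit hμ
  exact (hM.surfaceTension_le hμ hslope h1).trans (EReal.coe_le_coe_iff.2 h2)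

/-- A slope `u` near `w` equals `(1 - t) • w + t • u₁` with `u₁ = w + t⁻¹ • (u - w)`, which stays in
the polyhedron when `‖u - w‖ ≤ δ * t`. Mixing a fixed nearly optimal measure at `w` with any
Lipschitz measure at `u₁` costs at most `(1 - t) * h₀ + t * C`, close to `h₀` for small `t`. -/
theorem IsTameModel.eventually_surfaceTension_lt [L.FiniteIndex] (hM : IsTameModel L q Φ K C e m)
    (hA : IsLocalLipschitzConstraint L A q) (hq : ∀ x y, ∃ k : ℤ, q x y = k)
    (hw : w ∈ slopeSet L q) {y : EReal} (hy : surfaceTension L Φ w < y) :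
    ∀ᶠ u in 𝓝[slopeSet L q] w, surfaceTension L Φ u < y := by
  obtain ⟨z, hz, hzy⟩ := EReal.lt_iff_exists_real_btwn.1 hy
  obtain ⟨μ₀, hμ₀, hslope₀, h₀, hlt₀, hlim₀, -⟩ := hM.exists_of_surfaceTension_lt hz
  obtain ⟨δ, hδ, hcone⟩ := slopeSet_locally_conical hA hw
  have hcont : Tendsto (fun t : ℝ => (1 - t) * h₀ + t * C) (𝓝[>] 0) (𝓝 h₀) := by
    have : Continuous fun t : ℝ => (1 - t) * h₀ + t * C := by fun_prop
    simpa using (this.tendsto 0).mono_left nhdsWithin_le_nhds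
  obtain ⟨t, ⟨ht, ht1⟩, ht0⟩ := ((hcont.eventually (gt_mem_nhds hlt₀)).and
    ((Iio_mem_nhds one_pos : Iio (1 : ℝ) ∈ 𝓝 0) |> fun h => mem_nhdsWithin_of_mem_nhds h) |>.and
    self_mem_nhdsWithin).exists
  have ht0 : 0 < t := ht0
  have ht1 : t < 1 := ht1
  have hball : Metric.closedBall w (δ * t) ∈ 𝓝[slopeSet L q] w :=
    mem_nhdsWithin_of_mem_nhds (Metric.closedBall_mem_nhds w (by positivity))
  filter_upwards [hball, self_mem_nhdsWithin] with u hu hu'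
  rw [Metric.mem_closedBall, dist_eq_norm] at hu
  obtain ⟨μ₁, hμ₁, hslope₁⟩ := exists_isLipschitzMeasure hA hq (hcone u hu' t ht0 hu)
  have hμ := hμ₀.mixture hμ₁ ht0.le ht1.le
  have hslope := hasSlope_mixture ht0.le ht1.le hslope₀ hslope₁
  have hcomb : (1 - t) • w + t • (w + t⁻¹ • (u - w)) = u := by
    rw [smul_add, smul_smul, mul_inv_cancel₀ ht0.ne']
    module
  rw [hcomb] at hslope
  obtain ⟨h₁, hlim₁, -, hle₁, -⟩ := hM.exists_limit hμ₁
  obtain ⟨h, hlim, -⟩ := hM.exists_limit hμ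
  have hle : h ≤ (1 - t) * h₀ + t * h₁ := by
    refine le_of_tendsto_of_tendsto hlim ((hlim₀.const_mul (1 - t)).add (hlim₁.const_mul t))
      ((eventually_ge_atTop 1).mono fun n hn => ?_)
    have h2 := hM.realFreeEnergy_mixture_le hμ₀ hμ₁ ht0 ht1 hn
    have h3 : (0 : ℝ) < (n : ℝ) ^ d := by positivity
    beta_reduce
    rw [div_le_iff₀ h3]
    refine h2.trans (le_of_eq ?_)
    field_simp
  have hlt : h < z := by nlinarith [mul_le_mul_of_nonneg_left hle₁ ht0.le]
  exact ((hM.surfaceTension_le hμ hslope hlim).trans_lt (EReal.coe_lt_coe_iff.2 hlt)).trans hzy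

end UpperSemicontinuity

/-! ## Limits of measures on integral Lipschitz functions -/

section Normalize

variable {d : ℕ}

/-- The representative of a gradient configuration that vanishes at the origin. -/
def normalize (φ : HeightFunction d ℤ) : Site d → ℤ := fun x => φ x - φ 0

theorem measurable_normalize : Measurable (normalize : HeightFunction d ℤ → Site d → ℤ) :=
  measurable_pi_lambda _ fun x => measurable_gradient 0 x

/-- The height function with the given heights. -/
def unnormalize (z : Site d → ℤ) : HeightFunction d ℤ := z

theorem measurable_unnormalize : Measurable (unnormalize : (Site d → ℤ) → HeightFunction d ℤ) :=
  measurable_of_pi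

/-- The function factors through finitely many integer coordinates, a discrete space; thus weak
convergence controls local functions. -/
theorem continuous_of_local {g : HeightFunction d ℤ → ℝ} {Λ : Finset (Site d)}
    (hg : Measurable[gradientAlgebra (Λ : Set (Site d))] g) :
    Continuous fun z : Site d → ℤ => g z := by
  have h : (fun z : Site d → ℤ => g z) = (fun p : Λ → ℤ =>
      g fun y => if h : y ∈ Λ then p ⟨y, h⟩ else 0) ∘ Λ.restrict := by
    funext z
    refine eq_of_gradient_eq hg fun x hx y hy => ?_
    simp only [Finset.mem_coe] at hx hy
    simp [hx, hy]
  rw [h]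
  exact continuous_of_discreteTopology.comp (by fun_prop)

/-- The normalized functions between Lipschitz bounds. -/
def lipschitzBox (q : Site d → Site d → ℝ) : Set (Site d → ℤ) :=
  Set.pi univ fun x => Set.Icc (-⌈|q 0 x| + |q x 0|⌉) ⌈|q 0 x| + |q x 0|⌉

theorem isCompact_lipschitzBox (q : Site d → Site d → ℝ) : IsCompact (lipschitzBox q) :=
  isCompact_univ_pi fun _ => (Set.finite_Icc _ _).isCompact

end Normalize

/-! ### Local limits of Lipschitz measures -/

section Compactness

variable {d : ℕ} {L : AddSubgroup (Site d)} {q : Site d → Site d → ℝ}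

/-- The limit of local functions under a convergent family of measures. -/
def TendstoLocally {ι : Type*} (μ : ι → Measure (HeightFunction d ℤ)) (F : Filter ι)
    (μ' : Measure (HeightFunction d ℤ)) : Prop :=
  ∀ (Λ : Finset (Site d)) (g : HeightFunction d ℤ → ℝ),
    Measurable[gradientAlgebra (Λ : Set (Site d))] g → (∃ M : ℝ, ∀ φ, |g φ| ≤ M) →
      Tendsto (fun i => ∫ φ, g φ ∂μ i) F (𝓝 (∫ φ, g φ ∂μ'))

/-- Lipschitz functions normalised at the origin lie in a compact product of finite intervals, so
their laws lie in a compact set of probability measures and converge weakly along any ultrafilter.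
-/
theorem exists_tendstoLocally {ι : Type*} (U : Ultrafilter ι) {μ : ι → Measure (HeightFunction d ℤ)}
    (hμ : ∀ i, IsLipschitzMeasure L q (μ i)) :
    ∃ μ', IsProbabilityMeasure μ' ∧ IsShiftInvariant L μ' ∧ TendstoLocally μ U μ' := by
  have hprob : ∀ i, IsProbabilityMeasure ((μ i).map normalize) := fun i =>
    have := (hμ i).prob
    Measure.isProbabilityMeasure_map measurable_normalize.aemeasurable
  obtain ⟨ν, hν⟩ : ∃ ν : ι → ProbabilityMeasure (Site d → ℤ),
      ∀ i, (ν i : Measure (Site d → ℤ)) = (μ i).map normalize :=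
    ⟨fun i => ⟨_, hprob i⟩, fun i => rfl⟩
  have hT := isCompact_setOfPred_probabilityMeasure_mass_eq_compl_isCompact_le
    (u := fun _ : ℕ => 0) (K := fun _ => lipschitzBox q) tendsto_const_nhds
    (fun _ => isCompact_lipschitzBox q) (Or.inr monotone_const)
  have hmem : ∀ i, ν i ∈ {ν : ProbabilityMeasure (Site d → ℤ) |
      ∀ _ : ℕ, ν (lipschitzBox q)ᶜ ≤ 0} := by
    intro i _
    have h1 : (ν i : Measure (Site d → ℤ)) (lipschitzBox q)ᶜ = 0 := by
      rw [hν]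
      have h2 : ∀ᵐ z ∂(μ i).map normalize, z ∈ lipschitzBox q :=
        (ae_map_iff measurable_normalize.aemeasurable
          (isCompact_lipschitzBox q).isClosed.measurableSet).2
          ((hμ i).lipschitz.mono fun φ hφ x _ => abs_le.1 (hφ.abs_le 0 x))
      exact mem_ae_iff.1 h2
    rw [← ENNReal.coe_le_coe, ProbabilityMeasure.ennreal_coeFn_eq_coeFn_toMeasure, h1]
    simp
  obtain ⟨ν', -, hν'⟩ := hT.ultrafilter_le_nhds (U.map ν)
    (le_principal_iff.2 (Filter.mem_map.2 (Filter.univ_mem' hmem)))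
  have hlim : Tendsto ν U (𝓝 ν') := hν'
  refine ⟨(ν' : Measure (Site d → ℤ)).map unnormalize,
    Measure.isProbabilityMeasure_map measurable_unnormalize.aemeasurable, fun v hv => ?_,
    fun Λ g hg hM => ?_⟩
  -- For the normalised laws, invariance under `v` says that `z - z 0` and `z (· + v) - z v` have
  -- the same law. Both maps are continuous, so the identity passes to the weak limit.
  · have ha : Continuous fun (z : Site d → ℤ) (x : Site d) => z x - z 0 := by fun_prop
    have hb : Continuous fun (z : Site d → ℤ) (x : Site d) => z (x + v) - z v := by fun_prop
    have h1 : ∀ i, (ν i).map ha.measurable.aemeasurable = (ν i).map hb.measurable.aemeasurable := by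
      intro i
      refine Subtype.ext ?_
      change (ν i : Measure (Site d → ℤ)).map _ = (ν i : Measure (Site d → ℤ)).map _
      rw [hν, Measure.map_map ha.measurable measurable_normalize,
        Measure.map_map hb.measurable measurable_normalize]
      conv_lhs => rw [← (hμ i).inv v hv]
      rw [Measure.map_map (ha.measurable.comp measurable_normalize) (measurable_shift v)]
      congr 1
      funext φ x
      simp [normalize, shift]
    have h2 := tendsto_nhds_unique
      (((ProbabilityMeasure.continuous_map ha).tendsto ν').comp hlim)
      ((((ProbabilityMeasure.continuous_map hb).tendsto ν').comp hlim).congr fun i => (h1 i).symm)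
    have h3 : (ν' : Measure (Site d → ℤ)).map (fun (z : Site d → ℤ) (x : Site d) => z x - z 0) =
        (ν' : Measure (Site d → ℤ)).map (fun (z : Site d → ℤ) (x : Site d) => z (x + v) - z v) :=
      congrArg Subtype.val h2
    have hid : Measurable (unnormalize : _ → HeightFunction d ℤ) := measurable_unnormalize
    have h4 := congrArg (Measure.map unnormalize) h3
    rw [Measure.map_map hid ha.measurable, Measure.map_map hid hb.measurable] at h4
    rw [Measure.map_map (measurable_shift v) hid]
    refine (map_eq_of_gradient_eq ((measurable_shift v).comp hid) (hid.comp hb.measurable)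
      fun z x y => ?_).trans (h4.symm.trans (map_eq_of_gradient_eq (hid.comp ha.measurable) hid
        fun z x y => ?_))
    · simp [shift, unnormalize]
    · simp [unnormalize]
  · obtain ⟨M, hM⟩ := hM
    have hgm := hg.mono (gradientAlgebra_le _) le_rfl
    have h1 := (ProbabilityMeasure.tendsto_iff_forall_integral_tendsto.1 hlim)
      (BoundedContinuousFunction.ofNormedAddCommGroup _ (continuous_of_local hg) M hM)
    rw [integral_map measurable_unnormalize.aemeasurable hgm.aestronglyMeasurable]
    refine h1.congr fun i => ?_
    change ∫ z, g z ∂(ν i : Measure (Site d → ℤ)) = _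
    rw [hν, integral_map measurable_normalize.aemeasurable
      (continuous_of_local hg).measurable.aestronglyMeasurable]
    refine integral_congr_ae (Eventually.of_forall fun φ => ?_)
    exact eq_of_eq_add_const hg (φ 0) fun x _ => by simp [normalize]

variable {ι : Type*} {F : Filter ι} {μ : ι → Measure (HeightFunction d ℤ)}
  {μ' : Measure (HeightFunction d ℤ)}

/-- The indicator of the constraint between two vertices is a bounded local function, so its mean,
equal to one along the family, is one in the limit. -/
theorem TendstoLocally.isLipschitzMeasure [F.NeBot] (h : TendstoLocally μ F μ')
    (hμ : ∀ i, IsLipschitzMeasure L q (μ i)) (hprob : IsProbabilityMeasure μ')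
    (hinv : IsShiftInvariant L μ') : IsLipschitzMeasure L q μ' := by
  refine ⟨hprob, hinv, ?_⟩
  simp only [IsLipschitz]
  rw [ae_all_iff]; intro x
  rw [ae_all_iff]; intro y
  have hS : MeasurableSet[gradientAlgebra (({x, y} : Finset (Site d)) : Set (Site d))]
      {φ : HeightFunction d ℤ | ((φ y - φ x : ℤ) : ℝ) ≤ q x y} := by
    have h1 : Measurable[gradientAlgebra (({x, y} : Finset (Site d)) : Set (Site d))]
        fun φ : HeightFunction d ℤ => φ y - φ x := measurable_sub_apply (by simp) (by simp)
    exact h1 (t := {k : ℤ | (k : ℝ) ≤ q x y}) (MeasurableSet.of_discrete)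
  have hS' := gradientAlgebra_le (E := ℤ) _ _ hS
  have h2 := h {x, y} ({φ : HeightFunction d ℤ | ((φ y - φ x : ℤ) : ℝ) ≤ q x y}.indicator
    fun _ => 1) (Measurable.indicator measurable_const hS) ⟨1, fun φ => by
      by_cases hφ : φ ∈ {φ : HeightFunction d ℤ | ((φ y - φ x : ℤ) : ℝ) ≤ q x y}
      · rw [indicator_of_mem hφ, abs_one]
      · rw [indicator_of_notMem hφ, abs_zero]; exact zero_le_one⟩
  have h3 : ∀ i, ∫ φ, {φ : HeightFunction d ℤ | ((φ y - φ x : ℤ) : ℝ) ≤ q x y}.indicator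
      (fun _ => (1 : ℝ)) φ ∂μ i = 1 := fun i => by
    have := (hμ i).prob
    rw [integral_congr_ae (g := fun _ => 1) ((hμ i).lipschitz.mono fun φ hφ =>
      indicator_of_mem (s := {φ : HeightFunction d ℤ | ((φ y - φ x : ℤ) : ℝ) ≤ q x y}) (hφ x y) _)]
    simp
  simp only [h3] at h2
  have h4 := tendsto_nhds_unique h2 tendsto_const_nhds
  rw [integral_indicator_const _ hS', smul_eq_mul, mul_one, measureReal_def] at h4
  have h5 : μ' {φ : HeightFunction d ℤ | ((φ y - φ x : ℤ) : ℝ) ≤ q x y} = 1 :=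
    (ENNReal.toReal_eq_one_iff _).1 h4
  exact (prob_compl_eq_zero_iff hS').2 h5

/-- Truncating `g` at `|M|` makes it bounded everywhere and changes nothing on Lipschitz functions.
-/
theorem TendstoLocally.tendsto_integral (h : TendstoLocally μ F μ')
    (hμ : ∀ i, IsLipschitzMeasure L q (μ i)) (hμ' : IsLipschitzMeasure L q μ')
    {Λ : Finset (Site d)} {g : HeightFunction d ℤ → ℝ}
    (hg : Measurable[gradientAlgebra (Λ : Set (Site d))] g) {M : ℝ}
    (hM : ∀ φ, IsLipschitz q φ → |g φ| ≤ M) :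
    Tendsto (fun i => ∫ φ, g φ ∂μ i) F (𝓝 (∫ φ, g φ ∂μ')) := by
  have h1 : ∀ φ, IsLipschitz q φ → max (-|M|) (min |M| (g φ)) = g φ := fun φ hφ => by
    have h2 := abs_le.1 ((hM φ hφ).trans (le_abs_self M))
    rw [min_eq_right h2.2, max_eq_right h2.1]
  have h2 := h Λ (fun φ => max (-|M|) (min |M| (g φ)))
    (measurable_const.max (measurable_const.min hg)) ⟨|M|, fun φ => abs_le.2
      ⟨le_max_left _ _, max_le (by linarith [abs_nonneg M]) (min_le_left _ _)⟩⟩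
  rw [integral_congr_ae (hμ'.lipschitz.mono h1)] at h2
  exact h2.congr fun i => integral_congr_ae ((hμ i).lipschitz.mono h1)

theorem TendstoLocally.hasSlope [F.NeBot] (h : TendstoLocally μ F μ')
    (hμ : ∀ i, IsLipschitzMeasure L q (μ i)) (hμ' : IsLipschitzMeasure L q μ') {u : ι → Slope d}
    (hu : ∀ i, HasSlope L (μ i) (u i)) {w : Slope d} (huw : Tendsto u F (𝓝 w)) :
    HasSlope L μ' w := by
  refine ⟨hμ'.integrable, fun x hx => ?_⟩
  have h1 : Measurable[gradientAlgebra (({0, x} : Finset (Site d)) : Set (Site d))]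
      fun φ : HeightFunction d ℤ => HeightSpace.toReal (φ x - φ 0) :=
    IsRegularHeight.measurable_toReal.comp (measurable_sub_apply (by simp) (by simp))
  have h2 := h.tendsto_integral hμ hμ' h1 (M := (⌈|q 0 x| + |q x 0|⌉ : ℤ)) fun φ hφ => by
    have h := hφ.abs_le 0 x
    change |((φ x - φ 0 : ℤ) : ℝ)| ≤ _
    exact_mod_cast h
  have h3 : Tendsto (fun i => u i (toVec x)) F (𝓝 (w (toVec x))) :=
    ((ContinuousLinearMap.apply ℝ ℝ (toVec x)).continuous.tendsto w).comp huw
  exact tendsto_nhds_unique h3 (h2.congr fun i => ((hu i).2 x hx).symm)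

end Compactness

/-! ### A trial density bounded away from zero on Lipschitz functions -/

section RootDensity

variable {d : ℕ} {E : Type} [AddCommGroup E] [MeasurableSpace E] [HeightSpace E]
  [IsRegularHeight E]

/-- The density of independent uniform heights. -/
noncomputable def rootDensity (n : ℕ) (K : ℝ) (φ : HeightFunction d E) : ℝ≥0∞ :=
  ∏ x ∈ (box d n).erase 0, unifDensity E K (φ x - φ 0)

theorem measurable_rootDensity {n : ℕ} (hn : 1 ≤ n) (K : ℝ) :
    Measurable[gradientAlgebra (box d n : Set (Site d))]
      (rootDensity n K : HeightFunction d E → ℝ≥0∞) :=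
  Finset.measurable_prod (m := gradientAlgebra (box d n : Set (Site d))) _ fun x hx =>
    (measurable_unifDensity K).comp (measurable_sub_apply (by exact_mod_cast zero_mem_box hn)
      (by exact_mod_cast Finset.mem_of_mem_erase hx))

theorem lintegral_rootDensity_le_one {n : ℕ} (hn : 1 ≤ n) {K : ℝ} (hK : 0 ≤ K) :
    @lintegral _ (gradientAlgebra (box d n : Set (Site d))) (gradientRef (box d n) 0)
      (rootDensity n K : HeightFunction d E → ℝ≥0∞) ≤ 1 := by
  rw [← lmarginal_gradient (zero_mem_box hn) (measurable_rootDensity hn K) 0 0]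
  simp only [add_zero]
  have := IsRegularHeight.sigmaFinite (E := E)
  have := IsRegularHeight.measurableAdd (E := E)
  have := IsRegularHeight.measurableNeg (E := E)
  have := IsRegularHeight.invariant (E := E)
  have key := lmarginal_prod_le_one (μ := fun _ : Site d => (HeightSpace.ref : Measure E))
    ((box d n).erase 0) (fun _ => 0) (fun x => {x}) (fun x φ => unifDensity E K (φ x - φ 0))
    (fun x => (measurable_unifDensity K).comp ((measurable_pi_apply x).sub (measurable_pi_apply 0)))
    (fun x _ y _ hxy => by simpa using hxy) (fun i _ j hj hij _ φ y => ?_)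
    (fun x hx φ => ?_) 0
  · simpa [rootDensity] using key
  · have h0 : (0 : Site d) ≠ j := (Finset.ne_of_mem_erase hj).symm
    simp [Function.updateFinset, hij, h0]
  · rw [lmarginal_singleton]
    have h0 : (0 : Site d) ≠ x := (Finset.ne_of_mem_erase hx).symm
    simp only [Function.update_self, Function.update_of_ne h0]
    simp only [sub_eq_add_neg]
    rw [lintegral_add_right_eq_self (fun t => unifDensity E K t)]
    exact lintegral_unifDensity_le_one hK

theorem rootDensity_of_le {n : ℕ} {K : ℝ} {φ : HeightFunction d E}
    (h : ∀ x ∈ box d n, |HeightSpace.toReal (φ x - φ 0)| ≤ K) :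
    rootDensity n K φ = ENNReal.ofReal (2 * K + 1)⁻¹ ^ ((box d n).erase 0).card := by
  rw [rootDensity, Finset.prod_congr rfl (g := fun _ => ENNReal.ofReal (2 * K + 1)⁻¹) fun x hx => ?_,
    Finset.prod_const]
  exact unifDensity_of_le (h x (Finset.mem_of_mem_erase hx))

end RootDensity

/-! ## Lower semicontinuity of the surface tension, for integral heights -/

section LowerSemicontinuity

variable {d : ℕ} {L : AddSubgroup (Site d)} {A : SimpleGraph (Site d)}
  {q : Site d → Site d → ℝ} {Φ : Potential d ℤ}
  {K C : ℝ} {e : ℕ → ℝ} {m : ℕ} {u w : Slope d} {μ : Measure (HeightFunction d ℤ)}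

/-- Every measure on Lipschitz functions has an almost optimal trial density which is bounded on
Lipschitz functions. -/
theorem IsTameModel.exists_bounded_density (hM : IsTameModel L q Φ K C e m)
    (hμ : IsLipschitzMeasure L q μ) {n : ℕ} (hn : 1 ≤ n) {ε : ℝ} (hε : 0 < ε) :
    ∃ ρ : HeightFunction d ℤ → ℝ≥0∞, Measurable[gradientAlgebra (box d n : Set (Site d))] ρ ∧
      @lintegral _ (gradientAlgebra (box d n : Set (Site d))) (gradientRef (box d n) 0) ρ ≤ 1 ∧
      (∃ M : ℝ, ∀ φ, IsLipschitz q φ → ρ φ ≠ 0 ∧ |Real.log (ρ φ).toReal| ≤ M) ∧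
      ∫ φ, logDensity (box d n) μ φ ∂μ - ε ≤ ∫ φ, Real.log (ρ φ).toReal ∂μ := by
  have := hμ.prob
  have ht := hM.isTameMeasure hμ
  obtain ⟨ρ', p1, p2, p3, p4, -⟩ := exists_product_density hμ.inv hn hM.step_nonneg
    (ht.tame.mono fun φ hφ => hφ.step)
  obtain ⟨hac, hint, hlog⟩ := logDensity_integrable (zero_mem_box hn) (c := 1 ^ n ^ d)
    (by norm_num) (ht.density_le n hn) p1 p2 p3 p4
  obtain ⟨K', hK', hbox⟩ : ∃ K' : ℝ, 0 ≤ K' ∧ ∀ φ : HeightFunction d ℤ, IsLipschitz q φ →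
      ∀ x ∈ box d n, |HeightSpace.toReal (φ x - φ 0)| ≤ K' := by
    refine ⟨∑ x ∈ box d n, |((⌈|q 0 x| + |q x 0|⌉ : ℤ) : ℝ)|, by positivity, fun φ hφ x hx => ?_⟩
    refine le_trans ?_ (Finset.single_le_sum (f := fun x => |((⌈|q 0 x| + |q x 0|⌉ : ℤ) : ℝ)|)
      (fun _ _ => by positivity) hx)
    refine le_trans ?_ (le_abs_self _)
    have h := hφ.abs_le 0 x
    change |((φ x - φ 0 : ℤ) : ℝ)| ≤ _
    exact_mod_cast h
  obtain ⟨c, hc⟩ : ∃ c : ℝ, c = (2 * K' + 1)⁻¹ ^ ((box d n).erase 0).card := ⟨_, rfl⟩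
  have hc0 : 0 < c := by rw [hc]; positivity
  have hc1 : c ≤ 1 := by
    rw [hc]
    exact pow_le_one₀ (by positivity) (inv_le_one_of_one_le₀ (by linarith))
  have hroot : ∀ φ : HeightFunction d ℤ, IsLipschitz q φ →
      rootDensity n K' φ = ENNReal.ofReal c := fun φ hφ => by
    rw [rootDensity_of_le (hbox φ hφ), hc, ENNReal.ofReal_pow (by positivity)]
  -- Giving the root density the weight `s` keeps the trial density at least `s * c` on Lipschitz
  -- functions, while the factor `1 - s = exp (-ε)` on the true density costs exactly `ε` in the
  -- logarithm.
  obtain ⟨s, hs⟩ : ∃ s : ℝ, s = 1 - Real.exp (-ε) := ⟨_, rfl⟩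
  have hs0 : 0 < s := by rw [hs, sub_pos, Real.exp_lt_one_iff]; linarith
  have hs1 : 1 - s = Real.exp (-ε) := by rw [hs]; ring
  have hs2 : s < 1 := by linarith [Real.exp_pos (-ε)]
  -- Truncation at one leaves the density unchanged `μ`-almost everywhere, and it makes the bound
  -- hold at every Lipschitz function, as is needed to integrate against other measures.
  obtain ⟨ρ, hρ⟩ : ∃ ρ : HeightFunction d ℤ → ℝ≥0∞, ρ = fun φ =>
      ENNReal.ofReal (1 - s) * min (density (box d n) μ φ) 1 +
        ENNReal.ofReal s * rootDensity n K' φ := ⟨_, rfl⟩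
  have hm1 : Measurable[gradientAlgebra (box d n : Set (Site d))]
      fun φ => min (density (box d n) μ φ) 1 := (measurable_density _ _).min measurable_const
  have hm2 := measurable_rootDensity (E := ℤ) (d := d) hn K'
  have hρm : Measurable[gradientAlgebra (box d n : Set (Site d))] ρ := by
    rw [hρ]
    exact (hm1.const_mul _).add (hm2.const_mul _)
  have hbd : ∀ φ, IsLipschitz q φ → s * c ≤ (ρ φ).toReal ∧ (ρ φ).toReal ≤ 1 := by
    intro φ hφ
    have h1 : (ρ φ).toReal = (1 - s) * (min (density (box d n) μ φ) 1).toReal + s * c := by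
      have hne : min (density (box d n) μ φ) 1 ≠ ⊤ := ne_top_of_le_ne_top ENNReal.one_ne_top
        (min_le_right _ _)
      rw [hρ]
      beta_reduce
      rw [hroot φ hφ, ENNReal.toReal_add (ENNReal.mul_ne_top ENNReal.ofReal_ne_top hne)
        (ENNReal.mul_ne_top ENNReal.ofReal_ne_top ENNReal.ofReal_ne_top), ENNReal.toReal_mul,
        ENNReal.toReal_mul, ENNReal.toReal_ofReal hs0.le, ENNReal.toReal_ofReal hc0.le,
        ENNReal.toReal_ofReal (by linarith)]
    have h2 : (min (density (box d n) μ φ) 1).toReal ≤ 1 :=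
      ENNReal.toReal_le_of_le_ofReal zero_le_one (by rw [ENNReal.ofReal_one]; exact min_le_right _ _)
    have h3 : 0 ≤ (min (density (box d n) μ φ) 1).toReal := ENNReal.toReal_nonneg
    rw [h1]
    constructor <;> nlinarith
  have hlogbd : ∀ φ, IsLipschitz q φ → |Real.log (ρ φ).toReal| ≤ |Real.log (s * c)| := by
    intro φ hφ
    obtain ⟨h1, h2⟩ := hbd φ hφ
    have h3 : Real.log (s * c) ≤ Real.log (ρ φ).toReal := Real.log_le_log (by positivity) h1
    have h4 : Real.log (ρ φ).toReal ≤ 0 := Real.log_nonpos (le_trans (by positivity) h1) h2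
    rw [abs_of_nonpos h4, abs_of_nonpos (h3.trans h4)]
    linarith
  refine ⟨ρ, hρm, ?_, ⟨_, fun φ hφ => ⟨fun h0 => ?_, hlogbd φ hφ⟩⟩, ?_⟩
  · rw [hρ, lintegral_add_left (hm1.const_mul _), lintegral_const_mul _ hm1,
      lintegral_const_mul _ hm2]
    have h1 : @lintegral _ (gradientAlgebra (box d n : Set (Site d))) (gradientRef (box d n) 0)
        (fun φ => min (density (box d n) μ φ) 1) ≤ 1 :=
      (lintegral_mono fun φ => min_le_left _ _).trans (lintegral_density_le_one _)
    calc _ ≤ ENNReal.ofReal (1 - s) * 1 + ENNReal.ofReal s * 1 := by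
          gcongr
          exact lintegral_rootDensity_le_one hn hK'
      _ = 1 := by
          rw [mul_one, mul_one, ← ENNReal.ofReal_add (by linarith) hs0.le]
          simp
  · have h1 := (hbd φ hφ).1
    rw [h0, ENNReal.toReal_zero] at h1
    nlinarith [mul_pos hs0 hc0]
  · have hint' : Integrable (fun φ => Real.log (ρ φ).toReal) μ :=
      Integrable.mono' (integrable_const |Real.log (s * c)|)
        ((Real.measurable_log.comp hρm.ennreal_toReal).mono (gradientAlgebra_le _)
          le_rfl).aestronglyMeasurable
        (hμ.lipschitz.mono fun φ hφ => hlogbd φ hφ)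
    have h1 : ∫ φ, (logDensity (box d n) μ φ - ε) ∂μ ≤ ∫ φ, Real.log (ρ φ).toReal ∂μ := by
      refine integral_mono_ae (hint.sub (integrable_const _)) hint' ?_
      filter_upwards [density_pos (zero_mem_box hn) hac, hlog, hμ.lipschitz] with φ h1 h2 hφ
      rw [one_pow, Real.log_one, logDensity_eq, Real.log_nonpos_iff ENNReal.toReal_nonneg] at h2
      have h3 : density (box d n) μ φ ≤ 1 := by
        rw [← ENNReal.ofReal_toReal h1.2]
        exact ENNReal.ofReal_le_one.2 h2
      have h4 : 0 < (density (box d n) μ φ).toReal := ENNReal.toReal_pos h1.1 h1.2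
      have h5 : (1 - s) * (density (box d n) μ φ).toReal ≤ (ρ φ).toReal := by
        rw [hρ]
        beta_reduce
        rw [min_eq_left h3, hroot φ hφ,
          ENNReal.toReal_add (ENNReal.mul_ne_top ENNReal.ofReal_ne_top h1.2)
          (ENNReal.mul_ne_top ENNReal.ofReal_ne_top ENNReal.ofReal_ne_top), ENNReal.toReal_mul,
          ENNReal.toReal_ofReal (by linarith)]
        exact le_add_of_nonneg_right ENNReal.toReal_nonneg
      have h6 := Real.log_le_log (mul_pos (by linarith) h4) h5
      rw [Real.log_mul (by linarith) h4.ne', hs1, Real.log_exp] at h6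
      rw [logDensity_eq]
      linarith
    rw [integral_sub hint (integrable_const _)] at h1
    simpa using h1

/-- One trial density, nearly optimal for the limit and with logarithm bounded on Lipschitz
functions, is admissible for every member of the family. Its Gibbs bound is the integral of a local
function, so it converges. -/
theorem IsTameModel.eventually_realFreeEnergy_ge (hM : IsTameModel L q Φ K C e m) {ι : Type*}
    {F : Filter ι} {ν : ι → Measure (HeightFunction d ℤ)} (h : TendstoLocally ν F μ)
    (hν : ∀ i, IsLipschitzMeasure L q (ν i)) (hμ : IsLipschitzMeasure L q μ) {n : ℕ} (hn : 1 ≤ n)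
    {ε : ℝ} (hε : 0 < ε) :
    ∀ᶠ i in F, realFreeEnergy Φ n μ - ε ≤ realFreeEnergy Φ n (ν i) := by
  obtain ⟨ρ, h1, h2, ⟨M, hMρ⟩, h3⟩ := hM.exists_bounded_density hμ hn (half_pos hε)
  have hlogm : Measurable[gradientAlgebra (box d n : Set (Site d))]
      fun φ => Real.log (ρ φ).toReal := Real.measurable_log.comp h1.ennreal_toReal
  have hlim := (h.tendsto_integral hν hμ hlogm fun φ hφ => (hMρ φ hφ).2).add
    (h.tendsto_integral hν hμ (hM.potential.measurable_energy (box d n)) fun φ hφ =>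
      abs_energy_le hM.bound_nonneg (hM.tame φ hφ).strength_le _)
  have hlt : realFreeEnergy Φ n μ - ε <
      ∫ φ, Real.log (ρ φ).toReal ∂μ + ∫ φ, energy Φ (box d n) φ ∂μ := by
    rw [realFreeEnergy]
    linarith
  filter_upwards [hlim.eventually (lt_mem_nhds hlt)] with i hi
  have := (hν i).prob
  refine hi.le.trans (hM.integral_log_add_le (hν i) hn h1 h2
    ((hν i).lipschitz.mono fun φ hφ => (hMρ φ hφ).1) ?_)
  exact Integrable.mono' (integrable_const M)
    (hlogm.mono (gradientAlgebra_le _) le_rfl).aestronglyMeasurable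
    ((hν i).lipschitz.mono fun φ hφ => (hMρ φ hφ).2)

theorem monotone_boxBound (d m : ℕ) (D C : ℝ) (e : ℕ → ℝ) (l : ℕ) :
    Monotone (boxBound d m D C e l) := fun a b hab => by
  rw [boxBound, boxBound]
  gcongr

theorem continuous_boxBound (d m : ℕ) (D C : ℝ) (e : ℕ → ℝ) (l : ℕ) :
    Continuous (boxBound d m D C e l) := by
  unfold boxBound
  fun_prop

/-- Measures of free energy below `z` at slopes tending to `w` have a local limit of slope `w`. The
specific free energy need not pass to this limit directly, but for each `l` it dominates a box
bound, and box free energies are lower semicontinuous. Letting `l` grow afterwards recovers the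
specific free energy of the limit. -/
theorem IsTameModel.eventually_lt_surfaceTension (hM : IsTameModel L q Φ K C e m)
    {y : EReal} (hy : y < surfaceTension L Φ w) :
    ∀ᶠ u in 𝓝 w, y < surfaceTension L Φ u := by
  by_contra hcon
  rw [not_eventually] at hcon
  obtain ⟨z, hyz, hz⟩ := EReal.lt_iff_exists_real_btwn.1 hy
  -- Slopes of surface tension below `z` accumulate at `w`, so the neighbourhood filter pulled back
  -- to them is proper and admits a finer ultrafilter.
  have hne : (comap (Subtype.val : {u : Slope d // surfaceTension L Φ u < z} → Slope d)
      (𝓝 w)).NeBot := by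
    rw [comap_neBot_iff_frequently]
    exact hcon.mono fun u hu => ⟨⟨u, (not_lt.1 hu).trans_lt hyz⟩, rfl⟩
  have hex := fun u : {u : Slope d // surfaceTension L Φ u < z} =>
    hM.exists_of_surfaceTension_lt u.2
  choose ν hν hslope h hlt hlim hbox using hex
  obtain ⟨U, hU⟩ := Ultrafilter.exists_le
    (comap (Subtype.val : {u : Slope d // surfaceTension L Φ u < z} → Slope d) (𝓝 w))
  have huw : Tendsto (Subtype.val : {u : Slope d // surfaceTension L Φ u < z} → Slope d) U (𝓝 w) :=
    tendsto_comap.mono_left hU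
  obtain ⟨μ, hprob, hinv, hloc⟩ := exists_tendstoLocally U hν
  have hμ := hloc.isLipschitzMeasure hν hprob hinv
  have hμw := hloc.hasSlope hν hμ hslope huw
  obtain ⟨h', hlim', -, hle', hge', -⟩ := hM.exists_limit hμ
  have hbound : ∀ l, 1 ≤ l → boxBound d m (Real.log (2 * K + 1)) C e l
      (realFreeEnergy Φ l μ / (l : ℝ) ^ d) ≤ z := by
    intro l hl
    have hcont : Tendsto (fun ε : ℝ => boxBound d m (Real.log (2 * K + 1)) C e l
        ((realFreeEnergy Φ l μ - ε) / (l : ℝ) ^ d)) (𝓝[>] 0)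
        (𝓝 (boxBound d m (Real.log (2 * K + 1)) C e l (realFreeEnergy Φ l μ / (l : ℝ) ^ d))) := by
      have h1 : Continuous fun ε : ℝ => boxBound d m (Real.log (2 * K + 1)) C e l
          ((realFreeEnergy Φ l μ - ε) / (l : ℝ) ^ d) :=
        (continuous_boxBound _ _ _ _ _ _).comp (by fun_prop)
      simpa using (h1.tendsto 0).mono_left nhdsWithin_le_nhds
    refine le_of_tendsto hcont (eventually_nhdsWithin_of_forall fun ε hε => ?_)
    obtain ⟨i, hi⟩ := (hM.eventually_realFreeEnergy_ge hloc hν hμ hl hε).exists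
    refine (monotone_boxBound _ _ _ _ _ _ ?_).trans ((hbox i l hl).trans (hlt i).le)
    gcongr
  have hd := tendsto_boxBound_sub (d := d) (D := Real.log (2 * K + 1)) (C := C)
    (g := fun l => realFreeEnergy Φ l μ / (l : ℝ) ^ d)
    (M := Real.log (2 * K + 1) + C) hM.one_le hM.dim hM.tendsto_cross (fun l hl => by
      have ht := hM.isTameMeasure hμ
      have h1 := ht.realFreeEnergy_le hM.step_nonneg hM.bound_nonneg le_rfl hl
      have h2 := ht.realFreeEnergy_ge hM.potential hM.step_nonneg hM.bound_nonneg le_rfl hl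
      have h3 : (0 : ℝ) < (l : ℝ) ^ d := by positivity
      have h4 : 0 ≤ Real.log (2 * K + 1) := Real.log_nonneg (by linarith [hM.step_nonneg])
      rw [Real.log_one, zero_add] at h1
      rw [abs_le, le_div_iff₀ h3, div_le_iff₀ h3]
      constructor
      · linarith
      · nlinarith)
  have hfinal : h' ≤ z := by
    have h1 := hlim'.sub hd
    rw [sub_zero] at h1
    refine le_of_tendsto h1 ((eventually_ge_atTop 1).mono fun l hl => ?_)
    rw [sub_sub_cancel]
    exact hbound l hl
  exact absurd ((hM.surfaceTension_le hμ hμw hlim').trans (EReal.coe_le_coe_iff.2 hfinal))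
    (not_le.2 hz)

theorem integral_heights [L.FiniteIndex] {Ψ Ξ : Potential d ℤ} (hd : d ≠ 0)
    (hΨ : IsStrongInteractionInt L A q Ψ) (hΞ : IsWeakInteraction L Ξ) :
    allowableSlopes L (Ψ + Ξ) = lipschitzSlopes L q ∧
      (∃ C : ℝ, ∀ u ∈ closure (allowableSlopes L (Ψ + Ξ)),
        ((-C : ℝ) : EReal) ≤ surfaceTension L (Ψ + Ξ) u ∧
          surfaceTension L (Ψ + Ξ) u ≤ (C : EReal)) ∧
      ContinuousOn (surfaceTension L (Ψ + Ξ)) (closure (allowableSlopes L (Ψ + Ξ))) := by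
  obtain ⟨K, C, e, m, hM⟩ := exists_isTameModel hd hΨ hΞ
  have hA := hΨ.lipschitz.1
  have hle : ∀ u ∈ slopeSet L q, surfaceTension L (Ψ + Ξ) u ≤ C := fun u hu =>
    hM.surfaceTension_le_const hA hΨ.integral hu
  have h := allowableSlopes_eq hΨ.potential hΞ.potential hΨ.lipschitz fun u hu =>
    (hle u (interior_subset hu)).trans_lt (EReal.coe_lt_top C)
  have hsub : closure (allowableSlopes L (Ψ + Ξ)) ⊆ slopeSet L q := by
    rw [h]
    exact closure_minimal interior_subset (isClosed_slopeSet L q)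
  have hK : 0 ≤ Real.log (2 * K + 1) := Real.log_nonneg (by linarith [hM.step_nonneg])
  refine ⟨h, ⟨Real.log (2 * K + 1) + C, fun u hu => ⟨hM.surfaceTension_ge, (hle u (hsub hu)).trans
    (EReal.coe_le_coe_iff.2 (by linarith))⟩⟩, ContinuousOn.mono (fun w hw => ?_) hsub⟩
  exact tendsto_order.2 ⟨fun y hy => mem_nhdsWithin_of_mem_nhds (hM.eventually_lt_surfaceTension hy),
    fun y hy => hM.eventually_surfaceTension_lt hA hΨ.integral hw hy⟩

end LowerSemicontinuity

end LipschitzSurface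

theorem theorem4p8 (d : ℕ) (hd : 2 ≤ d)
    (L : AddSubgroup (LipschitzSurface.Site d)) (hL : L.FiniteIndex)
    (A : SimpleGraph (LipschitzSurface.Site d))
    (q : LipschitzSurface.Site d → LipschitzSurface.Site d → ℝ) :
    (∀ Ψ Ξ : LipschitzSurface.Potential d ℝ,
      LipschitzSurface.IsStrongInteractionReal L A q Ψ →
      LipschitzSurface.IsWeakInteraction L Ξ →
      LipschitzSurface.allowableSlopes L (Ψ + Ξ) = LipschitzSurface.lipschitzSlopes L q ∧
      Tendsto (LipschitzSurface.surfaceTension L (Ψ + Ξ))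
        (𝓝ˢ (frontier (LipschitzSurface.allowableSlopes L (Ψ + Ξ)))) (𝓝 ⊤)) ∧
    (∀ Ψ Ξ : LipschitzSurface.Potential d ℤ,
      LipschitzSurface.IsStrongInteractionInt L A q Ψ →
      LipschitzSurface.IsWeakInteraction L Ξ →
      LipschitzSurface.allowableSlopes L (Ψ + Ξ) = LipschitzSurface.lipschitzSlopes L q ∧
      (∃ C : ℝ, ∀ u ∈ closure (LipschitzSurface.allowableSlopes L (Ψ + Ξ)),
        ((-C : ℝ) : EReal) ≤ LipschitzSurface.surfaceTension L (Ψ + Ξ) u ∧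
        LipschitzSurface.surfaceTension L (Ψ + Ξ) u ≤ (C : EReal)) ∧
      ContinuousOn (LipschitzSurface.surfaceTension L (Ψ + Ξ))
        (closure (LipschitzSurface.allowableSlopes L (Ψ + Ξ)))) := by
  have hd0 : d ≠ 0 := by omega
  exact ⟨fun _ _ hΨ hΞ => LipschitzSurface.real_heights hd0 hΨ hΞ,
    fun _ _ hΨ hΞ => LipschitzSurface.integral_heights hd0 hΨ hΞ⟩
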